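/- All vector spaces are over $\mathbb{C}$ and $\mathbb{Z}$-graded, and signs follow the Koszul rule. An $L_\infty$-algebra $(\mathcal{H}_c,\mathfrak{l})$ is given by graded symmetric degree-one maps $l_k:\mathcal{H}_c^{\otimes k}\to\mathcal{H}_c$, $k\ge1$, with $$\sum_{p+r=n}\sum_{\sigma\in\mathfrak{S}_n}\frac{\pm1}{p!\,r!}\,l_{1+r}(l_p(c_{\sigma(1)},\dots,c_{\sigma(p)}),c_{\sigma(p+1)},\dots,c_{\sigma(n)})=0 .$$ A (weak) $A_\infty$-algebra $(\mathcal{H}_o,\mathfrak{m})$ is given by degree-one maps $m_k:\mathcal{H}_o^{\otimes k}\to\mathcal{H}_o$, $k\ge1$ (weak: $k\ge0$), with $\mathfrak{m}\circ\mathfrak{m}=0$, where for $m'$ of degree $r'$ $$(m\circ m')(o_1,\dots,o_N)=\sum_{i+s+j=N}(-1)^{r'(o_1+\cdots+o_i)}m_{i+1+j}(o_1,\dots,o_i,m'_s(o_{i+1},\dots,o_{i+s}),o_{i+s+1},\dots,o_N).$$ An open-closed homotopy algebra (OCHA) $(\mathcal{H}_c\oplus\mathcal{H}_o,\mathfrak{l},\mathfrak{n})$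 is an $L_\infty$-algebra $(\mathcal{H}_c,\mathfrak{l})$ with degree-one maps $n_{k,q}:\mathcal{H}_c^{\otimes k}\otimes\mathcal{H}_o^{\otimes q}\to\mathcal{H}_o$, graded symmetric in the closed arguments, $n_{0,0}=0$, such that $$\sum_{p+r=n}\sum_{\sigma\in\mathfrak{S}_n}\frac{\pm1}{p!\,r!}\Big(n_{1+r,m}(l_p(c_{\sigma(1)},\dots,c_{\sigma(p)}),c_{\sigma(p+1)},\dots,c_{\sigma(n)};o_1,\dots,o_m)$$ $$\qquad+\sum_{i+s+j=m}\pm\, n_{p,i+1+j}(c_{\sigma(1)},\dots,c_{\sigma(p)};o_1,\dots,o_i,n_{r,s}(c_{\sigma(p+1)},\dots,c_{\sigma(n)};o_{i+1},\dots,o_{i+s}),o_{i+s+1},\dots,o_m)\Big)=0 .$$ Let $\mathrm{Hom}^r=\prod_{k\ge0}\mathrm{Hom}^r(\mathcal{H}_o^{\otimes k},\mathcal{H}_o)$ with the Gerstenhaber bracket $[m,m']=m\circ m'-(-1)^{rr'}m'\circ m$ for $m\in\mathrm{Hom}^r$, $m'\in\mathrm{Hom}^{r'}$. For an $A_\infty$-algebra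 $(\mathcal{H}_o,\mathfrak{m})$, its suspended Hochschild DGLA $(\mathcal{H}'_c,\mathfrak{l}')=\mathrm{Coder}(T^c\mathcal{H}_o)[1]$ is the $L_\infty$-algebra with $\mathcal{H}_c'^{\,r}=\mathrm{Hom}^{r+1}$, $l'_1(sx)=-s[\mathfrak{m},x]$, $l'_2(sx,sy)=(-1)^a s[x,y]$ for $x\in\mathrm{Hom}^a$, and $l'_k=0$ for $k\ge3$. For an $L_\infty$-algebra $(\mathcal{H},\mathfrak{l})$, let $\mathcal{MC}(\mathcal{H},\mathfrak{l})$ be the set of $c\in\nu\mathcal{H}^0[[\nu]]$ with $\sum_{k\ge1}\frac1{k!}l_k(c,\dots,c)=0$, and let $\mathcal{M}(\mathcal{H},\mathfrak{l})=\mathcal{MC}(\mathcal{H},\mathfrak{l})/\!\sim$, where gauge equivalence $\sim$ is the equivalence relation generated by $c(0)\sim c(1)$ whenever $c(t)\in\nu\mathcal{H}^0[[\nu]]$ and $\alpha(t)\in\nu\mathcal{H}^{-1}[[\nu]]$ have $\nu$-coefficients polynomial in $t$ and $\frac{dc}{dt}=\sum_{k\ge0}\frac1{k!}l_{k+1}(\alpha,c,\dots,c)$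 (with $c(0),c(1)\in\mathcal{MC}$). A weak $A_\infty$-deformation of $(\mathcal{H}_o,\mathfrak{m})$ is a formal power series $M=\sum_{N\ge0}\nu^N M_N$ with $M_N\in\mathrm{Hom}^1$, $M_0=\mathfrak{m}$ and $M\circ M=0$; that is, a weak $A_\infty$-structure on $\mathcal{H}_o[[\nu]]$ reducing to $\mathfrak{m}$ at $\nu=0$. **Corollary.** Let $(\mathcal{H}_c,\mathfrak{l})$ be an $L_\infty$-algebra, $(\mathcal{H}_o,\mathfrak{m})$ an $A_\infty$-algebra, and $(\mathcal{H}_c\oplus\mathcal{H}_o,\mathfrak{l},\mathfrak{n})$ an OCHA with $n_{0,k}=m_k$ for all $k$. For $c\in\mathcal{MC}(\mathcal{H}_c,\mathfrak{l})$ put $\theta(c)=\big(\sum_{k\ge1}\frac1{k!}n_{k,q}(c,\dots,c;\,\cdot\,)\big)_{q\ge0}$. 1. For every $c\in\mathcal{MC}(\mathcal{H}_c,\mathfrak{l})$, $\mathfrak{m}+\theta(c)$ is a weak $A_\infty$-deformation of $(\mathcal{H}_o,\mathfrak{m})$. 2. A series $\theta$ with coefficients in $\prod_{k\ge0}\mathrm{Hom}(\mathcal{H}_o^{\otimes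 k},\mathcal{H}_o)$ lies in $\mathcal{MC}(\mathcal{H}'_c,\mathfrak{l}')$ if and only if $\mathfrak{m}+\theta$ is a weak $A_\infty$-deformation of $(\mathcal{H}_o,\mathfrak{m})$; so $\mathcal{M}(\mathcal{H}'_c,\mathfrak{l}')$ is the set of (gauge) equivalence classes of weak $A_\infty$-deformations. 3. The map $c\mapsto\theta(c)$ induces a well-defined map $\mathcal{M}(\mathcal{H}_c,\mathfrak{l})\to\mathcal{M}(\mathcal{H}'_c,\mathfrak{l}')$. If $\{n_{1,k}\}_{k\ge0}:(\mathcal{H}_c,l_1)\to(\mathcal{H}'_c,l'_1)$ is a quasi-isomorphism of complexes, then this map is a bijection; that is, the equivalence classes of weak $A_\infty$-deformations of $(\mathcal{H}_o,\mathfrak{m})$ are in one-to-one correspondence with $\mathcal{M}(\mathcal{H}_c,\mathfrak{l})$. -/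

import Mathlib

open scoped DirectSum

noncomputable section

namespace OpenClosed

universe u v

/-! ### Graded multilinear algebra -/

section Graded

variable {V : Type u} [AddCommGroup V] [Module ℂ V]

/-- The linear operator `v ↦ (-1)^(r * deg v) v` on a graded vector space. It carries the Koszul sign
produced by moving an object of degree `r` past a vector. -/
def signOp (gr : ℤ → Submodule ℂ V) [DirectSum.Decomposition gr] (r : ℤ) : V →ₗ[ℂ] V :=
  (DirectSum.toModule ℂ ℤ V fun d => (r * d).negOnePow • (gr d).subtype) ∘ₗ
    (DirectSum.decomposeLinearEquiv gr).toLinearMap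

theorem signOp_of_mem (gr : ℤ → Submodule ℂ V) [DirectSum.Decomposition gr] (r : ℤ) {d : ℤ} {x : V}
    (hx : x ∈ gr d) : signOp gr r x = (r * d).negOnePow • x := by
  simp only [signOp, LinearMap.comp_apply, LinearEquiv.coe_coe,
    DirectSum.decomposeLinearEquiv_apply, DirectSum.decompose_of_mem gr hx]
  change (DirectSum.toModule ℂ ℤ V fun d => (r * d).negOnePow • (gr d).subtype)
    (DirectSum.lof ℂ ℤ (fun i => gr i) d ⟨x, hx⟩) = _
  rw [DirectSum.toModule_lof]
  rfl

/-- The Koszul sign exponent of the permutation `σ` of homogeneous elements of degrees `d`: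
the sum of `d (σ i) * d (σ j)` over the inversions `i < j`, `σ j < σ i`. -/
def koszul {n : ℕ} (d : Fin n → ℤ) (σ : Equiv.Perm (Fin n)) : ℤ :=
  ∑ i, ∑ j, if i < j ∧ σ j < σ i then d (σ i) * d (σ j) else 0

/-- The consecutive entries `x_{i+1}, …, x_{i+s}` of a tuple `x_1, …, x_N`. -/
def block {X : Type*} {N : ℕ} (i s : ℕ) (h : i + s ≤ N) (x : Fin N → X) : Fin s → X :=
  fun y => x ⟨i + y.1, by omega⟩

/-- The tuple `x_1, …, x_i, v, x_{i+s+1}, …, x_N` of length `i + 1 + (N - i - s)`. -/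
def insertBlock {X : Type*} {N : ℕ} (i s : ℕ) (h : i + s ≤ N) (x : Fin N → X) (v : X) :
    Fin (i + 1 + (N - i - s)) → X :=
  fun a => if h₁ : a.1 < i then x ⟨a.1, by omega⟩
    else if h₂ : a.1 = i then v
    else x ⟨a.1 - 1 + s, by omega⟩

variable (V) in
/-- Families `(m_k)_{k ≥ 0}` of multilinear maps `m_k : V^{⊗k} → V`; equivalently, coderivations of
the tensor coalgebra of `V`. -/
abbrev Multi : Type u := ∀ k : ℕ, MultilinearMap ℂ (fun _ : Fin k => V) V

/-- The subspace `Hom^r` of families all of whose members have degree `r`. -/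
def homDeg (gr : ℤ → Submodule ℂ V) (r : ℤ) : Submodule ℂ (Multi V) where
  carrier := {m | ∀ (k : ℕ) (d : Fin k → ℤ) (x : Fin k → V),
    (∀ i, x i ∈ gr (d i)) → m k x ∈ gr (∑ i, d i + r)}
  add_mem' := fun ha hb k d x hx => (gr _).add_mem (ha k d x hx) (hb k d x hx)
  zero_mem' := fun _ _ _ _ => (gr _).zero_mem
  smul_mem' := fun c _ ha k d x hx => (gr _).smul_mem c (ha k d x hx)

theorem insertBlock_eq_update {X : Type*} {N : ℕ} (i s : ℕ) (h : i + s ≤ N) (x : Fin N → X)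
    (v w : X) : insertBlock i s h x w =
      Function.update (insertBlock i s h x v) ⟨i, by omega⟩ w := by
  funext b
  by_cases hb : b = ⟨i, by omega⟩
  · subst hb; simp [insertBlock]
  · rw [Function.update_of_ne hb]
    have : b.1 ≠ i := fun hh => hb (Fin.ext hh)
    simp [insertBlock, this]

theorem insertBlock_update_of_mem {X : Type*} {N : ℕ} (i s : ℕ) (h : i + s ≤ N)
    (f : Fin N → X → X) (a : Fin N) (ha : i ≤ a.1 ∧ a.1 < i + s) (o : Fin N → X) (x w : X) :
    insertBlock i s h (fun b => f b (Function.update o a x b)) w =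
      insertBlock i s h (fun b => f b (o b)) w := by
  have key : ∀ b : Fin N, ¬ (i ≤ b.1 ∧ b.1 < i + s) → Function.update o a x b = o b := by
    intro b hb
    apply Function.update_of_ne
    rintro rfl
    exact hb ha
  funext b
  simp only [insertBlock]
  split_ifs with h₁ h₂
  · rw [key]; simp only; omega
  · rfl
  · rw [key]; simp only; omega

theorem exists_insertBlock_update {X : Type*} {N : ℕ} (i s : ℕ) (h : i + s ≤ N)
    (f : Fin N → X → X) (a : Fin N) (ha : ¬ (i ≤ a.1 ∧ a.1 < i + s)) :
    ∃ a' : Fin (i + 1 + (N - i - s)), ∀ (o : Fin N → X) (x w : X),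
      insertBlock i s h (fun b => f b (Function.update o a x b)) w =
        Function.update (insertBlock i s h (fun b => f b (o b)) w) a' (f a x) := by
  refine ⟨⟨if a.1 < i then a.1 else a.1 + 1 - s, by have := a.2; split_ifs <;> omega⟩, ?_⟩
  intro o x w
  have key : ∀ b : Fin N, b ≠ a → Function.update o a x b = o b :=
    fun b hb => Function.update_of_ne hb _ _
  funext b
  by_cases hb : b = ⟨if a.1 < i then a.1 else a.1 + 1 - s, by have := a.2; split_ifs <;> omega⟩
  · rw [hb, Function.update_self]
    simp only [insertBlock]
    by_cases hi : a.1 < i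
    · simp [hi]
    · have h₁ : ¬ (a.1 + 1 - s < i) := by omega
      have h₂ : ¬ (a.1 + 1 - s = i) := by omega
      have h₃ : a.1 + 1 - s - 1 + s = a.1 := by omega
      simp [hi, h₁, h₂, h₃]
  · rw [Function.update_of_ne hb]
    have hb' : b.1 ≠ if a.1 < i then a.1 else a.1 + 1 - s := fun hh => hb (Fin.ext hh)
    simp only [insertBlock]
    split_ifs with h₁ h₂
    · rw [key]
      intro hh
      have := congrArg Fin.val hh
      simp only at this
      split_ifs at hb' <;> omega
    · rfl
    · rw [key]
      intro hh
      have := congrArg Fin.val hh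
      simp only at this
      split_ifs at hb' <;> omega

theorem block_update_of_mem {X : Type*} {N : ℕ} (i s : ℕ) (h : i + s ≤ N)
    (a : Fin N) (ha : i ≤ a.1 ∧ a.1 < i + s) (o : Fin N → X) (x : X) :
    block i s h (Function.update o a x) =
      Function.update (block i s h o) ⟨a.1 - i, by omega⟩ x := by
  funext b
  simp only [block, Function.update_apply, Fin.ext_iff]
  have : i + b.1 = a.1 ↔ b.1 = a.1 - i := by omega
  simp only [this]

theorem block_update_of_notMem {X : Type*} {N : ℕ} (i s : ℕ) (h : i + s ≤ N)
    (a : Fin N) (ha : ¬ (i ≤ a.1 ∧ a.1 < i + s)) (o : Fin N → X) (x : X) :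
    block i s h (Function.update o a x) = block i s h o := by
  funext b
  simp only [block]
  apply Function.update_of_ne
  intro hh
  have := congrArg Fin.val hh
  simp only at this
  omega

/-- The multilinear map
`(o_1, …, o_N) ↦ m (ε o_1, …, ε o_i, m' (o_{i+1}, …, o_{i+s}), o_{i+s+1}, …, o_N)`. -/
def compAt (ε : V →ₗ[ℂ] V) {N : ℕ} (i s : ℕ) (h : i + s ≤ N)
    (m : MultilinearMap ℂ (fun _ : Fin (i + 1 + (N - i - s)) => V) V)
    (m' : MultilinearMap ℂ (fun _ : Fin s => V) V) :
    MultilinearMap ℂ (fun _ : Fin N => V) V where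
  toFun o := m (insertBlock i s h (fun b => if b.1 < i then ε (o b) else o b)
    (m' (block i s h o)))
  map_update_add' := by
    intro inst o a x y
    cases Subsingleton.elim inst (instDecidableEqFin N)
    by_cases ha : i ≤ a.1 ∧ a.1 < i + s
    · have key := insertBlock_update_of_mem i s h (fun b z => if b.1 < i then ε z else z) a ha o
      beta_reduce at key
      simp only [key, block_update_of_mem i s h a ha, MultilinearMap.map_update_add]
      rw [insertBlock_eq_update i s h _ 0 (_ + _), MultilinearMap.map_update_add,
        ← insertBlock_eq_update, ← insertBlock_eq_update]
    · obtain ⟨a', key⟩ :=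
        exists_insertBlock_update i s h (fun b z => if b.1 < i then ε z else z) a ha
      simp only [block_update_of_notMem i s h a ha, key]
      rw [← MultilinearMap.map_update_add]
      congr 2
      split_ifs <;> simp
  map_update_smul' := by
    intro inst o a c x
    cases Subsingleton.elim inst (instDecidableEqFin N)
    by_cases ha : i ≤ a.1 ∧ a.1 < i + s
    · have key := insertBlock_update_of_mem i s h (fun b z => if b.1 < i then ε z else z) a ha o
      beta_reduce at key
      simp only [key, block_update_of_mem i s h a ha, MultilinearMap.map_update_smul]
      rw [insertBlock_eq_update i s h _ 0 (_ • _), MultilinearMap.map_update_smul,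
        ← insertBlock_eq_update]
    · obtain ⟨a', key⟩ :=
        exists_insertBlock_update i s h (fun b z => if b.1 < i then ε z else z) a ha
      simp only [block_update_of_notMem i s h a ha, key]
      rw [← MultilinearMap.map_update_smul]
      congr 2
      split_ifs <;> simp

/-- The composition `m ∘ m'` for `m'` of degree `r'`: on homogeneous `o_1, …, o_N` it is the sum over
`i + s + j = N` of
`(-1)^(r' (o_1 + ⋯ + o_i)) m_{i+1+j} (o_1, …, o_i, m'_s (o_{i+1}, …, o_{i+s}), …, o_N)`. -/
def circ (gr : ℤ → Submodule ℂ V) [DirectSum.Decomposition gr] (r' : ℤ) (m m' : Multi V) :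
    Multi V := fun N =>
  ∑ i : Fin (N + 1), ∑ s : Fin (N + 1 - i.1),
    compAt (signOp gr r') i.1 s.1 (by omega) (m (i.1 + 1 + (N - i.1 - s.1))) (m' s.1)

/-- The Gerstenhaber bracket `[m, m'] = m ∘ m' - (-1)^(r r') m' ∘ m` for `m` of degree `r` and `m'`
of degree `r'`. -/
def bracket (gr : ℤ → Submodule ℂ V) [DirectSum.Decomposition gr] (r r' : ℤ) (m m' : Multi V) :
    Multi V :=
  circ gr r' m m' - (r * r').negOnePow • circ gr r m' m

/-! ### Homotopy algebras -/

/-- The structure of an `A_∞`-algebra on the graded vector space `V = ⨁ V^r`: multilinear maps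
`m_k`, `k ≥ 1` (that is, `m_0 = 0`), of degree one satisfying the `A_∞`-relations
`∑ (-1)^(o_1 + ⋯ + o_j) m_k (o_1, …, o_j, m_l (o_{j+1}, …, o_{j+l}), …, o_n) = 0`. -/
structure AInftyAlgebra (gr : ℤ → Submodule ℂ V) [DirectSum.Decomposition gr] where
  m : Multi V
  m_zero : m 0 = 0
  m_degree : m ∈ homDeg gr 1
  m_rel : circ gr 1 m m = 0

/-- A weak `A_∞`-deformation of `m` over `ℂ⟦ν⟧`: a formal family `M = ∑ ν^N M_N` of families
`(M_{N,k})_{k ≥ 0}` of degree one multilinear maps which specializes to `m` at `ν = 0` and satisfies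
the weak `A_∞`-relations (compared coefficientwise in `ν`), so that its `ℂ⟦ν⟧`-linear extension is a
weak `A_∞`-structure on `V⟦ν⟧`. -/
def IsWeakAInftyDeformation (gr : ℤ → Submodule ℂ V) [DirectSum.Decomposition gr]
    (m : Multi V) (M : ℕ → Multi V) : Prop :=
  M 0 = m ∧ (∀ N, M N ∈ homDeg gr 1) ∧
    ∀ N, ∑ ab ∈ Finset.HasAntidiagonal.antidiagonal N, circ gr 1 (M ab.1) (M ab.2) = 0

/-- The structure of an `L_∞`-algebra on the graded vector space `V = ⨁ V^r`: graded symmetric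
multilinear maps `l_k`, `k ≥ 1` (that is, `l_0 = 0`), of degree one satisfying the
`L_∞`-relations. -/
structure LInftyAlgebra (gr : ℤ → Submodule ℂ V) where
  l : ∀ k : ℕ, MultilinearMap ℂ (fun _ : Fin k => V) V
  l_zero : l 0 = 0
  l_degree : ∀ (k : ℕ) (d : Fin k → ℤ) (c : Fin k → V), (∀ i, c i ∈ gr (d i)) →
    l k c ∈ gr (∑ i, d i + 1)
  l_symm : ∀ (k : ℕ) (σ : Equiv.Perm (Fin k)) (d : Fin k → ℤ) (c : Fin k → V),
    (∀ i, c i ∈ gr (d i)) → l k c = (koszul d σ).negOnePow • l k (fun i => c (σ i))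
  l_rel : ∀ (n : ℕ) (d : Fin n → ℤ) (c : Fin n → V), (∀ i, c i ∈ gr (d i)) →
    ∑ p : Fin (n + 1), ∑ σ : Equiv.Perm (Fin n),
      ((p.1.factorial * (n - p.1).factorial : ℂ)⁻¹) • (koszul d σ).negOnePow •
        l (n - p.1 + 1) (Fin.cons (l p.1 (fun i => c (σ ⟨i.1, by omega⟩)))
          (fun i => c (σ ⟨p.1 + i.1, by omega⟩))) = 0

end Graded

/-- An open-closed homotopy algebra (OCHA) on `Hc ⊕ Ho`: an `L_∞`-algebra on `Hc` together with
multilinear maps `n_{k,q} : Hc^{⊗k} ⊗ Ho^{⊗q} → Ho` of degree one, graded symmetric in the closed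
arguments, with `n_{0,0} = 0`, satisfying the open-closed relations. -/
structure OCHA {Hc : Type u} [AddCommGroup Hc] [Module ℂ Hc] (grc : ℤ → Submodule ℂ Hc)
    {Ho : Type v} [AddCommGroup Ho] [Module ℂ Ho] (gro : ℤ → Submodule ℂ Ho)
    extends LInftyAlgebra grc where
  n : ∀ k q : ℕ, MultilinearMap ℂ (fun _ : Fin k => Hc)
    (MultilinearMap ℂ (fun _ : Fin q => Ho) Ho)
  n_zero : n 0 0 = 0
  n_degree : ∀ (k q : ℕ) (dc : Fin k → ℤ) (c : Fin k → Hc) (dO : Fin q → ℤ) (o : Fin q → Ho),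
    (∀ i, c i ∈ grc (dc i)) → (∀ i, o i ∈ gro (dO i)) →
      n k q c o ∈ gro (∑ i, dc i + ∑ i, dO i + 1)
  n_symm : ∀ (k q : ℕ) (σ : Equiv.Perm (Fin k)) (d : Fin k → ℤ) (c : Fin k → Hc),
    (∀ i, c i ∈ grc (d i)) → n k q c = (koszul d σ).negOnePow • n k q (fun i => c (σ i))
  n_rel : ∀ (n' m : ℕ) (dc : Fin n' → ℤ) (c : Fin n' → Hc) (dO : Fin m → ℤ) (o : Fin m → Ho),
    (∀ i, c i ∈ grc (dc i)) → (∀ i, o i ∈ gro (dO i)) →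
    (∑ p : Fin (n' + 1), ∑ σ : Equiv.Perm (Fin n'),
      ((p.1.factorial * (n' - p.1).factorial : ℂ)⁻¹) • (koszul dc σ).negOnePow •
        n (n' - p.1 + 1) m (Fin.cons (l p.1 (fun i => c (σ ⟨i.1, by omega⟩)))
          (fun i => c (σ ⟨p.1 + i.1, by omega⟩))) o) +
    (∑ p : Fin (n' + 1), ∑ i : Fin (m + 1), ∑ s : Fin (m + 1 - i.1), ∑ σ : Equiv.Perm (Fin n'),
      ((p.1.factorial * (n' - p.1).factorial : ℂ)⁻¹) •
        (koszul dc σ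
          + ∑ a : Fin p.1, dc (σ ⟨a.1, by omega⟩)
          + ∑ b : Fin i.1, dO ⟨b.1, by omega⟩
          + (∑ b : Fin i.1, dO ⟨b.1, by omega⟩) *
            ∑ a : Fin (n' - p.1), dc (σ ⟨p.1 + a.1, by omega⟩)).negOnePow •
        n p.1 (i.1 + 1 + (m - i.1 - s.1)) (fun a => c (σ ⟨a.1, by omega⟩))
          (insertBlock i.1 s.1 (by omega) o
            (n (n' - p.1) s.1 (fun a => c (σ ⟨p.1 + a.1, by omega⟩))
              (block i.1 s.1 (by omega) o)))) = 0

/-! ### Formal Maurer–Cartan moduli spaces -/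

/-- A graded vector space with its pieces `deg r` inside an ambient space `V` (the ambient space may
be larger than the sum of the pieces), together with operations: `op k d` is the `k`-ary operation
on elements of degrees `d 0, …, d (k - 1)`. -/
structure GradedOps (V : Type u) [AddCommGroup V] [Module ℂ V] where
  deg : ℤ → Submodule ℂ V
  op : ∀ k : ℕ, (Fin k → ℤ) → (Fin k → V) → V

section MaurerCartan

variable {V : Type u} [AddCommGroup V] [Module ℂ V]

/-- The operations `l_k` of an `L_∞`-algebra. -/
def LInftyAlgebra.toGradedOps {gr : ℤ → Submodule ℂ V} (L : LInftyAlgebra gr) : GradedOps V where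
  deg := gr
  op k _ x := L.l k x

/-- The suspended Hochschild DGLA `Coder(T^c V)[1]` of `m`, as an `L_∞`-algebra: its degree `r`
piece is `Hom^{r+1}`, its differential is `l'_1 (s x) = -s [m, x]`, its binary operation is
`l'_2 (s x, s y) = (-1)^a s [x, y]` for `x ∈ Hom^a`, and the other operations vanish. -/
def hochschildOps (gr : ℤ → Submodule ℂ V) [DirectSum.Decomposition gr] (m : Multi V) :
    GradedOps (Multi V) where
  deg r := homDeg gr (r + 1)
  op k := match k with
    | 1 => fun d x => -bracket gr 1 (d 0 + 1) m (x 0)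
    | 2 => fun d x => (d 0 + 1).negOnePow • bracket gr (d 0 + 1) (d 1 + 1) (x 0) (x 1)
    | _ => fun _ _ => 0

namespace GradedOps

variable (G : GradedOps V)

/-- A formal power series `c = ∑ ν^N c_N` is represented by its sequence of coefficients `c : ℕ → V`.
The set `MC` consists of the series `c ∈ ν V^0⟦ν⟧` with `∑_{k ≥ 1} (1/k!) l_k (c, …, c) = 0`.
As `c` has no constant term, only the terms with `k ≤ N` contribute to the coefficient
of `ν^N`. -/
def MC : Set (ℕ → V) :=
  {c | c 0 = 0 ∧ (∀ N, c N ∈ G.deg 0) ∧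
    ∀ N, ∑ k ∈ Finset.Icc 1 N, ((k.factorial : ℂ)⁻¹) •
      ∑ i ∈ Finset.Nat.antidiagonalTuple k N, G.op k (fun _ => 0) (fun a => c (i a)) = 0}

/-- The value at `t` of the polynomial `∑ t^j p_j` with coefficients in `V`. -/
def polyEval (t : ℂ) (p : ℕ →₀ V) : V := p.sum fun j v => t ^ j • v

/-- The value at `t` of the derivative of the polynomial `∑ t^j p_j` with coefficients in `V`. -/
def polyDerivEval (t : ℂ) (p : ℕ →₀ V) : V := p.sum fun j v => ((j : ℂ) * t ^ (j - 1)) • v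

/-- `c₀` and `c₁` are joined by a polynomial gauge path: there are
`c (t) ∈ ν V^0⟦ν⟧` and `α (t) ∈ ν V^{-1}⟦ν⟧`, each coefficient of which is polynomial in `t`, with
`c (0) = c₀`, `c (1) = c₁` and
`dc/dt = ∑_{k ≥ 0} (1/k!) l_{k+1} (α (t), c (t), …, c (t))`. -/
def GaugePath (c₀ c₁ : ℕ → V) : Prop :=
  ∃ (c α : ℕ → ℕ →₀ V),
    c 0 = 0 ∧ α 0 = 0 ∧
    (∀ N j, c N j ∈ G.deg 0) ∧ (∀ N j, α N j ∈ G.deg (-1)) ∧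
    (∀ N, polyEval 0 (c N) = c₀ N) ∧ (∀ N, polyEval 1 (c N) = c₁ N) ∧
    ∀ (t : ℂ) (N : ℕ), polyDerivEval t (c N) =
      ∑ k ∈ Finset.range N, ((k.factorial : ℂ)⁻¹) •
        ∑ i ∈ Finset.Nat.antidiagonalTuple (k + 1) N,
          G.op (k + 1) (Fin.cons (-1) fun _ => 0)
            (Fin.cons (polyEval t (α (i 0))) fun a => polyEval t (c (i a.succ)))

/-- Gauge equivalence of Maurer–Cartan elements: they are joined by a finite chain of polynomial
gauge paths. -/
def gaugeSetoid : Setoid G.MC :=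
  Relation.EqvGen.setoid fun c₀ c₁ => G.GaugePath c₀ c₁

/-- The Maurer–Cartan moduli space. -/
def Moduli : Type u := Quotient G.gaugeSetoid

/-- The gauge equivalence class of a Maurer–Cartan element. -/
def toModuli (c : ℕ → V) (hc : c ∈ G.MC) : G.Moduli := Quotient.mk G.gaugeSetoid ⟨c, hc⟩

/-- The unary operation, on elements of degree `r`. -/
def diff (r : ℤ) (x : V) : V := G.op 1 (fun _ => r) (fun _ => x)

/-- `f` is a quasi-isomorphism of complexes with respect to the unary operations: a degree zero
chain map which is bijective on cohomology in every degree. -/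
def IsQuasiIso {W : Type v} [AddCommGroup W] [Module ℂ W] (G : GradedOps V) (G' : GradedOps W)
    (f : V → W) : Prop :=
  (∀ r, ∀ x ∈ G.deg r, f x ∈ G'.deg r) ∧
  (∀ r, ∀ x ∈ G.deg r, f (G.diff r x) = G'.diff r (f x)) ∧
  (∀ r, ∀ x ∈ G.deg r, G.diff r x = 0 → (∃ y ∈ G'.deg (r - 1), f x = G'.diff (r - 1) y) →
    ∃ z ∈ G.deg (r - 1), x = G.diff (r - 1) z) ∧
  (∀ r, ∀ y ∈ G'.deg r, G'.diff r y = 0 →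
    ∃ x ∈ G.deg r, G.diff r x = 0 ∧ ∃ w ∈ G'.deg (r - 1), y - f x = G'.diff (r - 1) w)

end GradedOps

end MaurerCartan

namespace OCHA

variable {Hc : Type u} [AddCommGroup Hc] [Module ℂ Hc] {grc : ℤ → Submodule ℂ Hc}
  {Ho : Type v} [AddCommGroup Ho] [Module ℂ Ho] {gro : ℤ → Submodule ℂ Ho}

/-- The closed arguments `c_1, …, c_k` give the family `(n_{k,q} (c_1, …, c_k; …))_{q ≥ 0}`
of multilinear maps on `Ho`. -/
def nStar (H : OCHA grc gro) (k : ℕ) (c : Fin k → Hc) : Multi Ho := fun q => H.n k q c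

/-- The formal series `∑_{k ≥ 1} (1/k!) n_{k,•} (c, …, c; …)` for `c ∈ ν Hc⟦ν⟧`. -/
def perturbation (H : OCHA grc gro) (c : ℕ → Hc) : ℕ → Multi Ho := fun N =>
  ∑ k ∈ Finset.Icc 1 N, ((k.factorial : ℂ)⁻¹) •
    ∑ i ∈ Finset.Nat.antidiagonalTuple k N, H.nStar k (fun a => c (i a))

end OCHA

end OpenClosed

end

open scoped DirectSum

noncomputable section

namespace OpenClosed

/-! ### Polynomial functions with values in a vector space -/

section PolyDeriv

open GradedOps

variable {V : Type*} [AddCommGroup V] [Module ℂ V] {W : Type*} [AddCommGroup W] [Module ℂ W]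

/-! The composition `circ` is not associative, so it is moved into an associative algebra. Write
`R_x` for right multiplication `X ↦ X ∘ x` on families of multilinear maps. By the pre-Lie identity
`circ_circ_sub`, graded commutators of such operators are again right multiplications, and
evaluating `R_x` at the identity family returns `x`. A weak A∞-structure `M` therefore becomes a
power series `R_M` with `R_M * R_M = 0`. With `M = m + θ` this is the Hochschild Maurer–Cartan
equation for `θ`, and the Hochschild gauge flow becomes `R_M' = R_M a - a R_M`, where `a` has
coefficients in the Lie algebra of degree-zero right multiplications.

The gauge group consists of the series `φ` with constant term 1 for which `φ⁻¹ (ν dφ/dν)` has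
coefficients in that Lie algebra; no Baker–Campbell–Hausdorff formula is needed. The holonomy of a
polynomial path in the Lie algebra is group-like (`exists_holonomy`), and conversely a group-like
`φ(ν)` is the end of the path `φ(tν)`. Hence Hochschild gauge equivalence is exactly `g R_{M'} = R_M
g` for a group-like `g` (`hochschildOps_gaugeSetoid_iff`).

On the open-closed side, the relations have the form `w ∘ l + B(w, w) = 0`. Inserting `(c, …, c)`
with weights `1/k!`, and writing `M(c) = m + θ(c)`, gives `∑ (1/k!) n_{k+1}(curvature of c, c, …, c)
+ M(c) ∘ M(c) = 0` (`QuadRel.expSum_rel`); this proves the first statement. Its linearization in a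
direction of degree -1 (`QuadRel.expSum₁_rel`) shows that along a gauge flow of `c` the series
`R_{M(c)}` obeys the commutator equation, so gauge equivalent `c` have conjugate `M(c)` and the map
on moduli is well defined.

Bijectivity is obstruction theory in powers of `ν`, carried out without minimal models or homotopy
inverses. The induction always carries the intertwining series along with the Maurer–Cartan data.
For surjectivity (`OCHA.exists_MC_intertwined`), `c` and a series `g = exp(R_w)` with `g R_{M(c)} =
R_{m+θ} g` are built together: the defects of the two equations at order `N` satisfy one cocycle
relation, and the quasi-isomorphism supplies corrections killing both. For injectivity
(`OCHA.gaugePath_of_intertwined`), given `g` intertwining `M(c)` and `M(c')`, a parameter `β` is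
built whose flow carries `c` to `c'`. Its holonomy is required to equal `g` times a stabilizer
element `exp(R_{M'} R_u + R_u R_{M'})`, and this extra freedom absorbs the exact part of the error.
-/

theorem polyEval_eq_sum (t : ℂ) (p : ℕ →₀ V) {s : Finset ℕ} (hs : p.support ⊆ s) :
    polyEval t p = ∑ j ∈ s, t ^ j • p j :=
  Finsupp.sum_of_support_subset _ hs _ (by simp)

theorem polyDerivEval_eq_sum (t : ℂ) (p : ℕ →₀ V) {s : Finset ℕ} (hs : p.support ⊆ s) :
    polyDerivEval t p = ∑ j ∈ s, ((j : ℂ) * t ^ (j - 1)) • p j :=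
  Finsupp.sum_of_support_subset _ hs _ (by simp)

@[simp] theorem polyEval_single (t : ℂ) (j : ℕ) (v : V) :
    polyEval t (Finsupp.single j v) = t ^ j • v := by simp [polyEval]

@[simp] theorem polyDerivEval_single (t : ℂ) (j : ℕ) (v : V) :
    polyDerivEval t (Finsupp.single j v) = ((j : ℂ) * t ^ (j - 1)) • v := by simp [polyDerivEval]

theorem polyEval_add (t : ℂ) (p q : ℕ →₀ V) : polyEval t (p + q) = polyEval t p + polyEval t q :=
  Finsupp.sum_add_index' (by simp) (by simp)

theorem polyDerivEval_add (t : ℂ) (p q : ℕ →₀ V) :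
    polyDerivEval t (p + q) = polyDerivEval t p + polyDerivEval t q :=
  Finsupp.sum_add_index' (by simp) (by simp)

theorem polyEval_sum {ι : Type*} (t : ℂ) (s : Finset ι) (p : ι → ℕ →₀ V) :
    polyEval t (∑ i ∈ s, p i) = ∑ i ∈ s, polyEval t (p i) :=
  map_sum (AddMonoidHom.mk' (polyEval t) (polyEval_add t)) p s

theorem polyEval_smul (t a : ℂ) (p : ℕ →₀ V) : polyEval t (a • p) = a • polyEval t p := by
  rw [polyEval_eq_sum t (a • p) Finsupp.support_smul, polyEval_eq_sum t p subset_rfl,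
    Finset.smul_sum]
  exact Finset.sum_congr rfl fun j _ => by rw [Finsupp.smul_apply, smul_comm]

theorem polyEval_mapRange (f : V →ₗ[ℂ] W) (t : ℂ) (p : ℕ →₀ V) :
    polyEval t (p.mapRange f f.map_zero) = f (polyEval t p) := by
  rw [polyEval_eq_sum t _ Finsupp.support_mapRange, polyEval_eq_sum t p subset_rfl]
  simp

theorem polyDerivEval_mapRange (f : V →ₗ[ℂ] W) (t : ℂ) (p : ℕ →₀ V) :
    polyDerivEval t (p.mapRange f f.map_zero) = f (polyDerivEval t p) := by
  rw [polyDerivEval_eq_sum t _ Finsupp.support_mapRange, polyDerivEval_eq_sum t p subset_rfl]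
  simp

/-- Linear functionals separate points, and after applying one the claim is that a scalar polynomial
with infinitely many roots vanishes. -/
theorem polyEval_injective {p : ℕ →₀ V} (h : ∀ t : ℂ, t ≠ 0 → polyEval t p = 0) : p = 0 := by
  ext j
  rw [Finsupp.zero_apply, ← Module.forall_dual_apply_eq_zero_iff ℂ]
  intro φ
  set P : Polynomial ℂ := ∑ i ∈ p.support, Polynomial.monomial i (φ (p i)) with hP
  have h0 : P = 0 := by
    refine Polynomial.eq_zero_of_infinite_isRoot _ ((Set.finite_singleton (0 : ℂ)).infinite_compl.mono ?_)
    intro t ht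
    have := congrArg φ (h t (by simpa using ht))
    rw [polyEval_eq_sum t p subset_rfl, map_sum, map_zero] at this
    simp only [Set.mem_ofPred_eq, Polynomial.IsRoot.def, hP, Polynomial.eval_finsetSum,
      Polynomial.eval_monomial]
    rw [← this]
    exact Finset.sum_congr rfl fun i _ => by rw [map_smul, smul_eq_mul, mul_comm]
  have := congrArg (fun Q => Polynomial.coeff Q j) h0
  simp only [hP, Polynomial.finsetSum_coeff, Polynomial.coeff_monomial, Polynomial.coeff_zero] at this
  rw [Finset.sum_ite_eq'] at this
  split_ifs at this with hj
  · exact this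
  · rw [Finsupp.notMem_support_iff.mp hj, map_zero]

/-- `f : ℂ → V` is a polynomial function whose derivative is `f'`. -/
def PolyDeriv (f f' : ℂ → V) : Prop :=
  ∃ p : ℕ →₀ V, (∀ t, f t = polyEval t p) ∧ ∀ t, f' t = polyDerivEval t p

/-- `f : ℂ → V` is a polynomial function. -/
def IsPolyFun (f : ℂ → V) : Prop := ∃ p : ℕ →₀ V, ∀ t, f t = polyEval t p

theorem PolyDeriv.isPolyFun {f f' : ℂ → V} (h : PolyDeriv f f') : IsPolyFun f :=
  let ⟨p, hp, _⟩ := h; ⟨p, hp⟩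

theorem IsPolyFun.exists_polyDeriv {f : ℂ → V} (h : IsPolyFun f) : ∃ f', PolyDeriv f f' :=
  let ⟨p, hp⟩ := h; ⟨_, p, hp, fun _ => rfl⟩

theorem PolyDeriv.polyDeriv_polyEval (p : ℕ →₀ V) :
    PolyDeriv (fun t => polyEval t p) (fun t => polyDerivEval t p) :=
  ⟨p, fun _ => rfl, fun _ => rfl⟩

theorem PolyDeriv.congr {f f' g g' : ℂ → V} (h : PolyDeriv f f') (h₁ : ∀ t, g t = f t)
    (h₂ : ∀ t, g' t = f' t) : PolyDeriv g g' := by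
  rwa [funext h₁, funext h₂]

theorem PolyDeriv.const (v : V) : PolyDeriv (fun _ => v) (fun _ => 0) :=
  ⟨Finsupp.single 0 v, by simp, by simp⟩

theorem PolyDeriv.add {f f' g g' : ℂ → V} (hf : PolyDeriv f f') (hg : PolyDeriv g g') :
    PolyDeriv (fun t => f t + g t) (fun t => f' t + g' t) := by
  obtain ⟨p, hp, hp'⟩ := hf
  obtain ⟨q, hq, hq'⟩ := hg
  exact ⟨p + q, fun t => by simp only [polyEval_add, hp, hq], fun t => by
    simp only [polyDerivEval_add, hp', hq']⟩

theorem PolyDeriv.sum {ι : Type*} (s : Finset ι) {f f' : ι → ℂ → V}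
    (h : ∀ i ∈ s, PolyDeriv (f i) (f' i)) :
    PolyDeriv (fun t => ∑ i ∈ s, f i t) (fun t => ∑ i ∈ s, f' i t) := by
  classical
  induction s using Finset.induction_on with
  | empty => simpa using PolyDeriv.const (0 : V)
  | insert a s ha ih =>
    simp only [Finset.sum_insert ha]
    exact (h a (by simp)).add (ih fun i hi => h i (by simp [hi]))

theorem PolyDeriv.map (φ : V →ₗ[ℂ] W) {f f' : ℂ → V} (h : PolyDeriv f f') :
    PolyDeriv (fun t => φ (f t)) (fun t => φ (f' t)) := by
  obtain ⟨p, hp, hp'⟩ := h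
  exact ⟨p.mapRange φ φ.map_zero, fun t => by simp only [polyEval_mapRange, hp],
    fun t => by simp only [polyDerivEval_mapRange, hp']⟩

theorem PolyDeriv.const_smul (a : ℂ) {f f' : ℂ → V} (h : PolyDeriv f f') :
    PolyDeriv (fun t => a • f t) (fun t => a • f' t) :=
  h.map (a • LinearMap.id)

theorem PolyDeriv.neg {f f' : ℂ → V} (h : PolyDeriv f f') :
    PolyDeriv (fun t => -f t) (fun t => -f' t) :=
  h.map (-LinearMap.id)

theorem PolyDeriv.sub {f f' g g' : ℂ → V} (hf : PolyDeriv f f') (hg : PolyDeriv g g') :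
    PolyDeriv (fun t => f t - g t) (fun t => f' t - g' t) := by
  simpa only [sub_eq_add_neg] using hf.add hg.neg

theorem PolyDeriv.linear (v : V) : PolyDeriv (fun t => t • v) (fun _ => v) :=
  ⟨Finsupp.single 1 v, by simp, by simp⟩

theorem IsPolyFun.map (φ : V →ₗ[ℂ] W) {f : ℂ → V} (h : IsPolyFun f) : IsPolyFun fun t => φ (f t) :=
  let ⟨_, h'⟩ := h.exists_polyDeriv
  (h'.map φ).isPolyFun

theorem IsPolyFun.sum {ι : Type*} (s : Finset ι) {f : ι → ℂ → V} (h : ∀ i ∈ s, IsPolyFun (f i)) :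
    IsPolyFun (fun t => ∑ i ∈ s, f i t) := by
  classical
  induction s using Finset.induction_on with
  | empty => simpa using (PolyDeriv.const (0 : V)).isPolyFun
  | insert a s ha ih =>
    simp only [Finset.sum_insert ha]
    obtain ⟨f', hf⟩ := (h a (by simp)).exists_polyDeriv
    obtain ⟨g', hg⟩ := (ih fun i hi => h i (by simp [hi])).exists_polyDeriv
    exact (hf.add hg).isPolyFun

theorem IsPolyFun.const (v : V) : IsPolyFun fun _ => v := (PolyDeriv.const v).isPolyFun

theorem IsPolyFun.pow_smul (n : ℕ) (v : V) : IsPolyFun fun t => t ^ n • v :=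
  ⟨Finsupp.single n v, by simp⟩

theorem IsPolyFun.const_smul (a : ℂ) {f : ℂ → V} (h : IsPolyFun f) : IsPolyFun fun t => a • f t :=
  h.map (a • LinearMap.id)

/-- Every polynomial function has a polynomial antiderivative with a given value at `0`. -/
theorem IsPolyFun.exists_antideriv {f : ℂ → V} (h : IsPolyFun f) (v : V) :
    ∃ F, PolyDeriv F f ∧ F 0 = v := by
  obtain ⟨p, hp⟩ := h
  refine ⟨fun t => v + ∑ j ∈ p.support, t ^ (j + 1) • ((j + 1 : ℂ)⁻¹ • p j), ?_, by simp⟩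
  refine ((PolyDeriv.const v).add (PolyDeriv.sum p.support (f := fun j t =>
    t ^ (j + 1) • ((j + 1 : ℂ)⁻¹ • p j)) (f' := fun j t => t ^ j • p j) fun j _ => ?_)).congr
    (fun _ => rfl) fun t => ?_
  · refine ⟨Finsupp.single (j + 1) ((j + 1 : ℂ)⁻¹ • p j), by simp, fun t => ?_⟩
    have : (j + 1 : ℂ) ≠ 0 := Nat.cast_add_one_ne_zero j
    rw [polyDerivEval_single, smul_smul]
    have h : ((j + 1 : ℕ) : ℂ) * t ^ (j + 1 - 1) * (j + 1 : ℂ)⁻¹ = t ^ j := by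
      rw [Nat.add_sub_cancel]
      push_cast
      field_simp
    rw [h]
  · rw [hp, zero_add, polyEval_eq_sum t p subset_rfl]

/-- Only the values of the derivative are known. The polynomial with coefficients `j • p j` has
value `t` times the derivative at `t`, so it vanishes and `p j = 0` for `j ≠ 0`. -/
theorem PolyDeriv.eq_of_zero {f : ℂ → V} (h : PolyDeriv f fun _ => 0) (t : ℂ) : f t = f 0 := by
  obtain ⟨p, hp, hp'⟩ := h
  set q : ℕ →₀ V := ∑ j ∈ p.support, Finsupp.single j ((j : ℂ) • p j) with hq
  have hq0 : q = 0 := by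
    refine polyEval_injective fun t _ => ?_
    have h1 : polyEval t q = t • polyDerivEval t p := by
      rw [polyDerivEval_eq_sum t p subset_rfl, hq, polyEval_sum, Finset.smul_sum]
      refine Finset.sum_congr rfl fun j _ => ?_
      rw [polyEval_single, smul_smul, smul_smul]
      rcases j with _ | j
      · simp
      · simp only [add_tsub_cancel_right]; congr 1; ring
    rw [h1, ← hp', smul_zero]
  have hpj : ∀ j ≠ 0, p j = 0 := by
    intro j hj
    have := DFunLike.congr_fun hq0 j
    rw [hq, Finsupp.finsetSum_apply, Finsupp.zero_apply] at this
    simp only [Finsupp.single_apply] at this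
    rw [Finset.sum_ite_eq'] at this
    split_ifs at this with h
    · exact (smul_eq_zero.mp this).resolve_left (by exact_mod_cast hj)
    · exact Finsupp.notMem_support_iff.mp h
  have hs : p = Finsupp.single 0 (p 0) := by
    ext j
    rcases eq_or_ne j 0 with rfl | hj
    · simp
    · rw [hpj j hj, Finsupp.single_eq_of_ne hj]
  rw [hp, hp, hs]
  simp

theorem PolyDeriv.eq_of_eq {f g f' : ℂ → V} (hf : PolyDeriv f f') (hg : PolyDeriv g f')
    (h0 : f 0 = g 0) (t : ℂ) : f t = g t := by
  have := PolyDeriv.eq_of_zero ((hf.sub hg).congr (fun _ => rfl) (fun t => (sub_self _).symm)) t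
  simpa [h0, sub_eq_zero] using this

/-- Modulo `S` the derivative is zero, so the image in the quotient is constant and equal to that of
`f 0`. -/
theorem PolyDeriv.mem {S : Submodule ℂ V} {f f' : ℂ → V} (h : PolyDeriv f f')
    (h' : ∀ t, f' t ∈ S) (h0 : f 0 ∈ S) (t : ℂ) : f t ∈ S := by
  have := PolyDeriv.eq_of_zero ((h.map S.mkQ).congr (fun _ => rfl)
    (fun t => ((Submodule.Quotient.mk_eq_zero S).mpr (h' t)).symm)) t
  exact (Submodule.Quotient.mk_eq_zero S).mp
    (this.trans ((Submodule.Quotient.mk_eq_zero S).mpr h0))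

theorem coeff_mem_of_polyEval_mem {S : Submodule ℂ V} {p : ℕ →₀ V} (h : ∀ t, polyEval t p ∈ S)
    (j : ℕ) : p j ∈ S := by
  have : p.mapRange S.mkQ S.mkQ.map_zero = 0 := polyEval_injective fun t _ => by
    rw [polyEval_mapRange]
    exact (Submodule.Quotient.mk_eq_zero S).mpr (h t)
  have := DFunLike.congr_fun this j
  exact (Submodule.Quotient.mk_eq_zero S).mp this

theorem PolyDeriv.polynomial_smul (P : Polynomial ℂ) (v : V) :
    PolyDeriv (fun t => P.eval t • v) (fun t => P.derivative.eval t • v) := by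
  refine ((PolyDeriv.sum P.support (f := fun j t => t ^ j • (P.coeff j • v))
    (f' := fun j t => ((j : ℂ) * t ^ (j - 1)) • (P.coeff j • v)) fun j _ =>
      ⟨Finsupp.single j (P.coeff j • v), by simp, by simp⟩)).congr (fun t => ?_) fun t => ?_
  · rw [Polynomial.eval_eq_sum, Polynomial.sum, Finset.sum_smul]
    exact Finset.sum_congr rfl fun j _ => by rw [smul_smul, mul_comm]
  · rw [Polynomial.derivative_eval, Polynomial.sum, Finset.sum_smul]
    exact Finset.sum_congr rfl fun j _ => by rw [smul_smul]; congr 1; ring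

/-- The Leibniz rule for a multilinear map. -/
theorem PolyDeriv.multilinear {k : ℕ} (w : MultilinearMap ℂ (fun _ : Fin k => V) W)
    {f f' : Fin k → ℂ → V} (h : ∀ a, PolyDeriv (f a) (f' a)) :
    PolyDeriv (fun t => w fun a => f a t)
      (fun t => ∑ a, w (Function.update (fun b => f b t) a (f' a t))) := by
  choose p hp hp' using h
  -- Expand into monomials `t ^ (∑ r a)`; the Leibniz rule then reduces to the product rule for `∏ X
  -- ^ r a`.
  have h1 : ∀ t, (w fun a => f a t) = ∑ r ∈ Fintype.piFinset fun a => (p a).support,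
      (∏ a, (Polynomial.X : Polynomial ℂ) ^ r a).eval t • w fun a => p a (r a) := by
    intro t
    simp only [hp, polyEval_eq_sum t _ subset_rfl]
    rw [w.map_sum_finset (fun a j => t ^ j • p a j)]
    refine Finset.sum_congr rfl fun r _ => ?_
    rw [w.map_smul_univ (fun a => t ^ r a) (fun a => p a (r a)), Polynomial.eval_prod]
    simp
  have h2 : ∀ t, (∑ a, w (Function.update (fun b => f b t) a (f' a t))) =
      ∑ r ∈ Fintype.piFinset fun a => (p a).support,
      (∏ a, (Polynomial.X : Polynomial ℂ) ^ r a).derivative.eval t • w fun a => p a (r a) := by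
    intro t
    have h3 : ∀ a, w (Function.update (fun b => f b t) a (f' a t)) =
        ∑ r ∈ Fintype.piFinset fun a => (p a).support,
        ((∏ b ∈ Finset.univ.erase a, t ^ r b) * ((r a : ℂ) * t ^ (r a - 1))) •
          w fun a => p a (r a) := by
      intro a
      have : Function.update (fun b => f b t) a (f' a t) = fun b => ∑ j ∈ (p b).support,
          (if b = a then (j : ℂ) * t ^ (j - 1) else t ^ j) • p b j := by
        funext b
        rcases eq_or_ne b a with rfl | hb
        · simp [hp', polyDerivEval_eq_sum t _ subset_rfl]
        · simp [hb, hp, polyEval_eq_sum t _ subset_rfl]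
      rw [this, w.map_sum_finset (fun b (j : ℕ) => (if b = a then (j : ℂ) * t ^ (j - 1) else t ^ j) • p b j)]
      refine Finset.sum_congr rfl fun r _ => ?_
      rw [w.map_smul_univ (fun b => if b = a then (r b : ℂ) * t ^ (r b - 1) else t ^ r b)
        (fun a => p a (r a)), ← Finset.prod_erase_mul _ _ (Finset.mem_univ a), if_pos rfl]
      congr 2
      exact Finset.prod_congr rfl fun b hb => if_neg (Finset.ne_of_mem_erase hb)
    simp only [h3]
    rw [Finset.sum_comm]
    refine Finset.sum_congr rfl fun r _ => ?_
    rw [← Finset.sum_smul, Polynomial.derivative_prod_finset, Polynomial.eval_finsetSum]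
    congr 1
    refine Finset.sum_congr rfl fun a _ => ?_
    simp [Polynomial.eval_prod, Polynomial.derivative_X_pow]
  exact (PolyDeriv.sum _ fun r _ => PolyDeriv.polynomial_smul _ _).congr h1 h2

theorem IsPolyFun.multilinear {k : ℕ} (w : MultilinearMap ℂ (fun _ : Fin k => V) W)
    {f : Fin k → ℂ → V} (h : ∀ a, IsPolyFun (f a)) : IsPolyFun (fun t => w fun a => f a t) := by
  choose f' hf using fun a => (h a).exists_polyDeriv
  exact (PolyDeriv.multilinear w hf).isPolyFun

end PolyDeriv

/-! ### Multilinear operations on formal power series -/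

section Series

open GradedOps Finset.Nat

variable {V : Type*} [AddCommGroup V] [Module ℂ V] {W : Type*} [AddCommGroup W] [Module ℂ W]

/-- The coefficient of `ν^N` of the `ℂ⟦ν⟧`-multilinear extension of `w`, applied to the power series
with coefficients `x a : ℕ → V`. -/
def ser {k : ℕ} (w : MultilinearMap ℂ (fun _ : Fin k => V) W) (x : Fin k → ℕ → V) (N : ℕ) : W :=
  ∑ i ∈ antidiagonalTuple k N, w fun a => x a (i a)

variable {k : ℕ} (w : MultilinearMap ℂ (fun _ : Fin k => V) W)

theorem le_of_mem_antidiagonalTuple {N : ℕ} {i : Fin k → ℕ} (hi : i ∈ antidiagonalTuple k N)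
    (a : Fin k) : i a ≤ N := by
  rw [← mem_antidiagonalTuple.mp hi]
  exact Finset.single_le_sum (fun _ _ => Nat.zero_le _) (Finset.mem_univ a)

theorem ser_congr {x y : Fin k → ℕ → V} {N : ℕ} (h : ∀ a, ∀ j ≤ N, x a j = y a j) :
    ser w x N = ser w y N :=
  Finset.sum_congr rfl fun _ hi => congrArg w <| funext fun a =>
    h a _ (le_of_mem_antidiagonalTuple hi a)

/-- Vanishing orders add: an index tuple of total below `∑ o a` must have some entry below its own
order. -/
theorem ser_eq_zero {x : Fin k → ℕ → V} {N : ℕ} (o : Fin k → ℕ) (h : ∀ a, ∀ j < o a, x a j = 0)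
    (hN : N < ∑ a, o a) : ser w x N = 0 := by
  refine Finset.sum_eq_zero fun i hi => ?_
  obtain ⟨a, -, ha⟩ : ∃ a ∈ Finset.univ, i a < o a := by
    apply Finset.exists_lt_of_sum_lt
    rwa [mem_antidiagonalTuple.mp hi]
  exact w.map_coord_zero a (h a _ ha)

/-- A nonzero term has all indices positive, so with at least two slots each index is below `N`.
This is the reason why the coefficients of order `N` enter an order-`N` equation only through the
unary operation, on which every later induction rests. -/
theorem ser_congr_of_two_le {x y : Fin k → ℕ → V} {N : ℕ} (hk : 2 ≤ k) (hx : ∀ a, x a 0 = 0)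
    (hy : ∀ a, y a 0 = 0) (h : ∀ a, ∀ j < N, x a j = y a j) : ser w x N = ser w y N := by
  refine Finset.sum_congr rfl fun i hi => ?_
  by_cases h0 : ∃ a, i a = 0
  · obtain ⟨a, ha⟩ := h0
    rw [w.map_coord_zero a (by rw [ha, hx]), w.map_coord_zero a (by rw [ha, hy])]
  · push Not at h0
    refine congrArg w <| funext fun a => h a _ ?_
    obtain ⟨b, hb⟩ : ∃ b : Fin k, b ≠ a := by
      have : Nontrivial (Fin k) := Fin.nontrivial_iff_two_le.mpr hk
      exact exists_ne a
    have := mem_antidiagonalTuple.mp hi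
    have h2 : i a + i b ≤ ∑ c, i c := by
      rw [← Finset.sum_pair hb.symm]
      exact Finset.sum_le_sum_of_subset (Finset.subset_univ _)
    have := h0 b
    omega

theorem ser_one (w : MultilinearMap ℂ (fun _ : Fin 1 => V) W) (x : Fin 1 → ℕ → V) (N : ℕ) :
    ser w x N = w fun _ => x 0 N := by
  rw [ser, antidiagonalTuple_one, Finset.sum_singleton]
  congr 1
  funext a
  rw [Subsingleton.elim a 0]
  rfl

theorem ser_zero_zero (w : MultilinearMap ℂ (fun _ : Fin 0 => V) W) (x : Fin 0 → ℕ → V) :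
    ser w x 0 = w Fin.elim0 := by
  rw [ser, antidiagonalTuple_zero_zero, Finset.sum_singleton]
  congr 1
  funext a
  exact a.elim0

theorem ser_zero_succ (w : MultilinearMap ℂ (fun _ : Fin 0 => V) W) (x : Fin 0 → ℕ → V) (N : ℕ) :
    ser w x (N + 1) = 0 := by
  rw [ser, antidiagonalTuple_zero_succ, Finset.sum_empty]

/-- Realizes the coefficients of a multilinear expression in polynomials as the coefficients of a
polynomial whose values are computed pointwise. An identity proved for vectors thus passes to power
series: truncate, evaluate at every `t`, and compare coefficients. -/
theorem exists_poly_ser (P : Fin k → ℕ →₀ V) : ∃ Q : ℕ →₀ W,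
    (∀ N, Q N = ser w (fun a => P a) N) ∧
      ∀ t, polyEval t Q = w fun a => polyEval t (P a) := by
  refine ⟨∑ r ∈ Fintype.piFinset fun a => (P a).support,
    Finsupp.single (∑ a, r a) (w fun a => P a (r a)), fun N => ?_, fun t => ?_⟩
  · rw [Finsupp.finsetSum_apply]
    simp only [Finsupp.single_apply]
    rw [← Finset.sum_filter, ser]
    refine Finset.sum_subset (fun r hr => ?_) fun r hr hr' => ?_
    · exact mem_antidiagonalTuple.mpr (Finset.mem_filter.mp hr).2
    · rw [Finset.mem_filter, not_and_or, Fintype.mem_piFinset] at hr'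
      rcases hr' with hr' | hr'
      · push Not at hr'
        obtain ⟨a, ha⟩ := hr'
        exact w.map_coord_zero a (Finsupp.notMem_support_iff.mp ha)
      · exact absurd (mem_antidiagonalTuple.mp hr) hr'
  · simp only [fun a => polyEval_eq_sum t (P a) subset_rfl]
    rw [w.map_sum_finset (fun a (j : ℕ) => t ^ j • P a j), polyEval_sum]
    refine Finset.sum_congr rfl fun r _ => ?_
    rw [polyEval_single, w.map_smul_univ (fun a => t ^ r a) (fun a => P a (r a)), Finset.prod_pow_eq_pow_sum]

theorem exists_poly_conv {U : Type*} [AddCommGroup U] [Module ℂ U] (B : V →ₗ[ℂ] W →ₗ[ℂ] U)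
    (P : ℕ →₀ V) (R : ℕ →₀ W) : ∃ Q : ℕ →₀ U,
    (∀ N, Q N = ∑ ab ∈ Finset.HasAntidiagonal.antidiagonal N, B (P ab.1) (R ab.2)) ∧
      ∀ t, polyEval t Q = B (polyEval t P) (polyEval t R) := by
  refine ⟨∑ ab ∈ P.support ×ˢ R.support, Finsupp.single (ab.1 + ab.2) (B (P ab.1) (R ab.2)),
    fun N => ?_, fun t => ?_⟩
  · rw [Finsupp.finsetSum_apply]
    simp only [Finsupp.single_apply]
    rw [← Finset.sum_filter]
    refine Finset.sum_subset (fun r hr => ?_) fun r hr hr' => ?_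
    · exact Finset.HasAntidiagonal.mem_antidiagonal.mpr (Finset.mem_filter.mp hr).2
    · rw [Finset.mem_filter, not_and_or, Finset.mem_product, not_and_or] at hr'
      rcases hr' with (hr' | hr') | hr'
      · rw [Finsupp.notMem_support_iff.mp hr', map_zero, LinearMap.zero_apply]
      · rw [Finsupp.notMem_support_iff.mp hr', map_zero]
      · exact absurd (Finset.HasAntidiagonal.mem_antidiagonal.mp hr) hr'
  · simp only [polyEval_sum, polyEval_single, polyEval_eq_sum t P subset_rfl,
      polyEval_eq_sum t R subset_rfl, map_sum, LinearMap.sum_apply, map_smul,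
      LinearMap.smul_apply]
    rw [Finset.sum_product_right]
    refine Finset.sum_congr rfl fun a _ => ?_
    rw [Finset.smul_sum]
    exact Finset.sum_congr rfl fun b _ => by rw [pow_add, smul_smul, mul_comm]

theorem ser_cons (w : MultilinearMap ℂ (fun _ : Fin (k + 1) => V) W) (x : ℕ → V)
    (z : Fin k → ℕ → V) (N : ℕ) : ser w (Fin.cons x z) N =
      ∑ i ∈ antidiagonalTuple (k + 1) N, w.curryLeft (x (i 0)) fun a => z a (i a.succ) := by
  refine Finset.sum_congr rfl fun i _ => ?_
  rw [MultilinearMap.curryLeft_apply]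
  congr 1
  funext a
  refine Fin.cases ?_ (fun b => ?_) a <;> simp

theorem ser_cons_sum {ι : Type*} (w : MultilinearMap ℂ (fun _ : Fin (k + 1) => V) W) (s : Finset ι)
    (a : ι → ℂ) (y : ι → ℕ → V) (z : Fin k → ℕ → V) (N : ℕ) :
    ser w (Fin.cons (fun n => ∑ p ∈ s, a p • y p n) z) N =
      ∑ p ∈ s, a p • ser w (Fin.cons (y p) z) N := by
  simp only [ser_cons, map_sum, _root_.sum_apply, map_smul, _root_.smul_apply,
    Finset.smul_sum]
  exact Finset.sum_comm

theorem ser_comp_perm (σ : Equiv.Perm (Fin k)) {x : Fin k → ℕ → V}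
    (h : ∀ i : Fin k → ℕ, (w fun a => x a (i a)) = w fun a => x (σ a) (i (σ a))) (N : ℕ) :
    ser w x N = ser w (fun a => x (σ a)) N := by
  refine Finset.sum_nbij' (fun i a => i (σ a)) (fun i a => i (σ.symm a)) ?_ ?_ ?_ ?_ ?_
  · intro i hi
    rw [mem_antidiagonalTuple] at hi ⊢
    rw [← hi]
    exact Equiv.sum_comp σ i
  · intro i hi
    rw [mem_antidiagonalTuple] at hi ⊢
    rw [← hi]
    exact Equiv.sum_comp σ.symm i
  · intro i _; simp
  · intro i _; simp
  · intro i _; exact h i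

theorem PolyDeriv.ser {x x' : Fin k → ℂ → ℕ → V} {N : ℕ}
    (h : ∀ a, ∀ j ≤ N, PolyDeriv (fun t => x a t j) (fun t => x' a t j)) :
    PolyDeriv (fun t => ser w (fun a => x a t) N)
      (fun t => ∑ a, OpenClosed.ser w (Function.update (fun b => x b t) a (x' a t)) N) := by
  refine (PolyDeriv.sum _ fun i hi => PolyDeriv.multilinear w fun a =>
    h a (i a) (le_of_mem_antidiagonalTuple hi a)).congr (fun t => rfl) fun t => ?_
  simp only [OpenClosed.ser]
  rw [Finset.sum_comm]
  refine Finset.sum_congr rfl fun i _ => Finset.sum_congr rfl fun a _ => congrArg w ?_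
  funext b
  rcases eq_or_ne b a with rfl | hb
  · simp
  · simp [hb]

theorem IsPolyFun.ser {x : Fin k → ℂ → ℕ → V} {N : ℕ}
    (h : ∀ a, ∀ j ≤ N, IsPolyFun fun t => x a t j) :
    IsPolyFun (fun t => ser w (fun a => x a t) N) :=
  IsPolyFun.sum _ fun i hi => IsPolyFun.multilinear w fun a =>
    h a (i a) (le_of_mem_antidiagonalTuple hi a)

/-! ### Exponential sums -/

variable (w : ∀ k : ℕ, MultilinearMap ℂ (fun _ : Fin k => V) W)

/-- The coefficient of `ν^N` in `∑_k (1/k!) w_k (c, …, c)`, for `c` without constant term. -/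
def expSum (c : ℕ → V) (N : ℕ) : W :=
  ∑ k ∈ Finset.range (N + 1), ((k.factorial : ℂ)⁻¹) • ser (w k) (fun _ => c) N

/-- The coefficient of `ν^N` in `∑_k (1/k!) w_{k+1} (x, c, …, c)`, for `x` and `c` without constant
term. -/
def expSum₁ (x c : ℕ → V) (N : ℕ) : W :=
  ∑ k ∈ Finset.range N, ((k.factorial : ℂ)⁻¹) • ser (w (k + 1)) (Fin.cons x fun _ => c) N

/-- The coefficient of `ν^N` in `∑_k (1/k!) w_{k+2} (y, x, c, …, c)`, for `y`, `x` and `c` without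
constant term. -/
def expSum₂ (y x c : ℕ → V) (N : ℕ) : W :=
  ∑ k ∈ Finset.range N, ((k.factorial : ℂ)⁻¹) •
    ser (w (k + 2)) (Fin.cons y (Fin.cons x fun _ => c)) N

variable {w} {c c' x x' y : ℕ → V} {N K : ℕ}

theorem ser_const_eq_zero (hc : c 0 = 0) {k : ℕ} (w : MultilinearMap ℂ (fun _ : Fin k => V) W)
    (h : N < k) : ser w (fun _ => c) N = 0 :=
  ser_eq_zero w (fun _ => 1) (fun _ j hj => by rwa [Nat.lt_one_iff.mp hj]) (by simpa using h)

theorem ser_cons_eq_zero (p : ℕ) (hx : ∀ j < p, x j = 0) (hc : c 0 = 0) {k : ℕ}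
    (w : MultilinearMap ℂ (fun _ : Fin (k + 1) => V) W) (h : N < p + k) :
    ser w (Fin.cons x fun _ => c) N = 0 := by
  refine ser_eq_zero w (Fin.cons p fun _ => 1) (fun a => ?_) (by simpa [Fin.sum_univ_succ] using h)
  refine Fin.cases ?_ (fun b => ?_) a
  · simpa using hx
  · simpa using hc

theorem ser_cons_cons_eq_zero (p q : ℕ) (hy : ∀ j < p, y j = 0) (hx : ∀ j < q, x j = 0)
    (hc : c 0 = 0) {k : ℕ} (w : MultilinearMap ℂ (fun _ : Fin (k + 2) => V) W)
    (h : N < p + q + k) : ser w (Fin.cons y (Fin.cons x fun _ => c)) N = 0 := by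
  refine ser_eq_zero w (Fin.cons p (Fin.cons q fun _ => 1)) (fun a => ?_)
    (by simpa [Fin.sum_univ_succ, add_assoc] using h)
  refine Fin.cases ?_ (fun b => Fin.cases ?_ (fun d => ?_) b) a
  · simpa using hy
  · simpa using hx
  · simpa using hc

theorem expSum_eq_sum (hc : c 0 = 0) (h : N < K) : expSum w c N =
    ∑ k ∈ Finset.range K, ((k.factorial : ℂ)⁻¹) • ser (w k) (fun _ => c) N := by
  refine Finset.sum_subset (Finset.range_subset_range.mpr h) fun k _ hk => ?_
  have : N + 1 ≤ k := by simpa using hk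
  rw [ser_const_eq_zero hc _ (by omega), smul_zero]

theorem expSum₁_eq_sum (hx : x 0 = 0) (hc : c 0 = 0) (h : N ≤ K) : expSum₁ w x c N =
    ∑ k ∈ Finset.range K, ((k.factorial : ℂ)⁻¹) • ser (w (k + 1)) (Fin.cons x fun _ => c) N := by
  refine Finset.sum_subset (by simpa using h) fun k _ hk => ?_
  rw [ser_cons_eq_zero 1 (by simpa using hx) hc, smul_zero]
  have : N ≤ k := by simpa using hk
  omega

theorem expSum₂_eq_sum (hy : y 0 = 0) (hc : c 0 = 0) (h : N ≤ K) : expSum₂ w y x c N =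
    ∑ k ∈ Finset.range K, ((k.factorial : ℂ)⁻¹) •
      ser (w (k + 2)) (Fin.cons y (Fin.cons x fun _ => c)) N := by
  refine Finset.sum_subset (by simpa using h) fun k _ hk => ?_
  rw [ser_cons_cons_eq_zero 1 0 (by simpa using hy) (by simp) hc, smul_zero]
  have : N ≤ k := by simpa using hk
  omega

theorem expSum_eq_add (N : ℕ) : expSum w c N = (if N = 0 then w 0 Fin.elim0 else 0) +
    ∑ k ∈ Finset.Icc 1 N, ((k.factorial : ℂ)⁻¹) • ser (w k) (fun _ => c) N := by
  have h : Finset.range (N + 1) = insert 0 (Finset.Icc 1 N) := by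
    ext j; simp; omega
  rw [expSum, h, Finset.sum_insert (by simp)]
  congr 1
  rcases N with _ | N
  · simp [ser_zero_zero]
  · simp [ser_zero_succ]

theorem expSum_zero : expSum w c 0 = w 0 Fin.elim0 := by
  simp [expSum_eq_add]

theorem expSum₁_zero : expSum₁ w x c 0 = 0 := rfl

/-- Terms of arity at least two see only coefficients below `N`, and the nullary term cancels, so
changing the coefficient at order `N` acts linearly through `w 1`. -/
theorem expSum_sub (hc : c 0 = 0) (hc' : c' 0 = 0) (h : ∀ j < N, c j = c' j) :
    expSum w c N - expSum w c' N = w 1 (fun _ => c N) - w 1 (fun _ => c' N) := by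
  rcases Nat.eq_zero_or_pos N with rfl | hN
  · rw [expSum_zero, expSum_zero, hc, hc', sub_self, sub_self]
  · rw [expSum, expSum, ← Finset.sum_sub_distrib, Finset.sum_eq_single 1]
    · simp [ser_one]
    · intro k _ hk
      rcases Nat.lt_or_ge k 2 with hk' | hk'
      · obtain rfl : k = 0 := by omega
        obtain ⟨n, rfl⟩ : ∃ n, N = n + 1 := ⟨N - 1, by omega⟩
        simp [ser_zero_succ]
      · rw [ser_congr_of_two_le (w k) hk' (fun _ => hc) (fun _ => hc') fun _ => h, sub_self]
    · intro h; exact absurd (Finset.mem_range.mpr (by omega)) h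

theorem expSum₁_sub (hx : x 0 = 0) (hx' : x' 0 = 0) (hc : c 0 = 0) (hc' : c' 0 = 0)
    (h : ∀ j < N, x j = x' j) (h' : ∀ j < N, c j = c' j) :
    expSum₁ w x c N - expSum₁ w x' c' N = w 1 (fun _ => x N) - w 1 (fun _ => x' N) := by
  rcases Nat.eq_zero_or_pos N with rfl | hN
  · rw [expSum₁_zero, expSum₁_zero, hx, hx', sub_self, sub_self]
  · rw [expSum₁, expSum₁, ← Finset.sum_sub_distrib, Finset.sum_eq_single 0]
    · simp [ser_one]
    · intro k _ hk
      rw [ser_congr_of_two_le (w (k + 1)) (by omega) (y := Fin.cons x' fun _ => c'), sub_self]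
      · intro a; refine Fin.cases ?_ (fun b => ?_) a
        · simpa using hx
        · simpa using hc
      · intro a; refine Fin.cases ?_ (fun b => ?_) a
        · simpa using hx'
        · simpa using hc'
      · intro a; refine Fin.cases ?_ (fun b => ?_) a
        · simpa using h
        · simpa using h'
    · intro h; exact absurd (Finset.mem_range.mpr (by omega)) h

theorem expSum₁_zero_left (N : ℕ) : expSum₁ w (fun _ => 0) c N = 0 :=
  Finset.sum_eq_zero fun k _ => by
    rw [ser_cons, Finset.sum_eq_zero, smul_zero]
    intro i _
    rw [map_zero, _root_.zero_apply]

/-- If `x` vanishes to order `N`, then only the unary operation contributes to the coefficient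
of `ν^N`. -/
theorem expSum₁_eq_of_order (hx : ∀ j < N, x j = 0) (hx0 : x 0 = 0) (hc : c 0 = 0) :
    expSum₁ w x c N = w 1 fun _ => x N := by
  have := expSum₁_sub (w := w) (x' := fun _ => 0) hx0 rfl hc hc hx (fun _ _ => rfl)
  rw [expSum₁_zero_left, sub_zero] at this
  rw [this, (w 1).map_coord_zero (m := fun _ => 0) 0 rfl, sub_zero]

theorem expSum₂_eq_zero (hy : ∀ j < N, y j = 0) (hx : x 0 = 0) (hc : c 0 = 0) :
    expSum₂ w y x c N = 0 :=
  Finset.sum_eq_zero fun k _ => by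
    rw [ser_cons_cons_eq_zero N 1 hy (by simpa using hx) hc _ (by omega), smul_zero]

theorem IsPolyFun.expSum₁ {x c : ℂ → ℕ → V} (hx : ∀ N, IsPolyFun fun t => x t N)
    (hc : ∀ N, IsPolyFun fun t => c t N) (N : ℕ) :
    IsPolyFun fun t => expSum₁ w (x t) (c t) N := by
  refine IsPolyFun.sum _ fun k _ => IsPolyFun.const_smul _ ?_
  have := IsPolyFun.ser (w (k + 1)) (N := N) (x := Fin.cons x fun _ => c) fun a j _ => by
    refine Fin.cases ?_ (fun b => ?_) a
    · simpa using hx j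
    · simpa using hc j
  convert this using 3 with t
  funext a
  refine Fin.cases ?_ (fun b => ?_) a <;> simp

/-- By symmetry on the degree-zero part, the `k + 1` terms of the Leibniz rule coincide, and `(k +
1) / (k + 1)! = 1 / k!`. -/
theorem PolyDeriv.expSum {S : Submodule ℂ V}
    (hw : ∀ (k : ℕ) (σ : Equiv.Perm (Fin k)) (v : Fin k → V), (∀ a, v a ∈ S) →
      w k v = w k fun a => v (σ a)) {c c' : ℂ → ℕ → V}
    (hc : ∀ t N, c t N ∈ S) (hc' : ∀ t N, c' t N ∈ S)
    (h : ∀ N, PolyDeriv (fun t => c t N) fun t => c' t N) (N : ℕ) :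
    PolyDeriv (fun t => expSum w (c t) N) fun t => expSum₁ w (c' t) (c t) N := by
  refine (PolyDeriv.sum _ fun k _ => (PolyDeriv.ser (w k) (N := N) (x := fun _ => c)
    (x' := fun _ => c') fun _ j _ => h j).const_smul _).congr (fun _ => rfl) fun t => ?_
  -- The nullary term is constant and drops out; this shifts the arity by one.
  rw [Finset.sum_range_succ']
  simp only [Finset.univ_eq_empty, Finset.sum_empty, smul_zero, add_zero, OpenClosed.expSum₁]
  refine Finset.sum_congr rfl fun k _ => ?_
  have key : ∀ a : Fin (k + 1), OpenClosed.ser (w (k + 1))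
      (Function.update (fun _ => c t) a (c' t)) N =
      OpenClosed.ser (w (k + 1)) (Fin.cons (c' t) fun _ => c t) N := by
    intro a
    rw [ser_comp_perm (w (k + 1)) (Equiv.swap 0 a)]
    · congr 1
      funext b
      refine Fin.cases ?_ (fun b => ?_) b
      · simp
      · rw [Function.update_apply, if_neg, Fin.cons_succ]
        intro hb
        have := (Equiv.swap_apply_eq_iff.mp hb)
        simp at this
    · intro i
      refine hw _ _ _ fun b => ?_
      rw [Function.update_apply]
      split_ifs
      · exact hc' t _
      · exact hc t _
  simp only [key, Finset.sum_const, Finset.card_univ, Fintype.card_fin]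
  rw [← Nat.cast_smul_eq_nsmul ℂ, smul_smul, Nat.factorial_succ]
  congr 1
  have h1 : ((k + 1 : ℕ) : ℂ) ≠ 0 := Nat.cast_ne_zero.mpr (by omega)
  have h2 : (k.factorial : ℂ) ≠ 0 := Nat.cast_ne_zero.mpr k.factorial_ne_zero
  push_cast at h1 ⊢
  field_simp

/-- Turns the product of two truncated exponential sums into a sum over total arity, the form in
which the quadratic relations are available. The part of the square beyond the triangle contributes
nothing. -/
theorem sum_range_range_eq_sum_antidiagonal {M : Type*} [AddCommMonoid M] {K : ℕ} {G : ℕ → ℕ → M}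
    (h : ∀ p r, K ≤ p + r → G p r = 0) :
    ∑ r ∈ Finset.range K, ∑ p ∈ Finset.range K, G p r =
      ∑ n ∈ Finset.range K, ∑ pr ∈ Finset.HasAntidiagonal.antidiagonal n, G pr.1 pr.2 := by
  rw [Finset.sum_comm, ← Finset.sum_product', Finset.sum_sigma']
  symm
  refine Finset.sum_of_injOn (fun x : (_ : ℕ) × ℕ × ℕ => x.2) ?_ ?_ ?_ (fun _ _ => rfl)
  · rintro ⟨n, p, r⟩ h1 ⟨n', p', r'⟩ h2 h3
    simp only [Finset.coe_sigma, Set.mem_sigma_iff, Finset.mem_coe, Finset.HasAntidiagonal.mem_antidiagonal] at h1 h2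
    simp only [Prod.mk.injEq] at h3
    obtain ⟨rfl, rfl⟩ := h3
    obtain rfl : n = n' := by omega
    rfl
  · rintro ⟨n, p, r⟩ h1
    simp only [Finset.coe_sigma, Set.mem_sigma_iff, Finset.mem_coe, Finset.HasAntidiagonal.mem_antidiagonal,
      Finset.mem_range] at h1
    simp only [Finset.coe_product, Set.mem_prod, Finset.mem_coe, Finset.mem_range]
    omega
  · rintro ⟨p, r⟩ - h2
    refine h p r ?_
    by_contra h3
    refine h2 ⟨⟨p + r, p, r⟩, ?_, rfl⟩
    simp
    omega

end Series

/-! ### Quadratic relations evaluated on repeated arguments -/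

section Relations

/-- The tuple `(x, c, …, c)`. -/
def firstArg {X : Type*} (x c : X) (k : ℕ) : Fin k → X := fun i => if i.1 = 0 then x else c

theorem firstArg_succ {X : Type*} (x c : X) (k : ℕ) : firstArg x c (k + 1) = Fin.cons x fun _ => c := by
  funext i
  refine Fin.cases ?_ (fun j => ?_) i <;> simp [firstArg]

open GradedOps Finset.Nat

variable {V : Type*} [AddCommGroup V] [Module ℂ V] {W : Type*} [AddCommGroup W] [Module ℂ W]

/-- Applies when at most one argument has nonzero degree, which covers `(c, …, c)` and `(x, c, …,
c)`. -/
theorem koszul_eq_zero {n : ℕ} {d : Fin n → ℤ} (h : ∀ i j, i ≠ j → d i * d j = 0)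
    (σ : Equiv.Perm (Fin n)) : koszul d σ = 0 :=
  Finset.sum_eq_zero fun i _ => Finset.sum_eq_zero fun j _ => by
    split_ifs with hij
    · exact h _ _ fun e => hij.1.ne (σ.injective e)
    · rfl

/-- Graded symmetry of a family of multilinear maps. -/
def GradedSymm (gr : ℤ → Submodule ℂ V) (w : ∀ k, MultilinearMap ℂ (fun _ : Fin k => V) W) : Prop :=
  ∀ (k : ℕ) (σ : Equiv.Perm (Fin k)) (d : Fin k → ℤ) (c : Fin k → V),
    (∀ i, c i ∈ gr (d i)) → w k c = (koszul d σ).negOnePow • w k (fun i => c (σ i))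

theorem GradedSymm.eq_of_mul_eq_zero {gr : ℤ → Submodule ℂ V}
    {w : ∀ k, MultilinearMap ℂ (fun _ : Fin k => V) W} (h : GradedSymm gr w) {k : ℕ}
    (σ : Equiv.Perm (Fin k)) (d : Fin k → ℤ) (c : Fin k → V) (hc : ∀ i, c i ∈ gr (d i))
    (hd : ∀ i j, i ≠ j → d i * d j = 0) : w k c = w k fun i => c (σ i) := by
  rw [h k σ d c hc, koszul_eq_zero hd, Int.negOnePow_zero, one_smul]

/-- A family `w` of multilinear maps on a graded space with operations `l` which satisfies the
quadratic relation `w ∘ l + B (w, w) = 0`. It is shared by the `L_∞`-relations (`w = l`, `B = 0`)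
and the open-closed relations (`B` the composition of families of multilinear maps). -/
structure QuadRel (gr : ℤ → Submodule ℂ V) (l : ∀ k, MultilinearMap ℂ (fun _ : Fin k => V) V)
    (w : ∀ k, MultilinearMap ℂ (fun _ : Fin k => V) W) (B : ℤ → W →ₗ[ℂ] W →ₗ[ℂ] W) : Prop where
  l_zero : l 0 = 0
  l_degree : ∀ (k : ℕ) (d : Fin k → ℤ) (c : Fin k → V), (∀ i, c i ∈ gr (d i)) →
    l k c ∈ gr (∑ i, d i + 1)
  l_symm : GradedSymm gr l
  w_symm : GradedSymm gr w
  rel : ∀ (n : ℕ) (d : Fin n → ℤ) (c : Fin n → V), (∀ i, c i ∈ gr (d i)) →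
    (∑ p : Fin (n + 1), ∑ σ : Equiv.Perm (Fin n),
      ((p.1.factorial * (n - p.1).factorial : ℂ)⁻¹) • (koszul d σ).negOnePow •
        w (n - p.1 + 1) (Fin.cons (l p.1 (fun i => c (σ ⟨i.1, by omega⟩)))
          (fun i => c (σ ⟨p.1 + i.1, by omega⟩)))) +
    (∑ p : Fin (n + 1), ∑ σ : Equiv.Perm (Fin n),
      ((p.1.factorial * (n - p.1).factorial : ℂ)⁻¹) •
        (koszul d σ + ∑ a : Fin p.1, d (σ ⟨a.1, by omega⟩)).negOnePow •
        B (1 + ∑ a : Fin (n - p.1), d (σ ⟨p.1 + a.1, by omega⟩))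
          (w p.1 (fun i => c (σ ⟨i.1, by omega⟩)))
          (w (n - p.1) (fun i => c (σ ⟨p.1 + i.1, by omega⟩)))) = 0

theorem sum_perm_apply_inv_zero {M : Type*} [AddCommMonoid M] (n : ℕ) (g : Fin (n + 1) → M) :
    ∑ σ : Equiv.Perm (Fin (n + 1)), g (σ.symm 0) = n.factorial • ∑ j, g j := by
  have h1 : ∑ σ : Equiv.Perm (Fin (n + 1)), g (σ.symm 0) =
      ∑ σ : Equiv.Perm (Fin (n + 1)), g (σ 0) :=
    Fintype.sum_equiv (Equiv.inv (Equiv.Perm (Fin (n + 1)))) _ _ fun σ => rfl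
  rw [h1, ← Equiv.sum_comp Equiv.Perm.decomposeFin.symm (fun σ => g (σ 0)),
    Fintype.sum_prod_type, Finset.smul_sum]
  refine Finset.sum_congr rfl fun j _ => ?_
  simp [Equiv.Perm.decomposeFin_symm_apply_zero, Fintype.card_perm]

namespace QuadRel

variable {gr : ℤ → Submodule ℂ V} {l : ∀ k, MultilinearMap ℂ (fun _ : Fin k => V) V}
  {w : ∀ k, MultilinearMap ℂ (fun _ : Fin k => V) W} {B : ℤ → W →ₗ[ℂ] W →ₗ[ℂ] W}

/-- All arguments have degree zero, so every sign is trivial and the `n!` permutations contribute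
equally; dividing by `n!` leaves the weights `1 / (p! r!)`. -/
theorem rel_const (h : QuadRel gr l w B) {c : V} (hc : c ∈ gr 0) (n : ℕ) :
    ∑ pr ∈ Finset.HasAntidiagonal.antidiagonal n,
      ((pr.2.factorial : ℂ)⁻¹ * (pr.1.factorial : ℂ)⁻¹) •
        (w (pr.2 + 1) (Fin.cons (l pr.1 fun _ => c) fun _ => c) +
          B 1 (w pr.1 fun _ => c) (w pr.2 fun _ => c)) = 0 := by
  have := h.rel n (fun _ => 0) (fun _ => c) fun _ => hc
  rw [← Finset.sum_add_distrib] at this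
  simp only [koszul_eq_zero (d := fun _ : Fin n => (0 : ℤ)) (fun _ _ _ => by simp),
    Finset.sum_const_zero, add_zero, Int.negOnePow_zero, one_smul, Finset.sum_const,
    Finset.card_univ, Fintype.card_perm, Fintype.card_fin, ← smul_add] at this
  rw [← Finset.smul_sum, ← Nat.cast_smul_eq_nsmul ℂ, smul_eq_zero] at this
  have := this.resolve_left (Nat.cast_ne_zero.mpr n.factorial_ne_zero)
  rw [Finset.Nat.sum_antidiagonal_eq_sum_range_succ (fun p r =>
    ((r.factorial : ℂ)⁻¹ * (p.factorial : ℂ)⁻¹) •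
      (w (r + 1) (Fin.cons (l p fun _ => c) fun _ => c) + B 1 (w p fun _ => c) (w r fun _ => c)))]
  rw [Fin.sum_univ_eq_sum_range (fun p => ((p.factorial * (n - p).factorial : ℂ)⁻¹) •
    (w (n - p + 1) (Fin.cons (l p fun _ => c) fun _ => c) +
      B 1 (w p fun _ => c) (w (n - p) fun _ => c)))] at this
  rw [← this]
  exact Finset.sum_congr rfl fun p _ => by rw [mul_inv_rev]

theorem _root_.OpenClosed.GradedSymm.apply_eq_firstArg
    {w : ∀ k, MultilinearMap ℂ (fun _ : Fin k => V) W} (h : GradedSymm gr w) {x c : V}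
    {d : ℤ} (hx : x ∈ gr d) (hc : c ∈ gr 0) {k : ℕ} (j : Fin k) (v : Fin k → V)
    (hv : ∀ i, v i = if i = j then x else c) : w k v = w k (firstArg x c k) := by
  have : NeZero k := ⟨by have := j.2; omega⟩
  rw [h.eq_of_mul_eq_zero (Equiv.swap 0 j) (fun i => if i = j then d else 0) v
    (fun i => by rw [hv]; split_ifs <;> assumption)
    (fun a b hab => by
      split_ifs with h1 h2
      · exact absurd (h1.trans h2.symm) hab
      all_goals simp)]
  congr 1
  funext i
  rw [hv, firstArg]
  have : Equiv.swap 0 j i = j ↔ i.1 = 0 := by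
    rw [Equiv.swap_apply_eq_iff, Equiv.swap_apply_right, Fin.ext_iff]
    rfl
  simp only [this]

/-- The entry `y` keeps its first position while `x` passes only degree-zero entries, so no sign
arises although both `x` and `y` may be odd. -/
theorem _root_.OpenClosed.GradedSymm.apply_cons_eq_firstArg
    {w : ∀ k, MultilinearMap ℂ (fun _ : Fin k => V) W} (h : GradedSymm gr w) {x c y : V}
    {d e : ℤ} (hy : y ∈ gr e) (hx : x ∈ gr d) (hc : c ∈ gr 0) {k : ℕ} (j : Fin k) (v : Fin k → V)
    (hv : ∀ i, v i = if i = j then x else c) :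
    w (k + 1) (Fin.cons y v) = w (k + 1) (Fin.cons y (firstArg x c k)) := by
  have : NeZero k := ⟨by have := j.2; omega⟩
  rw [h (k + 1) (Equiv.swap (Fin.succ 0) j.succ) (Fin.cons e fun i => if i = j then d else 0)
    (Fin.cons y v) (fun i => by
      refine Fin.cases ?_ (fun i => ?_) i
      · simpa using hy
      · simp only [Fin.cons_succ]; rw [hv]; split_ifs <;> assumption)]
  have hk : koszul (Fin.cons e fun i => if i = j then d else 0)
      (Equiv.swap (Fin.succ 0) j.succ) = 0 := by
    refine Finset.sum_eq_zero fun a _ => Finset.sum_eq_zero fun b _ => ?_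
    split_ifs with hab
    · obtain ⟨hab, hab'⟩ := hab
      have h0 : Equiv.swap (Fin.succ 0) j.succ 0 = 0 :=
        Equiv.swap_apply_of_ne_of_ne (Fin.succ_ne_zero _).symm (Fin.succ_ne_zero _).symm
      rcases Fin.eq_zero_or_eq_succ a with rfl | ⟨a, rfl⟩
      · rw [h0] at hab'
        exact absurd hab' (Fin.not_lt_zero _)
      · have hb : Equiv.swap (Fin.succ 0) j.succ b ≠ 0 := fun hb => by
          have : b = 0 := (Equiv.swap (Fin.succ 0) j.succ).injective (hb.trans h0.symm)
          subst this
          exact Fin.not_lt_zero _ hab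
        have ha : Equiv.swap (Fin.succ 0) j.succ a.succ ≠ 0 := fun ha =>
          Fin.succ_ne_zero a ((Equiv.swap (Fin.succ 0) j.succ).injective (ha.trans h0.symm))
        obtain ⟨a', ha'⟩ := (Fin.exists_succ_eq (x := Equiv.swap (Fin.succ 0) j.succ a.succ)).mpr ha
        obtain ⟨b', hb'⟩ := (Fin.exists_succ_eq (x := Equiv.swap (Fin.succ 0) j.succ b)).mpr hb
        have hne : a' ≠ b' := by
          rintro rfl
          exact hab.ne ((Equiv.swap (Fin.succ 0) j.succ).injective (ha'.symm.trans hb'))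
        rw [← ha', ← hb', Fin.cons_succ, Fin.cons_succ]
        split_ifs with h1 h2
        · exact absurd (h1.trans h2.symm) hne
        all_goals simp
    · rfl
  rw [hk, Int.negOnePow_zero, one_smul]
  congr 1
  funext i
  refine Fin.cases ?_ (fun i => ?_) i
  · rw [Equiv.swap_apply_of_ne_of_ne (Fin.succ_ne_zero _).symm (Fin.succ_ne_zero _).symm]
    rfl
  · rw [← (Fin.succ_injective k).map_swap 0 j i, Fin.cons_succ, Fin.cons_succ, hv, firstArg]
    have : Equiv.swap 0 j i = j ↔ i.1 = 0 := by
      rw [Equiv.swap_apply_eq_iff, Equiv.swap_apply_right, Fin.ext_iff]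
      rfl
    simp only [this]

/-- Apply the relation to one `x` and `n` copies of `c`, and sort the permutations by the block that
receives `x`. If it is the first block, the sign of the outer degree sum is -1, hence the
subtraction; if it is the second, the inner family has degree `1 - 1 = 0`, hence `B 0`. -/
theorem rel_firstArg (h : QuadRel gr l w B) {x c : V} (hx : x ∈ gr (-1)) (hc : c ∈ gr 0) (n : ℕ) :
    ∑ pr ∈ Finset.HasAntidiagonal.antidiagonal n,
      ((pr.2.factorial : ℂ)⁻¹ * (pr.1.factorial : ℂ)⁻¹) •
        ((w (pr.2 + 1) (Fin.cons (l (pr.1 + 1) (Fin.cons x fun _ => c)) fun _ => c) +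
          w (pr.2 + 2) (Fin.cons (l pr.1 fun _ => c) (Fin.cons x fun _ => c))) +
          (B 0 (w pr.1 fun _ => c) (w (pr.2 + 1) (Fin.cons x fun _ => c)) -
          B 1 (w (pr.1 + 1) (Fin.cons x fun _ => c)) (w pr.2 fun _ => c))) = 0 := by
  set A : ℕ → ℕ → W := fun p r => w (r + 1) (Fin.cons (l p (firstArg x c p)) fun _ => c) -
    B 1 (w p (firstArg x c p)) (w r fun _ => c) with hA
  set C : ℕ → ℕ → W := fun p r => w (r + 1) (Fin.cons (l p fun _ => c) (firstArg x c r)) +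
    B 0 (w p fun _ => c) (w r (firstArg x c r)) with hC
  set d : Fin (n + 1) → ℤ := fun i => if i = 0 then -1 else 0 with hd
  set v : Fin (n + 1) → V := fun i => if i = 0 then x else c with hv
  have hdd : ∀ i j, i ≠ j → d i * d j = 0 := fun i j hij => by
    simp only [hd]
    split_ifs with h1 h2
    · exact absurd (h1.trans h2.symm) hij
    all_goals simp
  have hvd : ∀ i, v i ∈ gr (d i) := fun i => by
    simp only [hd, hv]
    split_ifs <;> assumption
  have h1 := h.rel (n + 1) d v hvd
  simp only [← Finset.sum_add_distrib, ← smul_add] at h1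
  have key : ∀ (p : Fin (n + 1 + 1)) (σ : Equiv.Perm (Fin (n + 1))),
      (koszul d σ).negOnePow •
        w (n + 1 - p.1 + 1) (Fin.cons (l p.1 (fun i => v (σ ⟨i.1, by omega⟩)))
          (fun i => v (σ ⟨p.1 + i.1, by omega⟩))) +
      (koszul d σ + ∑ a : Fin p.1, d (σ ⟨a.1, by omega⟩)).negOnePow •
        B (1 + ∑ a : Fin (n + 1 - p.1), d (σ ⟨p.1 + a.1, by omega⟩))
          (w p.1 (fun i => v (σ ⟨i.1, by omega⟩)))
          (w (n + 1 - p.1) (fun i => v (σ ⟨p.1 + i.1, by omega⟩))) =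
      if (σ.symm 0).1 < p.1 then A p.1 (n + 1 - p.1) else C p.1 (n + 1 - p.1) := by
    intro p σ
    rw [koszul_eq_zero hdd, Int.negOnePow_zero, one_smul, zero_add]
    have hσ : ∀ (i : ℕ) (hi : i < n + 1), σ ⟨i, hi⟩ = 0 ↔ i = (σ.symm 0).1 := by
      intro i hi
      rw [← Equiv.eq_symm_apply, Fin.ext_iff]
    split_ifs with hj
    · have e1 : ∀ i : Fin (n + 1 - p.1), v (σ ⟨p.1 + i.1, by omega⟩) = c := fun i => by
        simp only [hv, hσ]; rw [if_neg (by omega)]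
      have e2 : ∀ i : Fin (n + 1 - p.1), d (σ ⟨p.1 + i.1, by omega⟩) = 0 := fun i => by
        simp only [hd, hσ]; rw [if_neg (by omega)]
      have e3 : ∑ i : Fin p.1, d (σ ⟨i.1, by omega⟩) = -1 := by
        rw [Finset.sum_eq_single ⟨(σ.symm 0).1, hj⟩]
        · simp [hd]
        · intro b _ hb
          simp only [hd, hσ]
          rw [if_neg]
          intro hb'
          exact hb (Fin.ext hb')
        · simp
      have e4 : ∀ i : Fin p.1, v (σ ⟨i.1, by omega⟩) =
          if i = ⟨(σ.symm 0).1, hj⟩ then x else c := fun i => by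
        simp only [hv, hσ]
        simp only [Fin.ext_iff]
      rw [e3]
      simp only [e1, e2, Finset.sum_const_zero, add_zero, hA]
      rw [h.l_symm.apply_eq_firstArg hx hc ⟨(σ.symm 0).1, hj⟩ _ e4,
        h.w_symm.apply_eq_firstArg hx hc ⟨(σ.symm 0).1, hj⟩ _ e4]
      rw [Int.negOnePow_neg, Int.negOnePow_one, Units.neg_smul, one_smul, ← sub_eq_add_neg]
    · have hlt := (σ.symm 0).2
      have e1 : ∀ i : Fin p.1, v (σ ⟨i.1, by omega⟩) = c := fun i => by
        simp only [hv, hσ]; rw [if_neg (by omega)]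
      have e2 : ∀ i : Fin p.1, d (σ ⟨i.1, by omega⟩) = 0 := fun i => by
        simp only [hd, hσ]; rw [if_neg (by omega)]
      have hj' : (σ.symm 0).1 - p.1 < n + 1 - p.1 := by omega
      have e3 : ∑ i : Fin (n + 1 - p.1), d (σ ⟨p.1 + i.1, by omega⟩) = -1 := by
        rw [Finset.sum_eq_single ⟨(σ.symm 0).1 - p.1, hj'⟩]
        · simp only [hd, hσ]
          rw [if_pos (by omega)]
        · intro b _ hb
          simp only [hd, hσ]
          rw [if_neg]
          intro hb'
          exact hb (Fin.ext (by simp only; omega))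
        · simp
      have e4 : ∀ i : Fin (n + 1 - p.1), v (σ ⟨p.1 + i.1, by omega⟩) =
          if i = ⟨(σ.symm 0).1 - p.1, hj'⟩ then x else c := fun i => by
        simp only [hv, hσ]
        simp only [Fin.ext_iff]
        congr 1
        apply propext
        omega
      rw [e3]
      simp only [e1, e2, Finset.sum_const_zero, hC]
      rw [h.w_symm.apply_cons_eq_firstArg (h.l_degree _ (fun _ => 0) _ fun _ => hc) hx hc
          ⟨(σ.symm 0).1 - p.1, hj'⟩ _ e4,
        h.w_symm.apply_eq_firstArg hx hc ⟨(σ.symm 0).1 - p.1, hj'⟩ _ e4]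
      rw [Int.negOnePow_zero, one_smul]
      rfl
  simp only [key] at h1
  -- Each position of `x` is realized by `n!` permutations; `p` of the `n + 1` positions lie in the
  -- first block.
  have h2 : ∀ p : Fin (n + 1 + 1), ∑ σ : Equiv.Perm (Fin (n + 1)),
      ((p.1.factorial * (n + 1 - p.1).factorial : ℂ)⁻¹) •
        (if (σ.symm 0).1 < p.1 then A p.1 (n + 1 - p.1) else C p.1 (n + 1 - p.1)) =
      (n.factorial : ℂ) • (((p.1.factorial * (n + 1 - p.1).factorial : ℂ)⁻¹) •
        ((p.1 : ℂ) • A p.1 (n + 1 - p.1) + ((n + 1 - p.1 : ℕ) : ℂ) • C p.1 (n + 1 - p.1))) := by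
    intro p
    rw [← Finset.smul_sum, sum_perm_apply_inv_zero n (fun j => if j.1 < p.1 then
      A p.1 (n + 1 - p.1) else C p.1 (n + 1 - p.1)), ← Nat.cast_smul_eq_nsmul ℂ, smul_comm]
    congr 2
    rw [Fin.sum_univ_eq_sum_range (fun j => if j < p.1 then A p.1 (n + 1 - p.1)
      else C p.1 (n + 1 - p.1)), Finset.sum_ite, Finset.sum_const, Finset.sum_const,
      ← Nat.cast_smul_eq_nsmul ℂ, ← Nat.cast_smul_eq_nsmul ℂ]
    have hp := p.2
    have c1 : (Finset.range (n + 1)).filter (fun j => j < p.1) = Finset.range p.1 := by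
      ext j; simp; omega
    have c2 : (Finset.range (n + 1)).filter (fun j => ¬ j < p.1) = Finset.Ico p.1 (n + 1) := by
      ext j; simp; omega
    rw [c1, c2, Finset.card_range, Nat.card_Ico]
  simp only [h2] at h1
  rw [← Finset.smul_sum, smul_eq_zero] at h1
  replace h1 := h1.resolve_left (Nat.cast_ne_zero.mpr n.factorial_ne_zero)
  rw [Fin.sum_univ_eq_sum_range (fun p => ((p.factorial * (n + 1 - p).factorial : ℂ)⁻¹) •
    ((p : ℂ) • A p (n + 1 - p) + ((n + 1 - p : ℕ) : ℂ) • C p (n + 1 - p)))] at h1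
  simp only [smul_add, Finset.sum_add_distrib] at h1
  -- The `A` term at `p = 0` and the `C` term at `p = n + 1` have weight zero. Dropping them and
  -- shifting `A` by one brings both sums over the same range.
  rw [Finset.sum_range_succ', Finset.sum_range_succ (fun p => ((p.factorial *
    (n + 1 - p).factorial : ℂ)⁻¹) • ((n + 1 - p : ℕ) : ℂ) • C p (n + 1 - p))] at h1
  simp only [Nat.cast_zero, zero_smul, smul_zero, add_zero, Nat.sub_self,
    Nat.add_sub_add_right] at h1
  rw [← Finset.sum_add_distrib] at h1
  rw [Finset.Nat.sum_antidiagonal_eq_sum_range_succ (fun p r =>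
    ((r.factorial : ℂ)⁻¹ * (p.factorial : ℂ)⁻¹) •
      ((w (r + 1) (Fin.cons (l (p + 1) (Fin.cons x fun _ => c)) fun _ => c) +
          w (r + 2) (Fin.cons (l p fun _ => c) (Fin.cons x fun _ => c))) +
          (B 0 (w p fun _ => c) (w (r + 1) (Fin.cons x fun _ => c)) -
          B 1 (w (p + 1) (Fin.cons x fun _ => c)) (w r fun _ => c)))), ← h1]
  refine Finset.sum_congr rfl fun p hp => ?_
  have hp' : n + 1 - p = n - p + 1 := by have := Finset.mem_range.mp hp; omega
  rw [hp', smul_smul, smul_smul]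
  have f1 : (((p + 1).factorial : ℂ) * ((n - p).factorial : ℂ))⁻¹ * ((p + 1 : ℕ) : ℂ) =
      ((n - p).factorial : ℂ)⁻¹ * (p.factorial : ℂ)⁻¹ := by
    have a1 : ((p + 1 : ℕ) : ℂ) ≠ 0 := Nat.cast_ne_zero.mpr (by omega)
    rw [Nat.factorial_succ, Nat.cast_mul, mul_inv, mul_inv]
    field_simp
  have f2 : ((p.factorial : ℂ) * ((n - p + 1).factorial : ℂ))⁻¹ * ((n - p + 1 : ℕ) : ℂ) =
      ((n - p).factorial : ℂ)⁻¹ * (p.factorial : ℂ)⁻¹ := by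
    have a1 : ((n - p + 1 : ℕ) : ℂ) ≠ 0 := Nat.cast_ne_zero.mpr (by omega)
    rw [Nat.factorial_succ, Nat.cast_mul, mul_inv, mul_inv]
    field_simp
  rw [f1, f2, ← smul_add]
  congr 1
  simp only [hA, hC, firstArg_succ]
  abel

end QuadRel

end Relations

/-! ### Quadratic relations for exponential sums -/

section SeriesRelations

open GradedOps Finset.Nat

variable {V : Type*} [AddCommGroup V] [Module ℂ V] {W : Type*} [AddCommGroup W] [Module ℂ W]

/-- The truncation of a power series to a polynomial of degree at most `N`. -/
def truncPoly (c : ℕ → V) (N : ℕ) : ℕ →₀ V :=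
  ∑ j ∈ Finset.range (N + 1), Finsupp.single j (c j)

omit [Module ℂ V] in
theorem truncPoly_apply (c : ℕ → V) {N j : ℕ} (h : j ≤ N) : truncPoly c N j = c j := by
  rw [truncPoly, Finsupp.finsetSum_apply]
  simp only [Finsupp.single_apply]
  rw [Finset.sum_ite_eq', if_pos (by simpa [Nat.lt_succ_iff] using h)]

theorem polyEval_truncPoly_mem {S : Submodule ℂ V} {c : ℕ → V} (h : ∀ j, c j ∈ S) (N : ℕ) (t : ℂ) :
    polyEval t (truncPoly c N) ∈ S := by
  rw [truncPoly, polyEval_sum]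
  exact S.sum_mem fun j _ => by rw [polyEval_single]; exact S.smul_mem _ (h j)

theorem polyEval_cons {k : ℕ} (t : ℂ) (x : ℕ →₀ V) (z : Fin k → ℕ →₀ V) :
    (fun a : Fin (k + 1) => polyEval t ((Fin.cons x z : Fin (k + 1) → ℕ →₀ V) a)) =
      Fin.cons (polyEval t x) fun a => polyEval t (z a) := by
  funext a
  refine Fin.cases ?_ (fun b => ?_) a <;> simp

omit [Module ℂ V] in
theorem coe_cons {k : ℕ} (x : ℕ →₀ V) (z : Fin k → ℕ →₀ V) :
    (fun a : Fin (k + 1) => (⇑((Fin.cons x z : Fin (k + 1) → ℕ →₀ V) a) : ℕ → V)) =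
      Fin.cons (⇑x) fun a => ⇑(z a) := by
  funext a
  refine Fin.cases ?_ (fun b => ?_) a <;> simp

omit [AddCommGroup V] [Module ℂ V] in
theorem forall_cons_of_forall {k N : ℕ} {x x' : ℕ → V} {z z' : Fin k → ℕ → V}
    (h : ∀ j ≤ N, x j = x' j) (h' : ∀ a, ∀ j ≤ N, z a j = z' a j) (a : Fin (k + 1)) :
    ∀ j ≤ N, (Fin.cons x z : Fin (k + 1) → ℕ → V) a j =
      (Fin.cons x' z' : Fin (k + 1) → ℕ → V) a j := by
  refine Fin.cases ?_ (fun b => ?_) a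
  · simpa using h
  · simpa using h' b

theorem sum_antidiagonal_congr {U : Type*} [AddCommGroup U] [Module ℂ U] (B : V →ₗ[ℂ] W →ₗ[ℂ] U)
    {N : ℕ} {f f' : ℕ → V} {g g' : ℕ → W} (hf : ∀ j ≤ N, f j = f' j) (hg : ∀ j ≤ N, g j = g' j) :
    ∑ ab ∈ Finset.HasAntidiagonal.antidiagonal N, B (f ab.1) (g ab.2) =
      ∑ ab ∈ Finset.HasAntidiagonal.antidiagonal N, B (f' ab.1) (g' ab.2) := by
  refine Finset.sum_congr rfl fun ab hab => ?_
  have := Finset.HasAntidiagonal.mem_antidiagonal.mp hab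
  rw [hf _ (by omega), hg _ (by omega)]

theorem sum_antidiagonal_eq_zero {U : Type*} [AddCommGroup U] [Module ℂ U]
    (B : V →ₗ[ℂ] W →ₗ[ℂ] U) {N p q : ℕ} {f : ℕ → V} {g : ℕ → W} (hf : ∀ j < p, f j = 0)
    (hg : ∀ j < q, g j = 0) (h : N < p + q) :
    ∑ ab ∈ Finset.HasAntidiagonal.antidiagonal N, B (f ab.1) (g ab.2) = 0 := by
  refine Finset.sum_eq_zero fun ab hab => ?_
  have := Finset.HasAntidiagonal.mem_antidiagonal.mp hab
  rcases Nat.lt_or_ge ab.1 p with h1 | h1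
  · rw [hf _ h1, map_zero, LinearMap.zero_apply]
  · rw [hg _ (by omega), map_zero]

theorem sum_antidiagonal_eq_sum_smul {U ι κ : Type*} [AddCommGroup U] [Module ℂ U]
    (B : V →ₗ[ℂ] W →ₗ[ℂ] U) (N : ℕ) (s : Finset ι) (s' : Finset κ) (a : ι → ℂ) (b : κ → ℂ)
    (f : ℕ → V) (g : ℕ → W) (F : ι → ℕ → V) (G : κ → ℕ → W)
    (hf : ∀ j ≤ N, f j = ∑ p ∈ s, a p • F p j) (hg : ∀ j ≤ N, g j = ∑ p ∈ s', b p • G p j) :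
    ∑ ab ∈ Finset.HasAntidiagonal.antidiagonal N, B (f ab.1) (g ab.2) =
    ∑ r ∈ s', ∑ p ∈ s, (b r * a p) •
      ∑ ab ∈ Finset.HasAntidiagonal.antidiagonal N, B (F p ab.1) (G r ab.2) := by
  rw [sum_antidiagonal_congr B hf hg]
  simp only [map_sum, LinearMap.sum_apply, map_smul, LinearMap.smul_apply, Finset.smul_sum,
    smul_smul]
  rw [Finset.sum_comm]
  refine Finset.sum_congr rfl fun r _ => ?_
  rw [Finset.sum_comm]

namespace QuadRel

variable {gr : ℤ → Submodule ℂ V} {l : ∀ k, MultilinearMap ℂ (fun _ : Fin k => V) V}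
  {w : ∀ k, MultilinearMap ℂ (fun _ : Fin k => V) W} {B : ℤ → W →ₗ[ℂ] W →ₗ[ℂ] W}

/-- `rel_const` holds for the value at every `t` of the truncation of `c`; both sides are polynomial
in `t`, so their coefficients agree. -/
theorem rel_ser (h : QuadRel gr l w B) {c : ℕ → V} (hc : ∀ j, c j ∈ gr 0) (n N : ℕ) :
    ∑ pr ∈ Finset.HasAntidiagonal.antidiagonal n,
      ((pr.2.factorial : ℂ)⁻¹ * (pr.1.factorial : ℂ)⁻¹) •
        (ser (w (pr.2 + 1)) (Fin.cons (ser (l pr.1) fun _ => c) fun _ => c) N +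
          ∑ ab ∈ Finset.HasAntidiagonal.antidiagonal N,
            B 1 (ser (w pr.1) (fun _ => c) ab.1) (ser (w pr.2) (fun _ => c) ab.2)) = 0 := by
  set P := truncPoly c N with hP
  have hPc : ∀ j ≤ N, c j = P j := fun j hj => (truncPoly_apply c hj).symm
  choose Ql hQl hQl' using fun p => exists_poly_ser (l p) fun _ => P
  choose Qw hQw hQw' using fun p => exists_poly_ser (w p) fun _ => P
  choose Q₁ hQ₁ hQ₁' using fun p r => exists_poly_ser (w (r + 1)) (Fin.cons (Ql p) fun _ => P)
  choose Q₂ hQ₂ hQ₂' using fun p r => exists_poly_conv (B 1) (Qw p) (Qw r)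
  have hQ : ∑ pr ∈ Finset.HasAntidiagonal.antidiagonal n,
      ((pr.2.factorial : ℂ)⁻¹ * (pr.1.factorial : ℂ)⁻¹) •
        (Q₁ pr.1 pr.2 + Q₂ pr.1 pr.2) = 0 := by
    refine polyEval_injective fun t _ => ?_
    simp only [polyEval_sum, polyEval_smul, polyEval_add, hQ₁', hQ₂', hQw', polyEval_cons, hQl']
    exact h.rel_const (polyEval_truncPoly_mem hc N t) n
  have := DFunLike.congr_fun hQ N
  rw [Finsupp.finsetSum_apply, Finsupp.zero_apply] at this
  rw [← this]
  refine Finset.sum_congr rfl fun pr _ => ?_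
  rw [Finsupp.smul_apply, Finsupp.add_apply, hQ₁, hQ₂, coe_cons]
  have e1 : ∀ p, ∀ j ≤ N, ser (l p) (fun _ => c) j = Ql p j := fun p j hj => by
    rw [hQl]; exact ser_congr _ fun _ i hi => hPc i (hi.trans hj)
  have e2 : ∀ p, ∀ j ≤ N, ser (w p) (fun _ => c) j = Qw p j := fun p j hj => by
    rw [hQw]; exact ser_congr _ fun _ i hi => hPc i (hi.trans hj)
  rw [ser_congr _ (forall_cons_of_forall (e1 pr.1) fun _ => hPc),
    sum_antidiagonal_congr (B 1) (e2 pr.1) (e2 pr.2)]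

theorem rel_ser_cons (h : QuadRel gr l w B) {x c : ℕ → V} (hx : ∀ j, x j ∈ gr (-1))
    (hc : ∀ j, c j ∈ gr 0) (n N : ℕ) :
    ∑ pr ∈ Finset.HasAntidiagonal.antidiagonal n,
      ((pr.2.factorial : ℂ)⁻¹ * (pr.1.factorial : ℂ)⁻¹) •
        ((ser (w (pr.2 + 1)) (Fin.cons (ser (l (pr.1 + 1)) (Fin.cons x fun _ => c))
            fun _ => c) N +
          ser (w (pr.2 + 2)) (Fin.cons (ser (l pr.1) fun _ => c) (Fin.cons x fun _ => c)) N) +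
          (∑ ab ∈ Finset.HasAntidiagonal.antidiagonal N,
            B 0 (ser (w pr.1) (fun _ => c) ab.1)
              (ser (w (pr.2 + 1)) (Fin.cons x fun _ => c) ab.2) -
          ∑ ab ∈ Finset.HasAntidiagonal.antidiagonal N,
            B 1 (ser (w (pr.1 + 1)) (Fin.cons x fun _ => c) ab.1)
              (ser (w pr.2) (fun _ => c) ab.2))) = 0 := by
  set P := truncPoly c N with hP
  set X := truncPoly x N with hX
  have hPc : ∀ j ≤ N, c j = P j := fun j hj => (truncPoly_apply c hj).symm
  have hXx : ∀ j ≤ N, x j = X j := fun j hj => (truncPoly_apply x hj).symm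
  choose Ql hQl hQl' using fun p => exists_poly_ser (l p) fun _ => P
  choose Rl hRl hRl' using fun p => exists_poly_ser (l (p + 1)) (Fin.cons X fun _ => P)
  choose Qw hQw hQw' using fun p => exists_poly_ser (w p) fun _ => P
  choose Rw hRw hRw' using fun p => exists_poly_ser (w (p + 1)) (Fin.cons X fun _ => P)
  choose Q₁ hQ₁ hQ₁' using fun p r => exists_poly_ser (w (r + 1)) (Fin.cons (Rl p) fun _ => P)
  choose Q₂ hQ₂ hQ₂' using fun p r => exists_poly_ser (w (r + 2))
    (Fin.cons (Ql p) (Fin.cons X fun _ => P))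
  choose Q₃ hQ₃ hQ₃' using fun p r => exists_poly_conv (B 0) (Qw p) (Rw r)
  choose Q₄ hQ₄ hQ₄' using fun p r => exists_poly_conv (B 1) (Rw p) (Qw r)
  have hQ : ∑ pr ∈ Finset.HasAntidiagonal.antidiagonal n,
      ((pr.2.factorial : ℂ)⁻¹ * (pr.1.factorial : ℂ)⁻¹) •
        ((Q₁ pr.1 pr.2 + Q₂ pr.1 pr.2) + (Q₃ pr.1 pr.2 + (-1 : ℂ) • Q₄ pr.1 pr.2)) = 0 := by
    refine polyEval_injective fun t _ => ?_
    simp only [polyEval_sum, polyEval_smul, polyEval_add, hQ₁', hQ₂', hQ₃', hQ₄', hQw', hRw',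
      polyEval_cons, hQl', hRl']
    simp only [neg_one_smul, ← sub_eq_add_neg]
    exact h.rel_firstArg (polyEval_truncPoly_mem hx N t) (polyEval_truncPoly_mem hc N t) n
  have := DFunLike.congr_fun hQ N
  rw [Finsupp.finsetSum_apply, Finsupp.zero_apply] at this
  rw [← this]
  refine Finset.sum_congr rfl fun pr _ => ?_
  rw [Finsupp.smul_apply, Finsupp.add_apply, Finsupp.add_apply, Finsupp.add_apply,
    Finsupp.smul_apply, neg_one_smul, ← sub_eq_add_neg, hQ₁, hQ₂, hQ₃, hQ₄, coe_cons, coe_cons,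
    coe_cons]
  have e1 : ∀ p, ∀ j ≤ N, ser (l p) (fun _ => c) j = Ql p j := fun p j hj => by
    rw [hQl]; exact ser_congr _ fun _ i hi => hPc i (hi.trans hj)
  have e2 : ∀ p, ∀ j ≤ N, ser (w p) (fun _ => c) j = Qw p j := fun p j hj => by
    rw [hQw]; exact ser_congr _ fun _ i hi => hPc i (hi.trans hj)
  have e3 : ∀ p, ∀ j ≤ N, ser (l (p + 1)) (Fin.cons x fun _ => c) j = Rl p j := fun p j hj => by
    rw [hRl, coe_cons]
    exact ser_congr _ (forall_cons_of_forall (fun i hi => hXx i (hi.trans hj))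
      fun _ i hi => hPc i (hi.trans hj))
  have e4 : ∀ p, ∀ j ≤ N, ser (w (p + 1)) (Fin.cons x fun _ => c) j = Rw p j := fun p j hj => by
    rw [hRw, coe_cons]
    exact ser_congr _ (forall_cons_of_forall (fun i hi => hXx i (hi.trans hj))
      fun _ i hi => hPc i (hi.trans hj))
  rw [ser_congr _ (forall_cons_of_forall (e3 pr.1) fun _ => hPc),
    ser_congr _ (forall_cons_of_forall (e1 pr.1) (forall_cons_of_forall hXx fun _ => hPc)),
    sum_antidiagonal_congr (B 0) (e2 pr.1) (e4 pr.2),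
    sum_antidiagonal_congr (B 1) (e4 pr.1) (e2 pr.2)]

theorem expSum_l_zero (h : QuadRel gr l w B) (c : ℕ → V) : expSum l c 0 = 0 := by
  rw [expSum_zero, h.l_zero, _root_.zero_apply]

/-- The curvature identity: `w ∘ l + B (w, w) = 0` for exponential sums. -/
theorem expSum_rel (h : QuadRel gr l w B) {c : ℕ → V} (hc : ∀ j, c j ∈ gr 0) (hc0 : c 0 = 0)
    (N : ℕ) : expSum₁ w (expSum l c) c N +
      ∑ ab ∈ Finset.HasAntidiagonal.antidiagonal N,
        B 1 (expSum w c ab.1) (expSum w c ab.2) = 0 := by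
  have e1 : expSum₁ w (expSum l c) c N = ∑ r ∈ Finset.range (N + 1),
      ∑ p ∈ Finset.range (N + 1), ((r.factorial : ℂ)⁻¹ * (p.factorial : ℂ)⁻¹) •
        ser (w (r + 1)) (Fin.cons (ser (l p) fun _ => c) fun _ => c) N := by
    rw [expSum₁_eq_sum (h.expSum_l_zero c) hc0 (Nat.le_succ N)]
    refine Finset.sum_congr rfl fun r _ => ?_
    rw [ser_congr _ (forall_cons_of_forall (x' := fun n => ∑ p ∈ Finset.range (N + 1),
      (p.factorial : ℂ)⁻¹ • ser (l p) (fun _ => c) n)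
      (fun j hj => expSum_eq_sum hc0 (by omega)) fun _ _ _ => rfl), ser_cons_sum, Finset.smul_sum]
    exact Finset.sum_congr rfl fun p _ => smul_smul _ _ _
  have e2 : ∑ ab ∈ Finset.HasAntidiagonal.antidiagonal N,
      B 1 (expSum w c ab.1) (expSum w c ab.2) = ∑ r ∈ Finset.range (N + 1),
      ∑ p ∈ Finset.range (N + 1), ((r.factorial : ℂ)⁻¹ * (p.factorial : ℂ)⁻¹) •
        ∑ ab ∈ Finset.HasAntidiagonal.antidiagonal N,
            B 1 (ser (w p) (fun _ => c) ab.1) (ser (w r) (fun _ => c) ab.2) := by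
    exact sum_antidiagonal_eq_sum_smul (B 1) N (Finset.range (N + 1)) (Finset.range (N + 1))
      (fun p => (p.factorial : ℂ)⁻¹) (fun r => (r.factorial : ℂ)⁻¹) (expSum w c) (expSum w c)
      (fun p => ser (w p) fun _ => c) (fun p => ser (w p) fun _ => c)
      (fun j hj => expSum_eq_sum hc0 (by omega)) (fun j hj => expSum_eq_sum hc0 (by omega))
  rw [e1, e2, ← Finset.sum_add_distrib]
  simp only [← Finset.sum_add_distrib, ← smul_add]
  rw [sum_range_range_eq_sum_antidiagonal (G := fun p r =>
    ((r.factorial : ℂ)⁻¹ * (p.factorial : ℂ)⁻¹) •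
      (ser (w (r + 1)) (Fin.cons (ser (l p) fun _ => c) fun _ => c) N +
        ∑ ab ∈ Finset.HasAntidiagonal.antidiagonal N,
          B 1 (ser (w p) (fun _ => c) ab.1) (ser (w r) (fun _ => c) ab.2)))]
  · exact Finset.sum_eq_zero fun n _ => h.rel_ser hc n N
  -- Off the triangle `p + r ≤ N` everything vanishes because `c` has order at least one.
  · intro p r hpr
    rw [ser_cons_eq_zero p (fun j hj => ser_const_eq_zero hc0 _ hj) hc0 _ (by omega),
      sum_antidiagonal_eq_zero (B 1) (fun j hj => ser_const_eq_zero hc0 _ hj)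
        (fun j hj => ser_const_eq_zero hc0 _ hj) (by omega), add_zero, smul_zero]

/-- The linearization of the curvature identity in a direction of degree `-1`. -/
theorem expSum₁_rel (h : QuadRel gr l w B) {x c : ℕ → V} (hx : ∀ j, x j ∈ gr (-1))
    (hc : ∀ j, c j ∈ gr 0) (hx0 : x 0 = 0) (hc0 : c 0 = 0) (N : ℕ) :
    (expSum₁ w (expSum₁ l x c) c N + expSum₂ w (expSum l c) x c N) +
      (∑ ab ∈ Finset.HasAntidiagonal.antidiagonal N,
        B 0 (expSum w c ab.1) (expSum₁ w x c ab.2) -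
      ∑ ab ∈ Finset.HasAntidiagonal.antidiagonal N,
        B 1 (expSum₁ w x c ab.1) (expSum w c ab.2)) = 0 := by
  have e1 : expSum₁ w (expSum₁ l x c) c N = ∑ r ∈ Finset.range (N + 1),
      ∑ p ∈ Finset.range (N + 1), ((r.factorial : ℂ)⁻¹ * (p.factorial : ℂ)⁻¹) •
        ser (w (r + 1)) (Fin.cons (ser (l (p + 1)) (Fin.cons x fun _ => c)) fun _ => c) N := by
    rw [expSum₁_eq_sum expSum₁_zero hc0 (Nat.le_succ N)]
    refine Finset.sum_congr rfl fun r _ => ?_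
    rw [ser_congr _ (forall_cons_of_forall (x' := fun n => ∑ p ∈ Finset.range (N + 1),
      (p.factorial : ℂ)⁻¹ • ser (l (p + 1)) (Fin.cons x fun _ => c) n)
      (fun j hj => expSum₁_eq_sum hx0 hc0 (by omega)) fun _ _ _ => rfl), ser_cons_sum,
      Finset.smul_sum]
    exact Finset.sum_congr rfl fun p _ => smul_smul _ _ _
  have e2 : expSum₂ w (expSum l c) x c N = ∑ r ∈ Finset.range (N + 1),
      ∑ p ∈ Finset.range (N + 1), ((r.factorial : ℂ)⁻¹ * (p.factorial : ℂ)⁻¹) •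
        ser (w (r + 2)) (Fin.cons (ser (l p) fun _ => c) (Fin.cons x fun _ => c)) N := by
    rw [expSum₂_eq_sum (h.expSum_l_zero c) hc0 (Nat.le_succ N)]
    refine Finset.sum_congr rfl fun r _ => ?_
    rw [ser_congr _ (forall_cons_of_forall (x' := fun n => ∑ p ∈ Finset.range (N + 1),
      (p.factorial : ℂ)⁻¹ • ser (l p) (fun _ => c) n)
      (fun j hj => expSum_eq_sum hc0 (by omega)) fun _ _ _ => rfl), ser_cons_sum, Finset.smul_sum]
    exact Finset.sum_congr rfl fun p _ => smul_smul _ _ _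
  have e3 : ∑ ab ∈ Finset.HasAntidiagonal.antidiagonal N,
      B 0 (expSum w c ab.1) (expSum₁ w x c ab.2) = ∑ r ∈ Finset.range (N + 1),
      ∑ p ∈ Finset.range (N + 1), ((r.factorial : ℂ)⁻¹ * (p.factorial : ℂ)⁻¹) •
        ∑ ab ∈ Finset.HasAntidiagonal.antidiagonal N, B 0 (ser (w p) (fun _ => c) ab.1)
          (ser (w (r + 1)) (Fin.cons x fun _ => c) ab.2) := by
    exact sum_antidiagonal_eq_sum_smul (B 0) N (Finset.range (N + 1)) (Finset.range (N + 1))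
      (fun p => (p.factorial : ℂ)⁻¹) (fun r => (r.factorial : ℂ)⁻¹) (expSum w c) (expSum₁ w x c)
      (fun p => ser (w p) fun _ => c) (fun p => ser (w (p + 1)) (Fin.cons x fun _ => c))
      (fun j hj => expSum_eq_sum hc0 (by omega)) (fun j hj => expSum₁_eq_sum hx0 hc0 (by omega))
  have e4 : ∑ ab ∈ Finset.HasAntidiagonal.antidiagonal N,
      B 1 (expSum₁ w x c ab.1) (expSum w c ab.2) = ∑ r ∈ Finset.range (N + 1),
      ∑ p ∈ Finset.range (N + 1), ((r.factorial : ℂ)⁻¹ * (p.factorial : ℂ)⁻¹) •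
        ∑ ab ∈ Finset.HasAntidiagonal.antidiagonal N,
          B 1 (ser (w (p + 1)) (Fin.cons x fun _ => c) ab.1) (ser (w r) (fun _ => c) ab.2) := by
    exact sum_antidiagonal_eq_sum_smul (B 1) N (Finset.range (N + 1)) (Finset.range (N + 1))
      (fun p => (p.factorial : ℂ)⁻¹) (fun r => (r.factorial : ℂ)⁻¹) (expSum₁ w x c) (expSum w c)
      (fun p => ser (w (p + 1)) (Fin.cons x fun _ => c)) (fun p => ser (w p) fun _ => c)
      (fun j hj => expSum₁_eq_sum hx0 hc0 (by omega)) (fun j hj => expSum_eq_sum hc0 (by omega))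
  rw [e1, e2, e3, e4]
  simp only [← Finset.sum_add_distrib, ← Finset.sum_sub_distrib, ← smul_add, ← smul_sub]
  rw [sum_range_range_eq_sum_antidiagonal (G := fun p r =>
    ((r.factorial : ℂ)⁻¹ * (p.factorial : ℂ)⁻¹) •
      ((ser (w (r + 1)) (Fin.cons (ser (l (p + 1)) (Fin.cons x fun _ => c)) fun _ => c) N +
          ser (w (r + 2)) (Fin.cons (ser (l p) fun _ => c) (Fin.cons x fun _ => c)) N) +
          ∑ ab ∈ Finset.HasAntidiagonal.antidiagonal N,
            (B 0 (ser (w p) (fun _ => c) ab.1) (ser (w (r + 1)) (Fin.cons x fun _ => c) ab.2) -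
            B 1 (ser (w (p + 1)) (Fin.cons x fun _ => c) ab.1) (ser (w r) (fun _ => c) ab.2))))]
  · exact Finset.sum_eq_zero fun n _ => by
      simpa only [Finset.sum_sub_distrib] using h.rel_ser_cons hx hc n N
  · intro p r hpr
    rw [ser_cons_eq_zero (p + 1)
        (fun j hj => ser_cons_eq_zero 1 (by simpa using hx0) hc0 _ (by omega)) hc0 _ (by omega),
      ser_cons_cons_eq_zero p 1 (fun j hj => ser_const_eq_zero hc0 _ hj) (by simpa using hx0) hc0 _
        (by omega),
      Finset.sum_sub_distrib, sum_antidiagonal_eq_zero (B 0) (N := N) (p := p) (q := r + 1) (f := ser (w p) fun _ => c)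
        (g := ser (w (r + 1)) (Fin.cons x fun _ => c))
        (fun j hj => ser_const_eq_zero hc0 _ hj)
        (fun j hj => ser_cons_eq_zero 1 (by simpa using hx0) hc0 _ (by omega)) (by omega),
      sum_antidiagonal_eq_zero (B 1) (N := N) (p := p + 1) (q := r) (f := ser (w (p + 1)) (Fin.cons x fun _ => c))
        (g := ser (w r) fun _ => c)
        (fun j hj => ser_cons_eq_zero 1 (by simpa using hx0) hc0 _ (by omega))
        (fun j hj => ser_const_eq_zero hc0 _ hj) (by omega), sub_zero, add_zero, add_zero,
      smul_zero]

end QuadRel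

end SeriesRelations

/-! ### Insertion operators on functions of lists -/

set_option linter.unusedSectionVars false

section ListInsertion

variable {V W : Type*} [AddCommGroup V] [Module ℂ V] [AddCommGroup W] [Module ℂ W]

/-- `∑ φ (y (b) :: c)` over the decompositions `l = b ++ c`. -/
def prefixInsert (y : List V → V) (φ : List V → W) (l : List V) : W :=
  ∑ s ∈ Finset.range (l.length + 1), φ (y (l.take s) :: l.drop s)

/-- `∑ φ (ε a ++ y (b) :: c)` over the decompositions `l = a ++ b ++ c`. -/
def insertSum (ε : V → V) (y : List V → V) (φ : List V → W) (l : List V) : W :=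
  ∑ i ∈ Finset.range (l.length + 1), ∑ s ∈ Finset.range (l.length + 1 - i),
    φ ((l.take i).map ε ++ y ((l.drop i).take s) :: l.drop (i + s))

/-- `∑ φ (x (b₁), y (b₂))`: the sum over the decompositions `l = b ++ c` of the insertions of `y`
into the remainder `c`, where `b` is replaced by `g b`. -/
def prefixPair (g : List V → V) (f : V → V) (y : List V → V) (φ : List V → W) (l : List V) : W :=
  ∑ s ∈ Finset.range (l.length + 1), insertSum f y (fun l' => φ (g (l.take s) :: l')) (l.drop s)

/-- `∑ K (φ (ε a ++ ·)) b` over the decompositions `l = a ++ b`. -/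
def sumPrefix (ε : V → V) (K : (List V → W) → List V → W) : (List V → W) → List V → W
  | φ, [] => K φ []
  | φ, o :: l => K φ (o :: l) + sumPrefix ε K (fun l' => φ (ε o :: l')) l

@[simp] theorem prefixInsert_nil (y : List V → V) (φ : List V → W) :
    prefixInsert y φ [] = φ [y []] := by simp [prefixInsert]

theorem prefixInsert_cons (y : List V → V) (φ : List V → W) (o : V) (l : List V) :
    prefixInsert y φ (o :: l) = φ (y [] :: o :: l) + prefixInsert (fun b => y (o :: b)) φ l := by
  rw [prefixInsert, List.length_cons, Finset.sum_range_succ', add_comm]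
  rfl

@[simp] theorem insertSum_nil (ε : V → V) (y : List V → V) (φ : List V → W) :
    insertSum ε y φ [] = φ [y []] := by simp [insertSum]

theorem insertSum_cons (ε : V → V) (y : List V → V) (φ : List V → W) (o : V) (l : List V) :
    insertSum ε y φ (o :: l) =
      prefixInsert y φ (o :: l) + insertSum ε y (fun l' => φ (ε o :: l')) l := by
  rw [insertSum, List.length_cons, Finset.sum_range_succ', add_comm]
  congr 1
  · simp [prefixInsert]
  · refine Finset.sum_congr rfl fun i _ => ?_
    rw [Nat.add_sub_add_right]
    refine Finset.sum_congr rfl fun s _ => ?_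
    rw [List.take_succ_cons, List.drop_succ_cons, List.map_cons, List.cons_append,
      Nat.add_right_comm, List.drop_succ_cons]

@[simp] theorem prefixPair_nil (g : List V → V) (f : V → V) (y : List V → V) (φ : List V → W) :
    prefixPair g f y φ [] = φ [g [], y []] := by simp [prefixPair]

theorem prefixPair_cons (g : List V → V) (f : V → V) (y : List V → V) (φ : List V → W) (o : V)
    (l : List V) : prefixPair g f y φ (o :: l) =
      insertSum f y (fun l' => φ (g [] :: l')) (o :: l) +
        prefixPair (fun b => g (o :: b)) f y φ l := by
  rw [prefixPair, List.length_cons, Finset.sum_range_succ', add_comm]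
  rfl

theorem insertSum_add (ε : V → V) (y : List V → V) (φ ψ : List V → W) (l : List V) :
    insertSum ε y (fun l => φ l + ψ l) l = insertSum ε y φ l + insertSum ε y ψ l := by
  simp only [insertSum, Finset.sum_add_distrib]

theorem insertSum_smul (ε : V → V) (y : List V → V) (a : ℂ) (φ : List V → W) (l : List V) :
    insertSum ε y (fun l => a • φ l) l = a • insertSum ε y φ l := by
  simp only [insertSum, Finset.smul_sum]

/-- `φ` is linear in each entry of the list. -/
structure EntryLinear (φ : List V → W) : Prop where
  add : ∀ a c v w, φ (a ++ (v + w) :: c) = φ (a ++ v :: c) + φ (a ++ w :: c)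
  smul : ∀ a c (t : ℂ) v, φ (a ++ (t • v) :: c) = t • φ (a ++ v :: c)

theorem EntryLinear.cons {φ : List V → W} (h : EntryLinear φ) (o : V) :
    EntryLinear fun l => φ (o :: l) :=
  ⟨fun a c v w => h.add (o :: a) c v w, fun a c t v => h.smul (o :: a) c t v⟩

theorem EntryLinear.prefixInsert_add {φ : List V → W} (h : EntryLinear φ) (x y : List V → V)
    (l : List V) : prefixInsert (fun b => x b + y b) φ l =
      prefixInsert x φ l + prefixInsert y φ l := by
  simp only [prefixInsert, ← Finset.sum_add_distrib]
  exact Finset.sum_congr rfl fun s _ => h.add [] _ _ _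

/-- After `y` has consumed an initial segment, `x` either consumes the output of `y` or consumes
nothing and stands in front of it. The second case is the extra summand with `x []`. -/
theorem EntryLinear.prefixInsert_prefixInsert {φ : List V → W} (h : EntryLinear φ)
    (x y : List V → V) (l : List V) :
    prefixInsert y (prefixInsert x φ) l =
      prefixInsert (prefixInsert y x) φ l + prefixInsert y (fun l' => φ (x [] :: l')) l := by
  have key : ∀ (y : List V → V) (l : List V),
      ∑ s ∈ Finset.range (l.length + 1),
        prefixInsert (fun b => x (y (l.take s) :: b)) φ (l.drop s) =
      prefixInsert (prefixInsert y x) φ l := by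
    intro y l
    induction l generalizing y with
    | nil => simp
    | cons o l ih =>
      rw [List.length_cons, Finset.sum_range_succ']
      simp only [List.take_succ_cons, List.drop_succ_cons, List.take_zero, List.drop_zero]
      rw [ih (fun b => y (o :: b)), prefixInsert_cons _ _ o l, prefixInsert_cons _ _ o l]
      simp only [prefixInsert_cons, prefixInsert_nil]
      rw [h.prefixInsert_add]
      abel
  rw [← key, prefixInsert, prefixInsert, ← Finset.sum_add_distrib]
  refine Finset.sum_congr rfl fun s _ => ?_
  rw [prefixInsert_cons, add_comm]

theorem EntryLinear.insertSum_prefixInsert {φ : List V → W} (h : EntryLinear φ) (f : V → V)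
    (x y : List V → V) (l : List V) :
    insertSum f y (prefixInsert x φ) l =
      prefixInsert (insertSum f y x) φ l + prefixPair (fun b => x (b.map f)) f y φ l := by
  induction l generalizing x with
  | nil => simp [prefixInsert_cons, add_comm]
  | cons o l ih =>
    have e : (fun l' => prefixInsert x φ (f o :: l')) =
        fun l' => φ (x [] :: f o :: l') + prefixInsert (fun b => x (f o :: b)) φ l' :=
      funext fun l' => prefixInsert_cons _ _ _ _
    rw [insertSum_cons, h.prefixInsert_prefixInsert, e, insertSum_add, ih, prefixPair_cons,
      insertSum_cons f y _ o l, prefixInsert_cons (insertSum f y x), prefixInsert_cons (prefixInsert y x)]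
    simp only [insertSum_cons, insertSum_nil, prefixInsert_nil, List.map_nil, List.map_cons]
    rw [h.prefixInsert_add]
    abel

/-- Two insertions are nested, or disjoint with `y` on the left, or disjoint with `x` on the left.
In the second case `e` passes over the output of `y`; in the third `f` has acted on the inputs of
`x`; entries before both carry `e ∘ f`. The disjoint terms are interchanged by swapping the roles of
`(e, x)` and `(f, y)`, which yields the pre-Lie identity. -/
theorem EntryLinear.insertSum_insertSum {φ : List V → W} (h : EntryLinear φ) (e f : V → V)
    (x y : List V → V) (l : List V) :
    insertSum f y (insertSum e x φ) l =
      insertSum (e ∘ f) (insertSum f y x) φ l +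
        (sumPrefix (e ∘ f) (prefixPair (fun b => e (y b)) e x) φ l +
          sumPrefix (e ∘ f) (prefixPair (fun b => x (b.map f)) f y) φ l) := by
  induction l generalizing φ with
  | nil => simp [insertSum_cons, prefixInsert_cons, sumPrefix]; abel
  | cons o l ih =>
    have e1 : (fun l' => insertSum e x φ (f o :: l')) = fun l' =>
        prefixInsert x φ (f o :: l') + insertSum e x (fun l'' => φ (e (f o) :: l'')) l' :=
      funext fun l' => insertSum_cons _ _ _ _ _
    have e2 : prefixInsert y (insertSum e x φ) (o :: l) = prefixInsert y (prefixInsert x φ) (o :: l) +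
        prefixPair (fun b => e (y b)) e x φ (o :: l) := by
      simp only [prefixInsert, prefixPair, ← Finset.sum_add_distrib]
      exact Finset.sum_congr rfl fun s _ => insertSum_cons _ _ _ _ _
    have e3 := h.insertSum_prefixInsert f x y (o :: l)
    rw [insertSum_cons] at e3
    rw [insertSum_cons, e1, insertSum_add, ih (h.cons _), e2, insertSum_cons (e ∘ f), sumPrefix, sumPrefix]
    have e4 : prefixInsert y (prefixInsert x φ) (o :: l) = prefixInsert (insertSum f y x) φ (o :: l) +
        prefixPair (fun b => x (b.map f)) f y φ (o :: l) -
        insertSum f y (fun l' => prefixInsert x φ (f o :: l')) l := by rw [← e3]; abel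
    rw [e4]
    simp only [Function.comp_apply]
    abel

theorem EntryLinear.sumPrefix_prefixPair_smul {φ : List V → W} (h : EntryLinear φ) (ε f : V → V)
    (g g' y : List V → V) (a : ℂ) (hg : ∀ b, g b = a • g' b) (l : List V) :
    sumPrefix ε (prefixPair g f y) φ l = a • sumPrefix ε (prefixPair g' f y) φ l := by
  have key : ∀ {φ : List V → W}, EntryLinear φ → ∀ l,
      prefixPair g f y φ l = a • prefixPair g' f y φ l := by
    intro φ h l
    simp only [prefixPair, Finset.smul_sum, ← insertSum_smul]
    refine Finset.sum_congr rfl fun s _ => ?_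
    congr 1
    funext l'
    rw [hg]
    exact h.smul [] _ _ _
  induction l generalizing φ with
  | nil => exact key h _
  | cons o l ih => rw [sumPrefix, sumPrefix, smul_add, key h, ih (h.cons _)]

/-- The pre-Lie identity for insertion operators. -/
theorem EntryLinear.insertSum_insertSum_sub {φ : List V → W} (h : EntryLinear φ) (e f : V → V)
    (x y : List V → V) (hef : e ∘ f = f ∘ e) (a : ℂ) (hx : ∀ b, f (x b) = a • x (b.map f))
    (hy : ∀ b, e (y b) = a • y (b.map e)) (ha : a * a = 1) (l : List V) :
    insertSum f y (insertSum e x φ) l - insertSum (e ∘ f) (insertSum f y x) φ l =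
      a • (insertSum e x (insertSum f y φ) l - insertSum (f ∘ e) (insertSum e x y) φ l) := by
  rw [h.insertSum_insertSum e f, h.insertSum_insertSum f e, add_sub_cancel_left, add_sub_cancel_left,
    h.sumPrefix_prefixPair_smul _ _ _ _ _ a hx, h.sumPrefix_prefixPair_smul _ _ _ _ _ a hy,
    smul_add, smul_smul, ha, one_smul, hef, add_comm]

end ListInsertion

/-! ### Families of multilinear maps as functions of lists -/

set_option linter.unusedSectionVars false

section MultiLists

variable {V : Type*} [AddCommGroup V] [Module ℂ V]

/-- The value of a family of multilinear maps on a list of vectors. -/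
def Multi.onList (X : Multi V) (l : List V) : V := X l.length l.get

theorem Multi.onList_eq (X : Multi V) {l : List V} {n : ℕ} (h : l.length = n) :
    X.onList l = X n fun i => l[i.1] := by
  subst h
  rfl

theorem Multi.onList_ofFn (X : Multi V) {n : ℕ} (f : Fin n → V) : X.onList (List.ofFn f) = X n f := by
  rw [X.onList_eq List.length_ofFn]
  congr 1
  funext i
  simp

theorem Multi.ext_onList {X Y : Multi V} (h : ∀ l, X.onList l = Y.onList l) : X = Y := by
  funext n
  ext f
  rw [← X.onList_ofFn, ← Y.onList_ofFn, h]

theorem Multi.onList_eq_update (X : Multi V) (a c : List V) (v : V) :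
    X.onList (a ++ v :: c) = X (a.length + (c.length + 1))
      (Function.update (fun i => (a ++ 0 :: c)[i.1]'(by simp)) ⟨a.length, by omega⟩ v) := by
  rw [X.onList_eq (n := a.length + (c.length + 1)) (by simp)]
  congr 1
  funext i
  rw [Function.update_apply]
  split_ifs with h
  · subst h
    simp
  · have h' : i.1 ≠ a.length := fun h' => h (Fin.ext h')
    rw [List.getElem_append, List.getElem_append]
    split_ifs with h1
    · rfl
    · obtain ⟨j, hj⟩ : ∃ j, i.1 - a.length = j + 1 := ⟨i.1 - a.length - 1, by omega⟩
      simp only [hj, List.getElem_cons_succ]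

theorem Multi.entryLinear (X : Multi V) : EntryLinear X.onList where
  add a c v w := by simp only [X.onList_eq_update, MultilinearMap.map_update_add]
  smul a c t v := by simp only [X.onList_eq_update, MultilinearMap.map_update_smul]

theorem ofFn_block {N i s : ℕ} (h : i + s ≤ N) (o : Fin N → V) :
    List.ofFn (block i s h o) = ((List.ofFn o).drop i).take s := by
  apply List.ext_getElem
  · simp; omega
  · intro j h1 h2
    simp [block]

theorem ofFn_insertBlock {N i s : ℕ} (h : i + s ≤ N) (ε : V → V) (o : Fin N → V) (v : V) :
    List.ofFn (insertBlock i s h (fun b => if b.1 < i then ε (o b) else o b) v) =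
      ((List.ofFn o).take i).map ε ++ v :: (List.ofFn o).drop (i + s) := by
  apply List.ext_getElem
  · simp; omega
  · intro j h1 h2
    rw [List.getElem_append]
    simp only [List.getElem_ofFn, insertBlock, List.length_map, List.length_take, List.length_ofFn]
    have hi : min i N = i := by omega
    simp only [hi]
    split_ifs with h3 h4 h5
    · simp
    · subst h4; simp
    · omega
    · obtain ⟨k, rfl⟩ : ∃ k, j = i + 1 + k := ⟨j - i - 1, by omega⟩
      have e1 : i + 1 + k - i = k + 1 := by omega
      simp only [e1, List.getElem_cons_succ, List.getElem_drop, List.getElem_ofFn]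
      congr 2
      omega

variable (gr : ℤ → Submodule ℂ V) [DirectSum.Decomposition gr]

/-- Passing to lists makes the compositions accessible to induction on `cons`, without the dependent
index types of `insertBlock`. -/
theorem onList_circ (r : ℤ) (X y : Multi V) (l : List V) :
    (circ gr r X y).onList l = insertSum (signOp gr r) y.onList X.onList l := by
  rw [Multi.onList, circ, _root_.sum_apply, insertSum,
    Finset.sum_range fun i => ∑ s ∈ Finset.range (l.length + 1 - i),
      X.onList ((l.take i).map (signOp gr r) ++ y.onList ((l.drop i).take s) :: l.drop (i + s))]
  refine Finset.sum_congr rfl fun i _ => ?_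
  rw [_root_.sum_apply, Finset.sum_range]
  refine Finset.sum_congr rfl fun s _ => ?_
  have hl : List.ofFn l.get = l := List.ofFn_get l
  have := ofFn_insertBlock (i := i.1) (s := s.1) (by omega) (signOp gr r) l.get
    (y.onList ((l.drop i.1).take s.1))
  rw [hl] at this
  rw [← this, Multi.onList_ofFn]
  have hb : y.onList ((l.drop i.1).take s.1) = y s.1 (block i.1 s.1 (by omega) l.get) := by
    rw [← Multi.onList_ofFn, ofFn_block, hl]
  rw [hb]
  rfl

theorem mem_homDeg_iff_onList {r : ℤ} {X : Multi V} : X ∈ homDeg gr r ↔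
    ∀ l : List (ℤ × V), (∀ p ∈ l, p.2 ∈ gr p.1) →
      X.onList (l.map Prod.snd) ∈ gr ((l.map Prod.fst).sum + r) := by
  constructor
  · intro h l hl
    rw [X.onList_eq (n := l.length) (by simp)]
    have := h l.length (fun i => l[i].1) (fun i => l[i].2) fun i => hl _ (List.getElem_mem _)
    have hs : (l.map Prod.fst).sum = ∑ i : Fin l.length, l[i].1 := by
      conv_lhs => rw [← List.ofFn_get l, List.map_ofFn, List.sum_ofFn]
      rfl
    rw [hs]
    simpa using this
  · intro h k d x hx
    have := h (List.ofFn fun i => (d i, x i)) (by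
      intro p hp
      obtain ⟨i, rfl⟩ := (List.mem_ofFn' _ _).mp hp
      exact hx i)
    rw [List.map_ofFn, List.map_ofFn, List.sum_ofFn] at this
    have e := X.onList_ofFn x
    rw [← e]
    exact this

theorem signOp_mem (r : ℤ) {d : ℤ} {x : V} (hx : x ∈ gr d) : signOp gr r x ∈ gr d := by
  rw [signOp_of_mem gr r hx]
  exact (gr d).smul_of_tower_mem _ hx

theorem circ_mem_homDeg {r r' : ℤ} {X y : Multi V} (hX : X ∈ homDeg gr r) (hy : y ∈ homDeg gr r')
    (e : ℤ) : circ gr e X y ∈ homDeg gr (r + r') := by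
  rw [mem_homDeg_iff_onList] at hX hy ⊢
  intro l hl
  rw [onList_circ, insertSum]
  refine Submodule.sum_mem _ fun i _ => Submodule.sum_mem _ fun s _ => ?_
  have h1 := hy ((l.drop i).take s) fun p hp => hl p (List.mem_of_mem_drop (List.mem_of_mem_take hp))
  have h2 := hX ((l.take i).map (fun p => (p.1, signOp gr e p.2)) ++
    ((((l.drop i).take s).map Prod.fst).sum + r', y.onList (((l.drop i).take s).map Prod.snd)) ::
      l.drop (i + s)) (by
    intro p hp
    rw [List.mem_append, List.mem_cons] at hp
    rcases hp with hp | rfl | hp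
    · obtain ⟨q, hq, rfl⟩ := List.mem_map.mp hp
      exact signOp_mem gr e (hl q (List.mem_of_mem_take hq))
    · exact h1
    · exact hl p (List.mem_of_mem_drop hp))
  have hs : (l.map Prod.fst).sum = ((l.take i).map Prod.fst).sum +
      ((((l.drop i).take s).map Prod.fst).sum + ((l.drop (i + s)).map Prod.fst).sum) := by
    rw [← List.sum_append, ← List.sum_append, ← List.map_append, ← List.map_append,
      ← List.drop_drop, List.take_append_drop, List.take_append_drop]
  simp only [List.map_append, List.map_cons, List.map_map, List.sum_append, List.sum_cons,
    Function.comp_def] at h2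
  rw [hs]
  simp only [← List.map_take, ← List.map_drop, List.map_map]
  convert h2 using 2
  · have : (l.take i).map (fun p => p.1) = (l.take i).map Prod.fst := rfl
    rw [this]
    ring
  · rfl

/-- Both sides are linear and agree on homogeneous vectors, where signs multiply. -/
theorem signOp_comp (r r' : ℤ) (x : V) : signOp gr r (signOp gr r' x) = signOp gr (r + r') x := by
  have : signOp gr r ∘ₗ signOp gr r' = signOp gr (r + r') := by
    rw [← sub_eq_zero]
    ext x
    induction x using DirectSum.Decomposition.inductionOn gr with
    | zero => simp
    | homogeneous x =>
      simp only [LinearMap.sub_apply, LinearMap.comp_apply, LinearMap.zero_apply]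
      rw [signOp_of_mem gr r' x.2, signOp_of_mem gr (r + r') x.2, Units.smul_def, map_zsmul,
        signOp_of_mem gr r x.2, ← Units.smul_def, smul_smul, ← Int.negOnePow_add, sub_eq_zero]
      congr 2
      ring
    | add x y hx hy => rw [map_add, hx, hy, LinearMap.zero_apply, LinearMap.zero_apply,
        LinearMap.zero_apply, add_zero]
  exact LinearMap.congr_fun this x

theorem signOp_even {r : ℤ} (hr : Even r) (x : V) : signOp gr r x = x := by
  have : signOp gr r - LinearMap.id = 0 := by
    ext x
    induction x using DirectSum.Decomposition.inductionOn gr with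
    | zero => simp
    | homogeneous x =>
      rw [LinearMap.sub_apply, signOp_of_mem gr r x.2, Int.negOnePow_even _ (hr.mul_right _),
        one_smul]
      simp
    | add x y hx hy => rw [map_add, hx, hy, LinearMap.zero_apply, LinearMap.zero_apply,
        LinearMap.zero_apply, add_zero]
  have := LinearMap.congr_fun this x
  simpa [sub_eq_zero] using this

/-- Two multilinear maps which agree on homogeneous vectors are equal. -/
theorem multilinear_ext_homogeneous {W : Type*} [AddCommGroup W] [Module ℂ W] {n : ℕ}
    {f g : MultilinearMap ℂ (fun _ : Fin n => V) W}
    (h : ∀ (d : Fin n → ℤ) (x : Fin n → V), (∀ i, x i ∈ gr (d i)) → f x = g x) : f = g := by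
  classical
  ext x
  have hx : x = fun i => ∑ d ∈ (DirectSum.decompose gr (x i)).support,
      (DirectSum.decompose gr (x i) d : V) :=
    funext fun i => (DirectSum.sum_support_decompose gr (x i)).symm
  rw [hx, f.map_sum_finset (fun i d => (DirectSum.decompose gr (x i) d : V)),
    g.map_sum_finset (fun i d => (DirectSum.decompose gr (x i) d : V))]
  exact Finset.sum_congr rfl fun r _ => h r _ fun i => SetLike.coe_mem _

/-- On homogeneous inputs the degree of the output is the sum of the input degrees plus `r'`; the
summands give the signs on the entries and `r'` gives the global sign. -/
theorem signOp_onList {r' : ℤ} {y : Multi V} (hy : y ∈ homDeg gr r') (r : ℤ) (l : List V) :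
    signOp gr r (y.onList l) =
      (((r * r').negOnePow : ℤ) : ℂ) • y.onList (l.map (signOp gr r)) := by
  have key : (signOp gr r).compMultilinearMap (y l.length) =
      (((r * r').negOnePow : ℤ) : ℂ) • (y l.length).compLinearMap fun _ => signOp gr r := by
    refine multilinear_ext_homogeneous gr fun d x hx => ?_
    have h1 := signOp_of_mem gr r (hy _ d x hx)
    have h2 : (fun i => signOp gr r (x i)) =
        fun i => (((r * d i).negOnePow : ℤ) : ℂ) • x i := by
      funext i
      rw [signOp_of_mem gr r (hx i), Units.smul_def, Int.cast_smul_eq_zsmul]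
    rw [LinearMap.compMultilinearMap_apply, h1, _root_.smul_apply,
      MultilinearMap.compLinearMap_apply, h2, MultilinearMap.map_smul_univ, smul_smul,
      Units.smul_def, ← Int.cast_smul_eq_zsmul ℂ]
    congr 1
    have h3 : ∀ (s : Finset (Fin l.length)), ∏ i ∈ s, (((r * d i).negOnePow : ℤ) : ℂ) =
        (((r * ∑ i ∈ s, d i).negOnePow : ℤ) : ℂ) := by
      intro s
      induction s using Finset.induction_on with
      | empty => simp
      | insert a s ha ih =>
        rw [Finset.prod_insert ha, Finset.sum_insert ha, mul_add, Int.negOnePow_add, ih]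
        push_cast
        ring
    rw [h3, mul_add, Int.negOnePow_add]
    push_cast
    ring
  have := congrArg (fun f => f l.get) key
  rw [_root_.smul_apply, LinearMap.compMultilinearMap_apply] at this
  rw [y.onList_eq (l := l.map (signOp gr r)) (n := l.length) (by simp)]
  simpa [Multi.onList] using this

/-- The pre-Lie identity for the composition of families of multilinear maps. -/
theorem circ_circ_sub {r r' : ℤ} (X : Multi V) {x y : Multi V} (hx : x ∈ homDeg gr r)
    (hy : y ∈ homDeg gr r') :
    circ gr r' (circ gr r X x) y - circ gr (r + r') X (circ gr r' x y) =
      (((r * r').negOnePow : ℤ) : ℂ) •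
        (circ gr r (circ gr r' X y) x - circ gr (r + r') X (circ gr r y x)) := by
  have hsub : ∀ (X Y : Multi V) (l : List V), (X - Y).onList l = X.onList l - Y.onList l :=
    fun X Y l => rfl
  have hsmul : ∀ (a : ℂ) (X : Multi V) (l : List V), (a • X).onList l = a • X.onList l :=
    fun a X l => rfl
  refine Multi.ext_onList fun l => ?_
  rw [hsmul, hsub, hsub]
  simp only [onList_circ]
  have hef : ∀ r r', (signOp gr r : V → V) ∘ (signOp gr r' : V → V) = signOp gr (r + r') :=
    fun r r' => funext (signOp_comp gr r r')
  have hc : ∀ (r : ℤ) (X x : Multi V), (circ gr r X x).onList =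
      insertSum (signOp gr r) x.onList X.onList := fun r X x => funext (onList_circ gr r X x)
  rw [hc, hc, hc, hc]
  have := X.entryLinear.insertSum_insertSum_sub (signOp gr r) (signOp gr r') x.onList y.onList
    (by rw [hef, hef, add_comm]) (((r * r').negOnePow : ℤ) : ℂ)
    (fun b => by rw [signOp_onList gr hx, mul_comm r' r]) (fun b => signOp_onList gr hy r b)
    (by rw [← Int.cast_mul, ← Units.val_mul, ← Int.negOnePow_add, Int.negOnePow_even _ ⟨_, rfl⟩]
        simp) l
  rw [hef, hef, add_comm r' r] at this
  exact this

end MultiLists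

/-! ### Right multiplication by a family of multilinear maps -/

section RightMul

variable {V : Type*} [AddCommGroup V] [Module ℂ V]
variable (gr : ℤ → Submodule ℂ V) [DirectSum.Decomposition gr]

/-- The composition of families of multilinear maps as a bilinear map. -/
def circBilin (r : ℤ) : Multi V →ₗ[ℂ] Multi V →ₗ[ℂ] Multi V :=
  LinearMap.mk₂ ℂ (circ gr r)
    (fun X X' y => Multi.ext_onList fun l => by
      change _ = (circ gr r X y).onList l + (circ gr r X' y).onList l
      rw [onList_circ, onList_circ, onList_circ, ← insertSum_add]
      rfl)
    (fun a X y => Multi.ext_onList fun l => by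
      change _ = a • (circ gr r X y).onList l
      rw [onList_circ, onList_circ, ← insertSum_smul]
      rfl)
    (fun X y y' => Multi.ext_onList fun l => by
      change _ = (circ gr r X y).onList l + (circ gr r X y').onList l
      rw [onList_circ, onList_circ, onList_circ]
      simp only [insertSum, ← Finset.sum_add_distrib]
      exact Finset.sum_congr rfl fun i _ => Finset.sum_congr rfl fun s _ =>
        X.entryLinear.add _ _ _ _)
    (fun a X y => Multi.ext_onList fun l => by
      change _ = a • (circ gr r X y).onList l
      rw [onList_circ, onList_circ]
      simp only [insertSum, Finset.smul_sum]
      exact Finset.sum_congr rfl fun i _ => Finset.sum_congr rfl fun s _ =>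
        X.entryLinear.smul _ _ _ _)

@[simp] theorem circBilin_apply (r : ℤ) (X y : Multi V) : circBilin gr r X y = circ gr r X y := rfl

/-- Right multiplication `X ↦ X ∘ x` by a family `x` of degree `r`. -/
def rmul (r : ℤ) : Multi V →ₗ[ℂ] Module.End ℂ (Multi V) := (circBilin gr r).flip

@[simp] theorem rmul_apply (r : ℤ) (x X : Multi V) : rmul gr r x X = circ gr r X x := rfl

/-- The Koszul operator depends only on the parity of its degree, so the degrees that occur can be
normalized to 0 and 1. -/
theorem circ_congr_of_even {r r' : ℤ} (h : Even (r' - r)) : circ gr r = circ gr r' := by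
  have : signOp gr r = signOp gr r' := by
    ext x
    rw [← signOp_even gr h (signOp gr r x), signOp_comp, sub_add_cancel]
  funext X y
  exact Multi.ext_onList fun l => by rw [onList_circ, onList_circ, this]

theorem rmul_congr_of_even {r r' : ℤ} (h : Even (r' - r)) : rmul gr r = rmul gr r' := by
  ext1 x
  ext1 X
  rw [rmul_apply, rmul_apply, circ_congr_of_even gr h]

variable (V) in
/-- The identity, as a family of multilinear maps concentrated in arity one. -/
def idMulti : Multi V
  | 1 => MultilinearMap.ofSubsingleton ℂ V V 0 LinearMap.id
  | _ => 0

theorem idMulti_onList_singleton (v : V) : (idMulti V).onList [v] = v := rfl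

theorem idMulti_onList_of_ne {l : List V} (h : l.length ≠ 1) : (idMulti V).onList l = 0 := by
  match l, h with
  | [], _ => rfl
  | _ :: _ :: _, _ => rfl

/-- The identity family is nonzero only in arity one, so only the insertion consuming the whole list
survives. This makes right multiplication faithful. -/
theorem circ_idMulti (r : ℤ) (x : Multi V) : circ gr r (idMulti V) x = x := by
  refine Multi.ext_onList fun l => ?_
  rw [onList_circ, insertSum, Finset.sum_eq_single 0]
  · rw [Finset.sum_eq_single l.length]
    · simp [idMulti_onList_singleton]
    · intro s hs hs'
      apply idMulti_onList_of_ne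
      have := Finset.mem_range.mp hs
      simp only [List.length_append, List.length_cons, List.length_drop, List.length_map,
        List.length_take]
      omega
    · intro h; exact absurd (Finset.mem_range.mpr (by omega)) h
  · intro i hi hi'
    refine Finset.sum_eq_zero fun s hs => idMulti_onList_of_ne ?_
    have := Finset.mem_range.mp hi
    simp only [List.length_append, List.length_cons, List.length_drop, List.length_map,
      List.length_take]
    omega
  · intro h; exact absurd (Finset.mem_range.mpr (by omega)) h

theorem rmul_idMulti (r : ℤ) (x : Multi V) : rmul gr r x (idMulti V) = x := circ_idMulti gr r x

theorem rmul_mul_sub {r r' : ℤ} {x y : Multi V} (hx : x ∈ homDeg gr r) (hy : y ∈ homDeg gr r') :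
    rmul gr r' y * rmul gr r x - rmul gr (r + r') (circ gr r' x y) =
      (((r * r').negOnePow : ℤ) : ℂ) •
        (rmul gr r x * rmul gr r' y - rmul gr (r + r') (circ gr r y x)) :=
  LinearMap.ext fun X => circ_circ_sub gr X hx hy

/-- Right multiplication turns the bracket of two even families into the opposite commutator. -/
theorem rmul_circ_sub_even {x y : Multi V} (hx : x ∈ homDeg gr 0) (hy : y ∈ homDeg gr 0) :
    rmul gr 0 x * rmul gr 0 y - rmul gr 0 y * rmul gr 0 x =
      rmul gr 0 (circ gr 0 y x - circ gr 0 x y) := by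
  have := rmul_mul_sub gr hx hy
  simp only [mul_zero, Int.negOnePow_zero, Units.val_one, Int.cast_one, one_smul, add_zero] at this
  rw [map_sub, sub_eq_sub_iff_add_eq_add]
  rw [sub_eq_sub_iff_add_eq_add] at this
  rw [← this, add_comm]

theorem rmul_circ_sub_odd {x y : Multi V} (hx : x ∈ homDeg gr 1) (hy : y ∈ homDeg gr 0) :
    rmul gr 1 x * rmul gr 0 y - rmul gr 0 y * rmul gr 1 x =
      rmul gr 1 (circ gr 1 y x - circ gr 0 x y) := by
  have := rmul_mul_sub gr hx hy
  simp only [mul_zero, Int.negOnePow_zero, Units.val_one, Int.cast_one, one_smul, add_zero] at this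
  rw [map_sub, sub_eq_sub_iff_add_eq_add]
  rw [sub_eq_sub_iff_add_eq_add] at this
  rw [← this, add_comm]

/-- For two odd families the sign in the pre-Lie identity is -1, so the anticommutator is the right
multiplication by the symmetrized composition. -/
theorem rmul_circ_add {x y : Multi V} {r r' : ℤ} (hx : x ∈ homDeg gr r) (hy : y ∈ homDeg gr r')
    (hr : Odd r) (hr' : Odd r') :
    rmul gr 1 y * rmul gr 1 x + rmul gr 1 x * rmul gr 1 y =
      rmul gr 0 (circ gr 1 x y + circ gr 1 y x) := by
  have := rmul_mul_sub gr hx hy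
  rw [Int.negOnePow_odd _ (hr.mul hr'), rmul_congr_of_even gr (r := r) (r' := 1)
    (odd_one.sub_odd hr), rmul_congr_of_even gr (r := r') (r' := 1) (odd_one.sub_odd hr'),
    rmul_congr_of_even gr (r := r + r') (r' := 0)
    (by rw [zero_sub, even_neg]; exact hr.add_odd hr'),
    circ_congr_of_even gr (r := r) (r' := 1)
    (odd_one.sub_odd hr), circ_congr_of_even gr (r := r') (r' := 1) (odd_one.sub_odd hr')] at this
  simp only [Units.val_neg, Units.val_one, Int.cast_neg, Int.cast_one] at this
  replace this := this.trans (LinearMap.ext fun X => neg_one_smul ℂ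
    ((rmul gr 1 x * rmul gr 1 y - rmul gr 0 (circ gr 1 y x)) X) :
      _ = -(rmul gr 1 x * rmul gr 1 y - rmul gr 0 (circ gr 1 y x)))
  rw [sub_eq_iff_eq_add] at this
  rw [map_add, this]
  abel

end RightMul

/-! ### Recursive construction of sequences and polynomial flows -/

/-- Dependent choice for conditions `P N` that involve only the terms up to index `N`: previously
settled conditions survive later choices. -/
theorem exists_seq {X : Type*} [Nonempty X] (P : ℕ → (ℕ → X) → Prop)
    (hcongr : ∀ N s s', (∀ k ≤ N, s k = s' k) → P N s → P N s')
    (hstep : ∀ N s, (∀ k < N, P k s) → ∃ x, P N (Function.update s N x)) :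
    ∃ s, ∀ N, P N s := by
  classical
  have hext : ∀ N s x, (∀ k < N, P k s) → P N (Function.update s N x) →
      ∀ k < N + 1, P k (Function.update s N x) := by
    intro N s x h h' k hk
    rcases Nat.lt_succ_iff_lt_or_eq.mp hk with hk | rfl
    · refine hcongr k s _ (fun j hj => ?_) (h k hk)
      rw [Function.update_of_ne (by omega)]
    · exact h'
  let T : ∀ n : ℕ, {s : ℕ → X // ∀ k < n, P k s} := fun n => Nat.rec
    ⟨fun _ => Classical.arbitrary X, fun k hk => absurd hk (Nat.not_lt_zero k)⟩
    (fun n s => ⟨Function.update s.1 n (hstep n s.1 s.2).choose,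
      hext n s.1 _ s.2 (hstep n s.1 s.2).choose_spec⟩) n
  have hT : ∀ n, (T (n + 1)).1 = Function.update (T n).1 n (hstep n (T n).1 (T n).2).choose :=
    fun n => rfl
  -- The partial sequences stabilize, so the diagonal is their common limit.
  have hT' : ∀ k n m, k < n → (T (n + m)).1 k = (T n).1 k := by
    intro k n m hk
    induction m with
    | zero => rfl
    | succ m ih => rw [← add_assoc, hT, Function.update_of_ne (by omega), ih]
  refine ⟨fun k => (T (k + 1)).1 k, fun N => hcongr N (T (N + 1)).1 _ (fun k hk => ?_)
    ((T (N + 1)).2 N (Nat.lt_succ_self N))⟩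
  have := hT' k (k + 1) (N - k) (Nat.lt_succ_self k)
  have e : k + 1 + (N - k) = N + 1 := by omega
  rw [← this, e]

/-- The equation is triangular: the right side at order `N` involves only lower orders, so it is
solved by successive polynomial antiderivatives, with no convergence question. -/
theorem exists_flow {V : Type*} [AddCommGroup V] [Module ℂ V] (F : (ℂ → ℕ → V) → ℂ → ℕ → V)
    (hF : ∀ N c c', (∀ t, ∀ k < N, c t k = c' t k) → ∀ t, F c t N = F c' t N)
    (hpoly : ∀ c : ℂ → ℕ → V, (∀ N, IsPolyFun fun t => c t N) → ∀ N, IsPolyFun fun t => F c t N)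
    (c₀ : ℕ → V) :
    ∃ c : ℂ → ℕ → V, (∀ N, PolyDeriv (fun t => c t N) fun t => F c t N) ∧ ∀ N, c 0 N = c₀ N := by
  obtain ⟨s, hs⟩ := exists_seq (X := ℂ → V)
    (fun N s => PolyDeriv (s N) (fun t => F (fun t k => s k t) t N) ∧ s N 0 = c₀ N)
    (fun N s s' h h' => ⟨h'.1.congr (fun t => by rw [h N le_rfl])
      (fun t => (hF N _ _ (fun t k hk => by rw [h k hk.le]) t).symm), by rw [← h N le_rfl, h'.2]⟩)
    (fun N s h => by
      set c : ℂ → ℕ → V := fun t k => if k < N then s k t else 0 with hc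
      have hc' : ∀ N, IsPolyFun fun t => c t N := fun k => by
        simp only [hc]
        split_ifs with hk
        · exact (h k hk).1.isPolyFun
        · exact IsPolyFun.const 0
      obtain ⟨f, hf, hf0⟩ := (hpoly c hc' N).exists_antideriv (c₀ N)
      refine ⟨f, hf.congr (fun t => by rw [Function.update_self]) (fun t => ?_), ?_⟩
      · refine hF N _ _ (fun t k hk => ?_) t
        simp only [hc, if_pos hk, Function.update_of_ne hk.ne]
      · rw [Function.update_self, hf0])
  exact ⟨fun t k => s k t, fun N => (hs N).1, fun N => (hs N).2⟩

/-! ### Group-like power series over an associative algebra -/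

set_option linter.unusedSectionVars false

section GroupLike

open PowerSeries

variable {A : Type*} [Ring A] [Algebra ℂ A]

/-- The Euler operator `ν d/dν`. -/
def euler (f : A⟦X⟧) : A⟦X⟧ := mk fun n => (n : ℂ) • coeff n f

@[simp] theorem coeff_euler (n : ℕ) (f : A⟦X⟧) : coeff n (euler f) = (n : ℂ) • coeff n f := by
  rw [euler, coeff_mk]

theorem euler_mul (f g : A⟦X⟧) : euler (f * g) = euler f * g + f * euler g := by
  ext n
  rw [map_add, coeff_euler, coeff_mul, coeff_mul, coeff_mul, ← Finset.sum_add_distrib,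
    Finset.smul_sum]
  refine Finset.sum_congr rfl fun p hp => ?_
  rw [coeff_euler, coeff_euler, smul_mul_assoc, mul_smul_comm, ← add_smul, ← Nat.cast_add,
    Finset.HasAntidiagonal.mem_antidiagonal.mp hp]

theorem euler_one : euler (1 : A⟦X⟧) = 0 := by
  ext n
  rw [coeff_euler, coeff_one]
  split_ifs with h
  · simp [h]
  · simp

theorem euler_C (a : A) : euler (C a) = 0 := by
  ext n
  rw [coeff_euler, coeff_C]
  split_ifs with h
  · simp [h]
  · simp

/-- All coefficients of `f` lie in `S`. -/
def CoeffsIn (S : Submodule ℂ A) (f : A⟦X⟧) : Prop := ∀ n, coeff n f ∈ S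

variable (g : Submodule ℂ A)

/-- A power series `φ` with constant coefficient `1` whose logarithmic derivative
`φ⁻¹ (ν dφ/dν)` has coefficients in the Lie subalgebra `g`. -/
structure IsGroupLike (φ : A⟦X⟧) : Prop where
  constCoeff : coeff 0 φ = 1
  exists_logDeriv : ∃ ξ, CoeffsIn g ξ ∧ euler φ = φ * ξ

/-- The inverse of a power series with constant coefficient `1`. -/
def seriesInv (φ : A⟦X⟧) : A⟦X⟧ := invOfUnit φ 1

variable {g} {φ ψ : A⟦X⟧}

theorem mul_seriesInv (h : coeff 0 φ = 1) : φ * seriesInv φ = 1 :=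
  mul_invOfUnit φ 1 (by simpa using h)

theorem seriesInv_mul (h : coeff 0 φ = 1) : seriesInv φ * φ = 1 :=
  invOfUnit_mul φ 1 (by simpa using h)

theorem coeff_zero_seriesInv (φ : A⟦X⟧) : coeff 0 (seriesInv φ) = 1 := by
  simp [seriesInv]

theorem coeff_zero_mul' (φ ψ : A⟦X⟧) : coeff 0 (φ * ψ) = coeff 0 φ * coeff 0 ψ := by
  simp [coeff_mul]

theorem logDeriv_coeff_zero {ξ : A⟦X⟧} (h : coeff 0 φ = 1) (hξ : euler φ = φ * ξ) :
    coeff 0 ξ = 0 := by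
  have := congrArg (coeff 0) hξ
  rw [coeff_euler, coeff_zero_mul', h, one_mul] at this
  simpa using this.symm

theorem CoeffsIn.add {S : Submodule ℂ A} {f f' : A⟦X⟧} (h : CoeffsIn S f) (h' : CoeffsIn S f') :
    CoeffsIn S (f + f') := fun n => by rw [map_add]; exact S.add_mem (h n) (h' n)

theorem CoeffsIn.neg {S : Submodule ℂ A} {f : A⟦X⟧} (h : CoeffsIn S f) : CoeffsIn S (-f) :=
  fun n => by rw [map_neg]; exact S.neg_mem (h n)

theorem CoeffsIn.commutator {S : Submodule ℂ A} (hS : ∀ s ∈ S, ∀ a ∈ g, s * a - a * s ∈ S)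
    {f ξ : A⟦X⟧} (h : CoeffsIn S f) (hξ : CoeffsIn g ξ) : CoeffsIn S (f * ξ - ξ * f) := by
  intro n
  rw [map_sub, coeff_mul, coeff_mul, ← Finset.Nat.sum_antidiagonal_swap (f := fun p =>
    coeff p.1 ξ * coeff p.2 f), ← Finset.sum_sub_distrib]
  exact S.sum_mem fun p _ => hS _ (h _) _ (hξ _)

theorem eq_C_add_X_mul (f : A⟦X⟧) :
    f = C (coeff 0 f) + X * mk fun n => coeff (n + 1) f := by
  ext n
  rcases n with _ | n
  · simp
  · rw [map_add, coeff_succ_X_mul, coeff_mk, coeff_C, if_neg (Nat.succ_ne_zero n), zero_add]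

theorem mul_X_mul_mul (a f b : A⟦X⟧) : a * (X * f) * b = X * (a * f * b) := by
  rw [← mul_assoc a X f, ← (PowerSeries.commute_X a).symm.eq, mul_assoc, mul_assoc, mul_assoc]

/-- Splitting `f` into its constant term and `X` times a series lowers the order of the second part
by one, which reduces conjugation statements to constant `f`. -/
theorem coeff_mul_mul_mem_of_C {S : Submodule ℂ A} {a b : A⟦X⟧} (n : ℕ)
    (hC : ∀ s ∈ S, coeff n (a * C s * b) ∈ S)
    (ih : ∀ m < n, ∀ f, CoeffsIn S f → coeff m (a * f * b) ∈ S) {f : A⟦X⟧} (hf : CoeffsIn S f) :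
    coeff n (a * f * b) ∈ S := by
  rw [eq_C_add_X_mul f, mul_add, add_mul, map_add, mul_X_mul_mul]
  refine S.add_mem (hC _ (hf 0)) ?_
  rcases n with _ | n
  · simp
  · rw [coeff_succ_X_mul]
    exact ih n n.lt_succ_self _ fun m => by rw [coeff_mk]; exact hf _

theorem euler_seriesInv {ξ : A⟦X⟧} (h : coeff 0 φ = 1) (hξ : euler φ = φ * ξ) :
    euler (seriesInv φ) = -(ξ * seriesInv φ) := by
  have h1 : euler (seriesInv φ * φ) = 0 := by rw [seriesInv_mul h, euler_one]
  rw [euler_mul, hξ, ← mul_assoc, seriesInv_mul h, one_mul] at h1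
  have h2 := congrArg (· * seriesInv φ) h1
  simp only [add_mul, zero_mul, mul_assoc, mul_seriesInv h, mul_one] at h2
  rw [eq_neg_iff_add_eq_zero, h2]

theorem smul_mem_of_natCast_smul_mem {S : Submodule ℂ A} {n : ℕ} (hn : n ≠ 0) {a : A}
    (h : (n : ℂ) • a ∈ S) : a ∈ S := by
  have hn' : (n : ℂ) ≠ 0 := Nat.cast_ne_zero.mpr hn
  have := S.smul_mem (n : ℂ)⁻¹ h
  rwa [smul_smul, inv_mul_cancel₀ hn', one_smul] at this

/-- For constant `s`, the Euler operator sends `Y = φ⁻¹ s φ` to `Y ξ - ξ Y`. As `ξ` has no constant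
term, `n` times the coefficient of `Y` at order `n` is a sum of commutators of lower coefficients of
`Y` with elements of `g`. -/
theorem IsGroupLike.inv_mul_mul_mem (hφ : IsGroupLike g φ) {S : Submodule ℂ A}
    (hS : ∀ s ∈ S, ∀ a ∈ g, s * a - a * s ∈ S) {f : A⟦X⟧} (hf : CoeffsIn S f) :
    CoeffsIn S (seriesInv φ * f * φ) := by
  obtain ⟨ξ, hξg, hξ⟩ := hφ.exists_logDeriv
  intro n
  induction n using Nat.strong_induction_on generalizing f with
  | h n ih =>
    refine coeff_mul_mul_mem_of_C n (fun s hs => ?_) (fun m hm f hf => ih m hm hf) hf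
    rcases Nat.eq_zero_or_pos n with rfl | hn
    · rwa [coeff_zero_mul', coeff_zero_mul', coeff_zero_seriesInv, hφ.constCoeff, one_mul, mul_one,
        coeff_zero_C]
    · have hCs : CoeffsIn S (C s) := fun m => by
        rw [coeff_C]; split_ifs
        · exact hs
        · exact S.zero_mem
      refine smul_mem_of_natCast_smul_mem hn.ne' ?_
      have e : euler (seriesInv φ * C s * φ) =
          (seriesInv φ * C s * φ) * ξ - ξ * (seriesInv φ * C s * φ) := by
        rw [euler_mul, euler_mul, euler_C, mul_zero, add_zero, hξ, euler_seriesInv hφ.constCoeff hξ]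
        noncomm_ring
      rw [← coeff_euler, e, map_sub, coeff_mul, coeff_mul,
        ← Finset.Nat.sum_antidiagonal_swap (f := fun p =>
          coeff p.1 ξ * coeff p.2 (seriesInv φ * C s * φ)), ← Finset.sum_sub_distrib]
      refine S.sum_mem fun p hp => ?_
      have hp' := Finset.HasAntidiagonal.mem_antidiagonal.mp hp
      rcases Nat.lt_or_ge p.1 n with h1 | h1
      · exact hS _ (ih p.1 h1 hCs) _ (hξg _)
      · have h2 : p.2 = 0 := by omega
        simp only [Prod.fst_swap, Prod.snd_swap, h2, logDeriv_coeff_zero hφ.constCoeff hξ, mul_zero,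
          zero_mul, sub_zero]
        exact S.zero_mem

/-- Here the Euler operator sends `φ s φ⁻¹` to `-φ [s, ξ] φ⁻¹`. The commutator starts in order one,
so a factor `X` splits off and the induction hypothesis applies one order lower. -/
theorem IsGroupLike.mul_mul_inv_mem (hφ : IsGroupLike g φ) {S : Submodule ℂ A}
    (hS : ∀ s ∈ S, ∀ a ∈ g, s * a - a * s ∈ S) {f : A⟦X⟧} (hf : CoeffsIn S f) :
    CoeffsIn S (φ * f * seriesInv φ) := by
  obtain ⟨ξ, hξg, hξ⟩ := hφ.exists_logDeriv
  intro n
  induction n using Nat.strong_induction_on generalizing f with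
  | h n ih =>
    refine coeff_mul_mul_mem_of_C n (fun s hs => ?_) (fun m hm f hf => ih m hm hf) hf
    rcases n with _ | n
    · rwa [coeff_zero_mul', coeff_zero_mul', coeff_zero_seriesInv, hφ.constCoeff, one_mul, mul_one,
        coeff_zero_C]
    · have hCs : CoeffsIn S (C s) := fun m => by
        rw [coeff_C]; split_ifs
        · exact hs
        · exact S.zero_mem
      refine smul_mem_of_natCast_smul_mem n.succ_ne_zero ?_
      set z := C s * ξ - ξ * C s with hz
      have hzS : CoeffsIn S z := hCs.commutator hS hξg
      have hz0 : coeff 0 z = 0 := by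
        rw [hz, map_sub, coeff_zero_mul', coeff_zero_mul', logDeriv_coeff_zero hφ.constCoeff hξ]
        simp
      have e : euler (φ * C s * seriesInv φ) = -(φ * z * seriesInv φ) := by
        rw [euler_mul, euler_mul, euler_C, mul_zero, add_zero, hξ, euler_seriesInv hφ.constCoeff hξ,
          hz]
        noncomm_ring
      rw [← coeff_euler, e, map_neg, eq_C_add_X_mul z, hz0, map_zero, zero_add, mul_X_mul_mul,
        coeff_succ_X_mul]
      exact S.neg_mem (ih n n.lt_succ_self fun m => by rw [coeff_mk]; exact hzS _)

variable (hg : ∀ s ∈ g, ∀ a ∈ g, s * a - a * s ∈ g)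
include hg

/-- The logarithmic derivative of `φ ψ` is `ψ⁻¹ ξ ψ + η`, and conjugation by `ψ` preserves `g`. -/
theorem IsGroupLike.mul (hφ : IsGroupLike g φ) (hψ : IsGroupLike g ψ) : IsGroupLike g (φ * ψ) := by
  obtain ⟨ξ, hξg, hξ⟩ := hφ.exists_logDeriv
  obtain ⟨η, hηg, hη⟩ := hψ.exists_logDeriv
  refine ⟨by rw [coeff_zero_mul', hφ.constCoeff, hψ.constCoeff, one_mul],
    seriesInv ψ * ξ * ψ + η, (hψ.inv_mul_mul_mem hg hξg).add hηg, ?_⟩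
  rw [euler_mul, hξ, hη, mul_add, mul_assoc φ ψ, mul_assoc φ ψ, ← mul_assoc ψ _ ψ,
    ← mul_assoc ψ _ ξ, mul_seriesInv hψ.constCoeff, one_mul, mul_assoc]

theorem IsGroupLike.inv (hφ : IsGroupLike g φ) : IsGroupLike g (seriesInv φ) := by
  obtain ⟨ξ, hξg, hξ⟩ := hφ.exists_logDeriv
  refine ⟨coeff_zero_seriesInv φ, -(φ * ξ * seriesInv φ), (hφ.mul_mul_inv_mem hg hξg).neg, ?_⟩
  rw [euler_seriesInv hφ.constCoeff hξ, mul_neg, ← mul_assoc, ← mul_assoc,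
    seriesInv_mul hφ.constCoeff, one_mul]

omit hg

theorem IsGroupLike.one : IsGroupLike g (1 : A⟦X⟧) :=
  ⟨by simp, 0, fun n => by simp, by rw [euler_one, mul_zero]⟩

/-- The leading coefficient of a group-like power series lies in the Lie algebra. -/
theorem IsGroupLike.coeff_mem (hφ : IsGroupLike g φ) {N : ℕ} (hN : N ≠ 0)
    (h : ∀ k < N, k ≠ 0 → coeff k φ = 0) : coeff N φ ∈ g := by
  obtain ⟨ξ, hξg, hξ⟩ := hφ.exists_logDeriv
  refine smul_mem_of_natCast_smul_mem hN ?_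
  rw [← coeff_euler, hξ, coeff_mul, Finset.sum_eq_single (0, N)]
  · rw [hφ.constCoeff, one_mul]
    exact hξg N
  · rintro ⟨i, j⟩ hij hne
    have := Finset.HasAntidiagonal.mem_antidiagonal.mp hij
    simp only at this ⊢
    have hi0 : i ≠ 0 := by
      rintro rfl
      exact hne (by simp only [zero_add] at this; rw [this])
    rcases Nat.lt_or_ge i N with hi | hi
    · rw [h i hi hi0, zero_mul]
    · obtain rfl : j = 0 := by omega
      rw [logDeriv_coeff_zero hφ.constCoeff hξ, mul_zero]
  · intro h'
    exact absurd (Finset.HasAntidiagonal.mem_antidiagonal.mpr (zero_add N)) h'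

/-! ### Polynomial paths of power series -/

/-- Coefficientwise polynomial derivative of a path of power series. -/
def SeriesDeriv (f f' : ℂ → A⟦X⟧) : Prop :=
  ∀ n, PolyDeriv (fun t => coeff n (f t)) fun t => coeff n (f' t)

/-- A path of power series with polynomial coefficients. -/
def IsPolySeries (f : ℂ → A⟦X⟧) : Prop := ∀ n, IsPolyFun fun t => coeff n (f t)

theorem PolyDeriv.mul {f f' h h' : ℂ → A} (hf : PolyDeriv f f') (hh : PolyDeriv h h') :
    PolyDeriv (fun t => f t * h t) fun t => f' t * h t + f t * h' t := by
  have := PolyDeriv.multilinear (MultilinearMap.mkPiAlgebraFin ℂ 2 A) (f := ![f, h])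
    (f' := ![f', h']) (fun a => by fin_cases a <;> assumption)
  refine this.congr (fun t => ?_) fun t => ?_
  · simp [MultilinearMap.mkPiAlgebraFin_apply]
  · simp [MultilinearMap.mkPiAlgebraFin_apply, Function.update]

theorem IsPolyFun.mul {f h : ℂ → A} (hf : IsPolyFun f) (hh : IsPolyFun h) :
    IsPolyFun fun t => f t * h t := by
  obtain ⟨_, hf⟩ := hf.exists_polyDeriv
  obtain ⟨_, hh⟩ := hh.exists_polyDeriv
  exact (hf.mul hh).isPolyFun

theorem SeriesDeriv.mul {f f' h h' : ℂ → A⟦X⟧} (hf : SeriesDeriv f f') (hh : SeriesDeriv h h') :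
    SeriesDeriv (fun t => f t * h t) fun t => f' t * h t + f t * h' t := fun n =>
  (PolyDeriv.sum _ fun p _ => (hf p.1).mul (hh p.2)).congr (fun t => coeff_mul _ _ _)
    fun t => by rw [map_add, coeff_mul, coeff_mul, ← Finset.sum_add_distrib]

theorem SeriesDeriv.sub {f f' h h' : ℂ → A⟦X⟧} (hf : SeriesDeriv f f') (hh : SeriesDeriv h h') :
    SeriesDeriv (fun t => f t - h t) fun t => f' t - h' t := fun n =>
  ((hf n).sub (hh n)).congr (fun _ => map_sub _ _ _) fun _ => map_sub _ _ _

theorem SeriesDeriv.const (f : A⟦X⟧) : SeriesDeriv (fun _ => f) fun _ => 0 := fun n =>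
  (PolyDeriv.const (coeff n f)).congr (fun _ => rfl) fun _ => map_zero _

theorem SeriesDeriv.isPolySeries {f f' : ℂ → A⟦X⟧} (hf : SeriesDeriv f f') : IsPolySeries f :=
  fun n => (hf n).isPolyFun

theorem IsPolySeries.mul {f h : ℂ → A⟦X⟧} (hf : IsPolySeries f) (hh : IsPolySeries h) :
    IsPolySeries fun t => f t * h t := fun n => by
  simp only [coeff_mul]
  exact IsPolyFun.sum _ fun p _ => (hf p.1).mul (hh p.2)

theorem IsPolyFun.add {V : Type*} [AddCommGroup V] [Module ℂ V] {f h : ℂ → V} (hf : IsPolyFun f)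
    (hh : IsPolyFun h) : IsPolyFun fun t => f t + h t := by
  obtain ⟨_, hf⟩ := hf.exists_polyDeriv
  obtain ⟨_, hh⟩ := hh.exists_polyDeriv
  exact (hf.add hh).isPolyFun

theorem SeriesDeriv.euler {f f' : ℂ → A⟦X⟧} (hf : SeriesDeriv f f') :
    SeriesDeriv (fun t => euler (f t)) fun t => OpenClosed.euler (f' t) := fun n =>
  ((hf n).const_smul (n : ℂ)).congr (fun _ => coeff_euler _ _) fun _ => coeff_euler _ _

/-- A path satisfying `U' = U α`, where `α` has no constant coefficient, and `U (0) = 0`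
vanishes. -/
theorem SeriesDeriv.eq_zero {U α : ℂ → A⟦X⟧} (hU : SeriesDeriv U fun t => U t * α t)
    (hα : ∀ t, coeff 0 (α t) = 0) (h0 : U 0 = 0) (t : ℂ) : U t = 0 := by
  have key : ∀ n t, coeff n (U t) = 0 := by
    intro n
    induction n using Nat.strong_induction_on with
    | h n ih =>
      intro t
      have : PolyDeriv (fun t => coeff n (U t)) fun _ => 0 := (hU n).congr (fun _ => rfl) fun t => by
        rw [coeff_mul, Finset.sum_eq_zero]
        intro p hp
        have hp' := Finset.HasAntidiagonal.mem_antidiagonal.mp hp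
        rcases Nat.lt_or_ge p.1 n with h | h
        · rw [ih _ h, zero_mul]
        · have : p.2 = 0 := by omega
          rw [this, hα, mul_zero]
      rw [this.eq_of_zero t, h0, map_zero]
  ext n
  rw [key, map_zero]

theorem sum_antidiagonal_congr_of_right_zero {a a' b : ℕ → A} {N : ℕ} (hb : b 0 = 0)
    (h : ∀ k < N, a k = a' k) : ∑ p ∈ Finset.HasAntidiagonal.antidiagonal N, a p.1 * b p.2 =
      ∑ p ∈ Finset.HasAntidiagonal.antidiagonal N, a' p.1 * b p.2 := by
  refine Finset.sum_congr rfl fun p hp => ?_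
  have hp' := Finset.HasAntidiagonal.mem_antidiagonal.mp hp
  rcases Nat.lt_or_ge p.1 N with h' | h'
  · rw [h _ h']
  · have : p.2 = 0 := by omega
    rw [this, hb, mul_zero, mul_zero]

theorem sum_antidiagonal_congr_of_left_zero {a a' b : ℕ → A} {N : ℕ} (hb : b 0 = 0)
    (h : ∀ k < N, a k = a' k) : ∑ p ∈ Finset.HasAntidiagonal.antidiagonal N, b p.1 * a p.2 =
      ∑ p ∈ Finset.HasAntidiagonal.antidiagonal N, b p.1 * a' p.2 := by
  refine Finset.sum_congr rfl fun p hp => ?_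
  have hp' := Finset.HasAntidiagonal.mem_antidiagonal.mp hp
  rcases Nat.lt_or_ge p.2 N with h' | h'
  · rw [h _ h']
  · have : p.1 = 0 := by omega
    rw [this, hb, zero_mul, zero_mul]

/-- The holonomy of a polynomial path in the Lie algebra is group-like. -/
theorem exists_holonomy (hg : ∀ s ∈ g, ∀ a ∈ g, s * a - a * s ∈ g) {α : ℂ → A⟦X⟧}
    (hα : IsPolySeries α) (hα0 : ∀ t, coeff 0 (α t) = 0) (hαg : ∀ t, CoeffsIn g (α t)) :
    ∃ φ : ℂ → A⟦X⟧, SeriesDeriv φ (fun t => φ t * α t) ∧ φ 0 = 1 ∧ ∀ t, IsGroupLike g (φ t) := by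
  obtain ⟨c, hc, hc0⟩ := exists_flow (V := A) (fun c t n => coeff n (mk (c t) * α t))
    (fun N c c' h t => by
      simp only [coeff_mul, coeff_mk]
      exact sum_antidiagonal_congr_of_right_zero (b := fun n => coeff n (α t)) (hα0 t) (h t))
    (fun c hc => IsPolySeries.mul (f := fun t => mk (c t)) (fun n => by simpa using hc n) hα)
    (fun n => coeff n (1 : A⟦X⟧))
  set φ : ℂ → A⟦X⟧ := fun t => mk (c t) with hφ
  have hφ' : SeriesDeriv φ fun t => φ t * α t := fun n =>
    (hc n).congr (fun t => by rw [hφ, coeff_mk]) fun _ => rfl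
  have hφ0 : φ 0 = 1 := by ext n; rw [hφ, coeff_mk, hc0]
  -- The candidate logarithmic derivative solves the zero-curvature equation `ξ' = ξ α - α ξ + ν
  -- dα/dν` with `ξ(0) = 0`. It stays in `g` because the right side does, by induction on the order.
  obtain ⟨b, hb, hb0⟩ := exists_flow (V := A)
    (fun b t n => coeff n (mk (b t) * α t) - coeff n (α t * mk (b t)) + (n : ℂ) • coeff n (α t))
    (fun N c c' h t => by
      simp only [coeff_mul, coeff_mk]
      rw [sum_antidiagonal_congr_of_right_zero (b := fun n => coeff n (α t)) (hα0 t) (h t),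
        sum_antidiagonal_congr_of_left_zero (b := fun n => coeff n (α t)) (hα0 t) (h t)])
    (fun c hc n => by
      have hc' : IsPolySeries fun t => mk (c t) := fun n => by simpa using hc n
      simp only [sub_eq_add_neg, ← neg_one_smul ℂ (coeff n (_ * mk _))]
      exact (((hc'.mul hα) n).add (((hα.mul hc') n).const_smul (-1))).add ((hα n).const_smul _))
    (fun _ => 0)
  set ξ : ℂ → A⟦X⟧ := fun t => mk (b t) with hξ
  have hξ' : SeriesDeriv ξ fun t => ξ t * α t - α t * ξ t + euler (α t) := fun n =>
    (hb n).congr (fun t => by rw [hξ, coeff_mk]) fun t => by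
      rw [map_add, map_sub, coeff_euler]
  have hξ0 : ξ 0 = 0 := by ext n; rw [hξ, coeff_mk, hb0, map_zero]
  have hξg : ∀ n t, coeff n (ξ t) ∈ g := by
    intro n
    induction n using Nat.strong_induction_on with
    | h n ih =>
      refine (hξ' n).mem (fun t => ?_) (by rw [hξ0, map_zero]; exact g.zero_mem)
      rw [map_add, map_sub, coeff_euler, coeff_mul, coeff_mul,
        ← Finset.Nat.sum_antidiagonal_swap (f := fun p => coeff p.1 (α t) * coeff p.2 (ξ t)),
        ← Finset.sum_sub_distrib]
      refine g.add_mem (g.sum_mem fun p hp => ?_) (g.smul_mem _ (hαg t n))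
      have hp' := Finset.HasAntidiagonal.mem_antidiagonal.mp hp
      rcases Nat.lt_or_ge p.1 n with h1 | h1
      · exact hg _ (ih _ h1 t) _ (hαg t _)
      · have h2 : p.2 = 0 := by omega
        simp only [Prod.fst_swap, Prod.snd_swap, h2, hα0, mul_zero, zero_mul, sub_zero]
        exact g.zero_mem
  -- `U = ν dφ/dν - φ ξ` satisfies `U' = U α` and `U(0) = 0`, so it vanishes.
  have hU := hφ'.euler.sub (hφ'.mul hξ')
  have key : ∀ t, euler (φ t) - φ t * ξ t = 0 := by
    refine SeriesDeriv.eq_zero (α := α) (fun n => (hU n).congr (fun _ => rfl) fun t => ?_) hα0 ?_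
    · refine congrArg (coeff n) ?_
      beta_reduce
      rw [euler_mul]
      noncomm_ring
    · rw [hφ0, hξ0, euler_one, mul_zero, sub_zero]
  have hφc : ∀ t, coeff 0 (φ t) = 1 := by
    intro t
    have : PolyDeriv (fun t => coeff 0 (φ t)) fun _ => 0 := (hφ' 0).congr (fun _ => rfl) fun t => by
      rw [coeff_zero_mul', hα0, mul_zero]
    rw [this.eq_of_zero t, hφ0]
    simp
  exact ⟨φ, hφ', hφ0, fun t => ⟨hφc t, ξ t, fun n => hξg n t, sub_eq_zero.mp (key t)⟩⟩

/-- Dependence of the holonomy on the path. -/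
theorem holonomy_coeff_eq {φ φ' α α' : ℂ → A⟦X⟧} (h : SeriesDeriv φ fun t => φ t * α t)
    (h' : SeriesDeriv φ' fun t => φ' t * α' t) (h0 : φ 0 = 1) (h0' : φ' 0 = 1)
    (hα0' : ∀ t, coeff 0 (α' t) = 0) {N : ℕ}
    (hα : ∀ k < N, ∀ t, coeff k (α t) = coeff k (α' t)) :
    ∀ k < N, ∀ t, coeff k (φ t) = coeff k (φ' t) := by
  intro k hk
  induction k using Nat.strong_induction_on with
  | h k ih =>
    refine (h k).eq_of_eq ((h' k).congr (fun _ => rfl) fun t => ?_) (by rw [h0, h0'])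
    rw [coeff_mul, coeff_mul]
    refine Finset.sum_congr rfl fun p hp => ?_
    have hp' := Finset.HasAntidiagonal.mem_antidiagonal.mp hp
    rw [hα p.2 (by omega)]
    rcases Nat.lt_or_ge p.1 k with h1 | h1
    · rw [ih _ h1 (by omega)]
    · have h2 : p.2 = 0 := by omega
      rw [h2, hα0', mul_zero, mul_zero]

theorem holonomy_coeff_sub {φ φ' α α' : ℂ → A⟦X⟧} (h : SeriesDeriv φ fun t => φ t * α t)
    (h' : SeriesDeriv φ' fun t => φ' t * α' t) (h0 : φ 0 = 1) (h0' : φ' 0 = 1)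
    (hα0 : ∀ t, coeff 0 (α t) = 0) (hα0' : ∀ t, coeff 0 (α' t) = 0) {N : ℕ} (hN : N ≠ 0)
    (hα : ∀ k < N, ∀ t, coeff k (α t) = coeff k (α' t)) {a : A}
    (hαN : ∀ t, coeff N (α t) - coeff N (α' t) = a) (t : ℂ) :
    coeff N (φ t) - coeff N (φ' t) = t • a := by
  have key := holonomy_coeff_eq h h' h0 h0' hα0' hα
  have hc : ∀ t, coeff 0 (φ t) = 1 := fun t => by
    have : PolyDeriv (fun t => coeff 0 (φ t)) fun _ => 0 := (h 0).congr (fun _ => rfl) fun t => by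
      rw [coeff_zero_mul', hα0, mul_zero]
    rw [this.eq_of_zero t, h0]
    simp
  refine PolyDeriv.eq_of_eq (((h N).sub (h' N)).congr (fun _ => rfl) fun t => ?_)
    (PolyDeriv.linear a) (by rw [h0, h0', sub_self, zero_smul]) t
  -- At order `N` only `φ_0 α_N` distinguishes the two equations, and `φ_0 = 1`; the difference
  -- therefore has constant derivative `a`.
  rw [coeff_mul, coeff_mul, ← Finset.sum_sub_distrib, Finset.sum_eq_single (0, N)]
  · rw [← key 0 (by omega), hc, one_mul, one_mul, hαN]
  · rintro ⟨i, j⟩ hij hne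
    have hij' := Finset.HasAntidiagonal.mem_antidiagonal.mp hij
    simp only at hij' ⊢
    have hi0 : i ≠ 0 := by
      rintro rfl
      exact hne (by simp only [zero_add] at hij'; rw [hij'])
    rcases Nat.lt_or_ge i N with hi | hi
    · rw [key i hi, hα j (by omega), sub_self]
    · obtain rfl : j = 0 := by omega
      rw [hα0, hα0', mul_zero, mul_zero, sub_self]
  · intro h'
    exact absurd (Finset.HasAntidiagonal.mem_antidiagonal.mpr (zero_add N)) h'

/-- The power series `f (t ν)`. -/
def scale (t : ℂ) (f : A⟦X⟧) : A⟦X⟧ := mk fun n => t ^ n • coeff n f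

@[simp] theorem coeff_scale (t : ℂ) (n : ℕ) (f : A⟦X⟧) : coeff n (scale t f) = t ^ n • coeff n f := by
  rw [scale, coeff_mk]

theorem scale_mul (t : ℂ) (f f' : A⟦X⟧) : scale t (f * f') = scale t f * scale t f' := by
  ext n
  rw [coeff_scale, coeff_mul, coeff_mul, Finset.smul_sum]
  refine Finset.sum_congr rfl fun p hp => ?_
  rw [coeff_scale, coeff_scale, smul_mul_smul_comm, ← pow_add,
    Finset.HasAntidiagonal.mem_antidiagonal.mp hp]

theorem scale_zero (h : coeff 0 φ = 1) : scale 0 φ = 1 := by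
  ext n
  rw [coeff_scale, coeff_one]
  split_ifs with hn
  · subst hn; simp [h]
  · rw [zero_pow hn, zero_smul]

theorem scale_one (f : A⟦X⟧) : scale 1 f = f := by ext n; simp

theorem scale_one_series (t : ℂ) : scale t (1 : A⟦X⟧) = 1 := by
  ext n
  rw [coeff_scale, coeff_one]
  split_ifs with hn
  · simp [hn]
  · simp

theorem isPolySeries_scale (f : A⟦X⟧) : IsPolySeries fun t => scale t f := fun n => by
  simp only [coeff_scale]
  exact IsPolyFun.pow_smul n _

theorem CoeffsIn.scale {S : Submodule ℂ A} {f : A⟦X⟧} (h : CoeffsIn S f) (t : ℂ) :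
    CoeffsIn S (scale t f) := fun n => by rw [coeff_scale]; exact S.smul_mem _ (h n)

theorem IsGroupLike.scale (hφ : IsGroupLike g φ) (t : ℂ) : IsGroupLike g (scale t φ) := by
  obtain ⟨ξ, hξg, hξ⟩ := hφ.exists_logDeriv
  refine ⟨by rw [coeff_scale, hφ.constCoeff, pow_zero, one_smul], OpenClosed.scale t ξ,
    hξg.scale t, ?_⟩
  rw [← scale_mul, ← hξ]
  ext n
  rw [coeff_euler, coeff_scale, coeff_scale, coeff_euler, smul_comm]

/-- A group-like power series `φ (ν)` is the end of the path `φ (t ν)`, which is the holonomy of a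
polynomial path in the Lie algebra. -/
theorem IsGroupLike.exists_path (hφ : IsGroupLike g φ) : ∃ α : ℂ → A⟦X⟧, IsPolySeries α ∧
    (∀ t, coeff 0 (α t) = 0) ∧ (∀ t, CoeffsIn g (α t)) ∧
      SeriesDeriv (fun t => OpenClosed.scale t φ) fun t => OpenClosed.scale t φ * α t := by
  obtain ⟨ξ, hξg, hξ⟩ := hφ.exists_logDeriv
  have hξ0 := logDeriv_coeff_zero hφ.constCoeff hξ
  -- The `t`-derivative of `φ(tν)` is `t⁻¹` times its Euler derivative, so `α(t) = t⁻¹ ξ(tν)`; this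
  -- is polynomial since `ξ` has no constant term. At `n = 0` the truncated exponent is harmless for
  -- the same reason.
  refine ⟨fun t => PowerSeries.mk fun n => t ^ (n - 1) • coeff n ξ, fun n => ?_, fun t => ?_, fun t n => ?_,
    fun n => ?_⟩
  · simp only [coeff_mk]
    exact IsPolyFun.pow_smul _ _
  · rw [coeff_mk, hξ0, smul_zero]
  · rw [coeff_mk]
    exact g.smul_mem _ (hξg n)
  · refine PolyDeriv.congr ⟨Finsupp.single n (coeff n φ), fun t => rfl, fun t => rfl⟩
      (fun t => by rw [coeff_scale, polyEval_single]) fun t => ?_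
    rw [polyDerivEval_single, mul_comm, ← smul_smul, ← coeff_euler, hξ, coeff_mul, coeff_mul,
      Finset.smul_sum]
    refine Finset.sum_congr rfl fun p hp => ?_
    have hp' := Finset.HasAntidiagonal.mem_antidiagonal.mp hp
    rw [coeff_scale, coeff_mk]
    rcases Nat.eq_zero_or_pos p.2 with h2 | h2
    · rw [h2, hξ0]; simp
    · rw [smul_mul_smul_comm, ← pow_add]
      congr 2
      omega

end GroupLike

theorem PolyDeriv.unique {V : Type*} [AddCommGroup V] [Module ℂ V] {f f' f'' : ℂ → V}
    (h : PolyDeriv f f') (h' : PolyDeriv f f'') (t : ℂ) : f' t = f'' t := by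
  obtain ⟨p, hp, hp'⟩ := (h.sub h').congr (g := fun _ => 0) (fun t => (sub_self _).symm)
    fun _ => rfl
  have := polyEval_injective fun t _ => (hp t).symm
  have h0 := hp' t
  rw [this] at h0
  exact sub_eq_zero.mp (h0.trans (by simp [GradedOps.polyDerivEval]))

/-! ### Conjugation along holonomies -/

section HolonomyPath

open PowerSeries

variable {A : Type*} [Ring A] [Algebra ℂ A]

theorem SeriesDeriv.unique {f f' f'' : ℂ → A⟦X⟧} (h : SeriesDeriv f f') (h' : SeriesDeriv f f'')
    (t : ℂ) : f' t = f'' t := by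
  ext n
  exact (h n).unique (h' n) t

theorem IsPolySeries.exists_seriesDeriv {f : ℂ → A⟦X⟧} (h : IsPolySeries f) :
    ∃ f', SeriesDeriv f f' := by
  choose f' hf' using fun n => (h n).exists_polyDeriv
  exact ⟨fun t => mk fun n => f' n t, fun n => (hf' n).congr (fun _ => rfl) fun t => coeff_mk _ _⟩

/-- A solution of `M' = M a - a M` is intertwined with its initial value by the holonomy of `a`. -/
theorem holonomy_intertwines {M φ a : ℂ → A⟦X⟧}
    (hM : SeriesDeriv M fun t => M t * a t - a t * M t) (hφ : SeriesDeriv φ fun t => φ t * a t)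
    (hφ0 : φ 0 = 1) (ha : ∀ t, coeff 0 (a t) = 0) (t : ℂ) : φ t * M t = M 0 * φ t := by
  have h := (hφ.mul hM).sub ((SeriesDeriv.const (M 0)).mul hφ)
  refine sub_eq_zero.mp (SeriesDeriv.eq_zero (α := a) (fun n => (h n).congr (fun _ => rfl)
    fun t => congrArg (coeff n) ?_) ha ?_ t)
  · beta_reduce
    noncomm_ring
  · rw [hφ0, one_mul, mul_one, sub_self]

theorem scale_seriesInv {φ : A⟦X⟧} (h : coeff 0 φ = 1) (t : ℂ) :
    seriesInv (scale t φ) = scale t (seriesInv φ) := by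
  have h' : coeff 0 (scale t φ) = 1 := by rw [coeff_scale, h, pow_zero, one_smul]
  rw [← mul_one (seriesInv _), ← scale_one_series t, ← mul_seriesInv h, scale_mul, ← mul_assoc,
    seriesInv_mul h', one_mul]

theorem mul_left_cancel_series {φ f f' : A⟦X⟧} (h : coeff 0 φ = 1) (e : φ * f = φ * f') :
    f = f' := by
  rw [← one_mul f, ← seriesInv_mul h, mul_assoc, e, ← mul_assoc, seriesInv_mul h, one_mul]

/-- Conjugating by the path `φ (t ν)` of a group-like power series gives a solution of
`M' = M a - a M` with `a` a path in the Lie algebra. -/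
theorem IsGroupLike.exists_conj_path {g : Submodule ℂ A} {φ : A⟦X⟧} (hφ : IsGroupLike g φ)
    {S : Submodule ℂ A} (hS : ∀ s ∈ S, ∀ a ∈ g, s * a - a * s ∈ S) {M : A⟦X⟧}
    (hM : CoeffsIn S M) : ∃ N a : ℂ → A⟦X⟧, N 0 = M ∧ φ * N 1 = M * φ ∧ IsPolySeries a ∧
      (∀ t, coeff 0 (a t) = 0) ∧ (∀ t, CoeffsIn g (a t)) ∧ (∀ t, CoeffsIn S (N t)) ∧
      (∀ t, coeff 0 (N t) = coeff 0 M) ∧ SeriesDeriv N fun t => N t * a t - a t * N t := by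
  obtain ⟨a, ha, ha0, hag, hd⟩ := hφ.exists_path
  have hc : ∀ t, coeff 0 (OpenClosed.scale t φ) = 1 := fun t => (hφ.scale t).constCoeff
  have hpoly : IsPolySeries fun t =>
      seriesInv (OpenClosed.scale t φ) * M * OpenClosed.scale t φ := by
    simp only [scale_seriesInv hφ.constCoeff]
    exact ((isPolySeries_scale _).mul (SeriesDeriv.const M).isPolySeries).mul
      (isPolySeries_scale φ)
  obtain ⟨N', hN'⟩ := hpoly.exists_seriesDeriv
  have hconj : ∀ t, OpenClosed.scale t φ *
      (seriesInv (OpenClosed.scale t φ) * M * OpenClosed.scale t φ) = M * OpenClosed.scale t φ :=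
    fun t => by rw [← mul_assoc, ← mul_assoc, mul_seriesInv (hc t), one_mul]
  refine ⟨fun t => seriesInv (OpenClosed.scale t φ) * M * OpenClosed.scale t φ, a, ?_, ?_, ha, ha0,
    hag, fun t => (hφ.scale t).inv_mul_mul_mem hS hM, fun t => ?_, fun n => (hN' n).congr
    (fun _ => rfl) fun t => congrArg (coeff n) ?_⟩
  · beta_reduce
    rw [scale_seriesInv hφ.constCoeff, scale_zero hφ.constCoeff, scale_zero (coeff_zero_seriesInv φ),
      one_mul, mul_one]
  · have := hconj 1
    beta_reduce
    rwa [scale_one] at this ⊢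
  · rw [coeff_zero_mul', coeff_zero_mul', hc, coeff_zero_seriesInv, one_mul, mul_one]
  · have h1 := SeriesDeriv.unique (hd.mul hN') (fun n => (((SeriesDeriv.const M).mul hd) n).congr
      (fun t => congrArg (coeff n) (hconj t)) fun _ => rfl) t
    refine (mul_left_cancel_series (hc t) ?_).symm
    beta_reduce at h1 ⊢
    rw [mul_sub, ← mul_assoc, hconj, eq_sub_iff_add_eq]
    rw [zero_mul, zero_add, ← mul_assoc M] at h1
    rw [← h1, add_comm, mul_assoc _ (a t)]

end HolonomyPath

/-! ### The algebra of endomorphisms generated by right multiplications -/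

section EndMulti

open PowerSeries

/-- The associative algebra of endomorphisms of the space of families of multilinear maps. -/
def EndMulti (V : Type*) [AddCommGroup V] [Module ℂ V] : Type _ := Module.End ℂ (Multi V)

variable {V : Type*} [AddCommGroup V] [Module ℂ V]

instance : Ring (EndMulti V) := inferInstanceAs (Ring (Module.End ℂ (Multi V)))

instance : Algebra ℂ (EndMulti V) := inferInstanceAs (Algebra ℂ (Module.End ℂ (Multi V)))

variable (V) in
/-- Evaluation of an endomorphism at the identity. -/
def evalId : EndMulti V →ₗ[ℂ] Multi V where
  toFun f := (show Module.End ℂ (Multi V) from f) (idMulti V)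
  map_add' _ _ := rfl
  map_smul' _ _ := rfl

variable (gr : ℤ → Submodule ℂ V) [DirectSum.Decomposition gr]

/-- Right multiplication as an element of `EndMulti V`. -/
def rightMul (r : ℤ) : Multi V →ₗ[ℂ] EndMulti V where
  toFun x := rmul gr r x
  map_add' := (rmul gr r).map_add
  map_smul' := (rmul gr r).map_smul

@[simp] theorem evalId_rightMul (r : ℤ) (x : Multi V) : evalId V (rightMul gr r x) = x :=
  rmul_idMulti gr r x

theorem rightMul_injective (r : ℤ) : Function.Injective (rightMul gr r) :=
  Function.LeftInverse.injective (evalId_rightMul gr r)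

theorem rightMul_even {x y : Multi V} (hx : x ∈ homDeg gr 0) (hy : y ∈ homDeg gr 0) :
    rightMul gr 0 x * rightMul gr 0 y - rightMul gr 0 y * rightMul gr 0 x =
      rightMul gr 0 (circ gr 0 y x - circ gr 0 x y) := rmul_circ_sub_even gr hx hy

theorem rightMul_odd {x y : Multi V} (hx : x ∈ homDeg gr 1) (hy : y ∈ homDeg gr 0) :
    rightMul gr 1 x * rightMul gr 0 y - rightMul gr 0 y * rightMul gr 1 x =
      rightMul gr 1 (circ gr 1 y x - circ gr 0 x y) := rmul_circ_sub_odd gr hx hy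

theorem rightMul_add {x y : Multi V} {r r' : ℤ} (hx : x ∈ homDeg gr r) (hy : y ∈ homDeg gr r')
    (hr : Odd r) (hr' : Odd r') :
    rightMul gr 1 y * rightMul gr 1 x + rightMul gr 1 x * rightMul gr 1 y =
      rightMul gr 0 (circ gr 1 x y + circ gr 1 y x) := rmul_circ_add gr hx hy hr hr'

/-- The right multiplications by families of degree `r`. -/
def rightSub (r : ℤ) : Submodule ℂ (EndMulti V) := (homDeg gr r).map (rightMul gr r)

theorem rightMul_mem {r : ℤ} {x : Multi V} (hx : x ∈ homDeg gr r) :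
    rightMul gr r x ∈ rightSub gr r := Submodule.mem_map_of_mem hx

theorem evalId_mem {r : ℤ} {a : EndMulti V} (ha : a ∈ rightSub gr r) :
    evalId V a ∈ homDeg gr r := by
  obtain ⟨x, hx, rfl⟩ := ha
  rwa [evalId_rightMul]

theorem rightMul_evalId {r : ℤ} {a : EndMulti V} (ha : a ∈ rightSub gr r) :
    rightMul gr r (evalId V a) = a := by
  obtain ⟨x, hx, rfl⟩ := ha
  rw [evalId_rightMul]

theorem rightSub_commutator_even : ∀ s ∈ rightSub gr 0, ∀ a ∈ rightSub gr 0,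
    s * a - a * s ∈ rightSub gr 0 := by
  rintro _ ⟨x, hx, rfl⟩ _ ⟨y, hy, rfl⟩
  rw [rightMul_even gr hx hy]
  have h1 := circ_mem_homDeg gr hy hx 0
  have h2 := circ_mem_homDeg gr hx hy 0
  exact rightMul_mem gr ((homDeg gr 0).sub_mem h1 h2)

theorem rightSub_commutator_odd : ∀ s ∈ rightSub gr 1, ∀ a ∈ rightSub gr 0,
    s * a - a * s ∈ rightSub gr 1 := by
  rintro _ ⟨x, hx, rfl⟩ _ ⟨y, hy, rfl⟩
  rw [rightMul_odd gr hx hy]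
  have h1 := circ_mem_homDeg gr hy hx 1
  have h2 := circ_mem_homDeg gr hx hy 0
  exact rightMul_mem gr ((homDeg gr 1).sub_mem h1 h2)

/-- The power series of right multiplications by the coefficients of a formal series. -/
def rightSeries (r : ℤ) (M : ℕ → Multi V) : (EndMulti V)⟦X⟧ := mk fun N => rightMul gr r (M N)

@[simp] theorem coeff_rightSeries (r : ℤ) (M : ℕ → Multi V) (N : ℕ) :
    coeff N (rightSeries gr r M) = rightMul gr r (M N) := coeff_mk _ _

theorem coeffsIn_rightSeries {r : ℤ} {M : ℕ → Multi V} (hM : ∀ N, M N ∈ homDeg gr r) :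
    CoeffsIn (rightSub gr r) (rightSeries gr r M) := fun N => by
  rw [coeff_rightSeries]; exact rightMul_mem gr (hM N)

theorem coeff_mul_sub_mul {A : Type*} [Ring A] (f h : A⟦X⟧) (N : ℕ) : coeff N (f * h - h * f) =
    ∑ p ∈ Finset.HasAntidiagonal.antidiagonal N,
      (coeff p.2 f * coeff p.1 h - coeff p.1 h * coeff p.2 f) := by
  rw [map_sub, coeff_mul, coeff_mul, ← Finset.Nat.sum_antidiagonal_swap, ← Finset.sum_sub_distrib]
  rfl

theorem coeff_rightSeries_commutator {M α : ℕ → Multi V} (hM : ∀ N, M N ∈ homDeg gr 1)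
    (hα : ∀ N, α N ∈ homDeg gr 0) (N : ℕ) :
    coeff N (rightSeries gr 1 M * rightSeries gr 0 α - rightSeries gr 0 α * rightSeries gr 1 M) =
      rightMul gr 1 (∑ p ∈ Finset.HasAntidiagonal.antidiagonal N,
        (circ gr 1 (α p.1) (M p.2) - circ gr 0 (M p.2) (α p.1))) := by
  rw [coeff_mul_sub_mul, map_sum]
  refine Finset.sum_congr rfl fun p _ => ?_
  rw [coeff_rightSeries, coeff_rightSeries, rightMul_odd gr (hM _) (hα _)]

theorem coeff_mul_add_mul {A : Type*} [Ring A] (f h : A⟦X⟧) (N : ℕ) : coeff N (f * h + h * f) =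
    ∑ p ∈ Finset.HasAntidiagonal.antidiagonal N,
      (coeff p.2 f * coeff p.1 h + coeff p.1 h * coeff p.2 f) := by
  rw [map_add, coeff_mul, coeff_mul, ← Finset.Nat.sum_antidiagonal_swap, ← Finset.sum_add_distrib]
  rfl

theorem coeff_rightSeries_anticommutator {r r' : ℤ} (hr : Odd r) (hr' : Odd r')
    {M α : ℕ → Multi V} (hM : ∀ N, M N ∈ homDeg gr r)
    (hα : ∀ N, α N ∈ homDeg gr r') (N : ℕ) :
    coeff N (rightSeries gr 1 M * rightSeries gr 1 α + rightSeries gr 1 α * rightSeries gr 1 M) =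
      rightMul gr 0 (∑ p ∈ Finset.HasAntidiagonal.antidiagonal N,
        (circ gr 1 (α p.1) (M p.2) + circ gr 1 (M p.2) (α p.1))) := by
  rw [coeff_mul_add_mul, map_sum]
  refine Finset.sum_congr rfl fun p _ => ?_
  rw [coeff_rightSeries, coeff_rightSeries, rightMul_add gr (hα _) (hM _) hr' hr]

/-- Pre-Lie controls only the anticommutator of odd right multiplications, so the square is obtained
as half the anticommutator of the series with itself. -/
theorem coeff_rightSeries_mul_self {M : ℕ → Multi V} (hM : ∀ N, M N ∈ homDeg gr 1) (N : ℕ) :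
    coeff N (rightSeries gr 1 M * rightSeries gr 1 M) =
      rightMul gr 0 (∑ p ∈ Finset.HasAntidiagonal.antidiagonal N, circ gr 1 (M p.1) (M p.2)) := by
  have key : (2 : ℂ) • coeff N (rightSeries gr 1 M * rightSeries gr 1 M) =
      (2 : ℂ) • rightMul gr 0 (∑ p ∈ Finset.HasAntidiagonal.antidiagonal N,
        circ gr 1 (M p.1) (M p.2)) := by
    rw [two_smul, two_smul, ← map_add,
      coeff_rightSeries_anticommutator gr odd_one odd_one hM hM, ← map_add,
      Finset.sum_add_distrib]
    congr 2
    exact Finset.Nat.sum_antidiagonal_swap (f := fun p => circ gr 1 (M p.1) (M p.2))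
  have := congrArg ((2 : ℂ)⁻¹ • ·) key
  simpa [smul_smul] using this

/-- The weak `A_∞`-relations say that the series of right multiplications squares to zero. -/
theorem rightSeries_mul_self {M : ℕ → Multi V} (hM : ∀ N, M N ∈ homDeg gr 1)
    (h : ∀ N, ∑ p ∈ Finset.HasAntidiagonal.antidiagonal N, circ gr 1 (M p.1) (M p.2) = 0) :
    rightSeries gr 1 M * rightSeries gr 1 M = 0 := by
  ext N
  rw [coeff_rightSeries_mul_self gr hM, h, map_zero, map_zero]

end EndMulti

/-! ### The suspended Hochschild DGLA -/

section Hochschild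

variable {V : Type*} [AddCommGroup V] [Module ℂ V]
variable (gr : ℤ → Submodule ℂ V) [DirectSum.Decomposition gr]

theorem sum_antidiagonal_single_left {W : Type*} [AddCommGroup W] [Module ℂ W]
    (B : W →ₗ[ℂ] W →ₗ[ℂ] W) (m : W) (y : ℕ → W) (N : ℕ) :
    ∑ p ∈ Finset.HasAntidiagonal.antidiagonal N, B ((Pi.single 0 m : ℕ → W) p.1) (y p.2) =
      B m (y N) := by
  rw [Finset.sum_eq_single (0, N)]
  · rw [Pi.single_eq_same]
  · rintro ⟨i, j⟩ hij hne
    have : i ≠ 0 := by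
      rintro rfl
      exact hne (by simpa using Finset.HasAntidiagonal.mem_antidiagonal.mp hij)
    rw [Pi.single_eq_of_ne this, map_zero, LinearMap.zero_apply]
  · intro h
    exact absurd (Finset.HasAntidiagonal.mem_antidiagonal.mpr (zero_add N)) h

theorem sum_antidiagonal_single_right {W : Type*} [AddCommGroup W] [Module ℂ W]
    (B : W →ₗ[ℂ] W →ₗ[ℂ] W) (m : W) (y : ℕ → W) (N : ℕ) :
    ∑ p ∈ Finset.HasAntidiagonal.antidiagonal N, B (y p.1) ((Pi.single 0 m : ℕ → W) p.2) =
      B (y N) m := by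
  rw [← Finset.Nat.sum_antidiagonal_swap]
  exact sum_antidiagonal_single_left B.flip m y N

theorem sum_antidiagonalTuple_one {X W : Type*} [AddCommMonoid W] (F : (Fin 1 → X) → W)
    (x : ℕ → X) (N : ℕ) :
    ∑ i ∈ Finset.Nat.antidiagonalTuple 1 N, F (fun a => x (i a)) = F fun _ => x N := by
  rw [Finset.Nat.antidiagonalTuple_one, Finset.sum_singleton]
  congr 1
  funext a
  fin_cases a
  rfl

theorem sum_antidiagonalTuple_two {W : Type*} [AddCommMonoid W] (F : ℕ → ℕ → W) (N : ℕ) :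
    ∑ i ∈ Finset.Nat.antidiagonalTuple 2 N, F (i 0) (i 1) =
      ∑ p ∈ Finset.HasAntidiagonal.antidiagonal N, F p.1 p.2 := by
  rw [Finset.Nat.antidiagonalTuple_two, Finset.sum_map]
  rfl

theorem sum_antidiagonal_eq_zero_of_le_one {W : Type*} [AddCommMonoid W] {F : ℕ → ℕ → W}
    (h : ∀ k, F 0 k = 0) (h' : ∀ k, F k 0 = 0) {N : ℕ} (hN : N ≤ 1) :
    ∑ p ∈ Finset.HasAntidiagonal.antidiagonal N, F p.1 p.2 = 0 := by
  refine Finset.sum_eq_zero fun p hp => ?_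
  have := Finset.HasAntidiagonal.mem_antidiagonal.mp hp
  rcases Nat.eq_zero_or_pos p.1 with h1 | h1
  · rw [h1, h]
  · have : p.2 = 0 := by omega
    rw [this, h']

/-- The curvature in the Hochschild algebra is `-(m ∘ θ + θ ∘ m + θ ∘ θ)`. It completes to `-(m + θ)
∘ (m + θ)` because `m ∘ m = 0`. -/
theorem hochschildOps_sum_eq (m : Multi V) (hm : circ gr 1 m m = 0) {θ : ℕ → Multi V}
    (hθ : θ 0 = 0) (N : ℕ) :
    ∑ k ∈ Finset.Icc 1 N, ((k.factorial : ℂ)⁻¹) •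
      ∑ i ∈ Finset.Nat.antidiagonalTuple k N,
        (hochschildOps gr m).op k (fun _ => 0) (fun a => θ (i a)) =
      -∑ p ∈ Finset.HasAntidiagonal.antidiagonal N,
        circ gr 1 ((Pi.single 0 m + θ : ℕ → Multi V) p.1) ((Pi.single 0 m + θ : ℕ → Multi V) p.2) := by
  set f : ℕ → Multi V := fun k => ((k.factorial : ℂ)⁻¹) •
      ∑ i ∈ Finset.Nat.antidiagonalTuple k N,
        (hochschildOps gr m).op k (fun _ => 0) (fun a => θ (i a)) with hf
  set Q := ∑ p ∈ Finset.HasAntidiagonal.antidiagonal N, circBilin gr 1 (θ p.1) (θ p.2) with hQ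
  have f1 : f 1 = -(circBilin gr 1 m (θ N) + circBilin gr 1 (θ N) m) := by
    simp only [hf]
    rw [sum_antidiagonalTuple_one ((hochschildOps gr m).op 1 (fun _ => 0))]
    simp only [Nat.factorial_one, Nat.cast_one, inv_one, one_smul, hochschildOps, bracket]
    norm_num
  have f2 : f 2 = -Q := by
    simp only [hf]
    have e := sum_antidiagonalTuple_two (fun a b => (hochschildOps gr m).op 2 (fun _ => 0)
      ![θ a, θ b]) N
    have e' : ∀ i : Fin 2 → ℕ, (fun a => θ (i a)) = ![θ (i 0), θ (i 1)] := fun i => by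
      funext a; fin_cases a <;> rfl
    simp only [e']
    rw [e]
    simp only [hochschildOps, bracket]
    norm_num
    rw [Finset.sum_add_distrib, Finset.sum_neg_distrib, Finset.sum_neg_distrib]
    have := Finset.Nat.sum_antidiagonal_swap (n := N) (f := fun p => circ gr 1 (θ p.1) (θ p.2))
    simp only [Prod.fst_swap, Prod.snd_swap] at this
    rw [this, ← two_smul ℂ, smul_smul]
    norm_num
    simp only [hQ, circBilin_apply]
  have hff : ∀ k, 3 ≤ k → f k = 0 := fun k hk => by
    obtain ⟨j, rfl⟩ := Nat.exists_eq_add_of_le' hk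
    simp [hf, hochschildOps]
  have f10 : N = 0 → f 1 = 0 := by rintro rfl; rw [f1, hθ]; simp [-circBilin_apply]
  have f20 : N ≤ 1 → f 2 = 0 := fun h => by
    rw [f2, hQ, sum_antidiagonal_eq_zero_of_le_one (F := fun a b => circBilin gr 1 (θ a) (θ b))
      (fun k => by simp [hθ, -circBilin_apply]) (fun k => by simp [hθ, -circBilin_apply]) h,
      neg_zero]
  -- For `N ≤ 1` the range omits arities 1 or 2, but the omitted terms vanish since `θ 0 = 0`.
  have hsum : ∑ k ∈ Finset.Icc 1 N, f k = f 1 + f 2 := by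
    rcases N with _ | _ | N
    · rw [f10 rfl, f20 (by omega)]; simp
    · rw [f20 (by omega)]; simp
    · rw [← Finset.sum_pair (by norm_num : (1 : ℕ) ≠ 2)]
      refine (Finset.sum_subset (fun k hk => ?_) fun k hk hk' => hff k ?_).symm
      · simp only [Finset.mem_insert, Finset.mem_singleton] at hk
        rw [Finset.mem_Icc]; omega
      · simp only [Finset.mem_insert, Finset.mem_singleton] at hk'
        rw [Finset.mem_Icc] at hk; omega
  rw [hsum, f1, f2, ← neg_add]
  congr 1
  simp only [← circBilin_apply, Pi.add_apply, map_add, LinearMap.add_apply, Finset.sum_add_distrib,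
    sum_antidiagonal_single_left, sum_antidiagonal_single_right]
  have h0 : circBilin gr 1 m ((Pi.single 0 m : ℕ → Multi V) N) = 0 := by
    rcases N with _ | N
    · rw [Pi.single_eq_same, circBilin_apply, hm]
    · rw [Pi.single_eq_of_ne (Nat.succ_ne_zero N), map_zero]
  rw [h0, zero_add, hQ]
  abel

/-- For a parameter `α` of family degree zero the gauge vector field is `α ∘ M - M ∘ α` with `M = m
+ θ`: the unary operation supplies the part in `m`, the binary one the part in `θ`. -/
theorem hochschildOps_gauge_sum_eq (m : Multi V) {α θ : ℕ → Multi V} (hα : α 0 = 0) (hθ : θ 0 = 0)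
    (N : ℕ) :
    ∑ k ∈ Finset.range N, ((k.factorial : ℂ)⁻¹) •
        ∑ i ∈ Finset.Nat.antidiagonalTuple (k + 1) N,
          (hochschildOps gr m).op (k + 1) (Fin.cons (-1) fun _ => 0)
            (Fin.cons (α (i 0)) fun a => θ (i a.succ)) =
      ∑ p ∈ Finset.HasAntidiagonal.antidiagonal N,
        (circ gr 1 (α p.1) ((Pi.single 0 m + θ : ℕ → Multi V) p.2) -
          circ gr 0 ((Pi.single 0 m + θ : ℕ → Multi V) p.2) (α p.1)) := by
  set f : ℕ → Multi V := fun k => ((k.factorial : ℂ)⁻¹) •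
        ∑ i ∈ Finset.Nat.antidiagonalTuple (k + 1) N,
          (hochschildOps gr m).op (k + 1) (Fin.cons (-1) fun _ => 0)
            (Fin.cons (α (i 0)) fun a => θ (i a.succ)) with hf
  have f0 : f 0 = circBilin gr 1 (α N) m - circBilin gr 0 m (α N) := by
    simp only [hf]
    have e' : ∀ i : Fin 1 → ℕ, (Fin.cons (α (i 0)) fun a => θ (i a.succ) : Fin 1 → Multi V) =
      fun a => α (i a) := fun i => by
      funext a; fin_cases a; rfl
    simp only [e']
    rw [sum_antidiagonalTuple_one ((hochschildOps gr m).op 1 _)]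
    simp [hochschildOps, bracket]
  have f1 : f 1 = ∑ p ∈ Finset.HasAntidiagonal.antidiagonal N,
      (circBilin gr 1 (α p.1) (θ p.2) - circBilin gr 0 (θ p.2) (α p.1)) := by
    simp only [hf]
    have e := sum_antidiagonalTuple_two (fun a b => (hochschildOps gr m).op 2
      (Fin.cons (-1) fun _ => 0) ![α a, θ b]) N
    have e' : ∀ i : Fin 2 → ℕ, (Fin.cons (α (i 0)) fun a => θ (i a.succ) : Fin 2 → Multi V) =
      ![α (i 0), θ (i 1)] := fun i => by
      funext a; fin_cases a <;> rfl
    simp only [e']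
    refine (congrArg _ e).trans ?_
    have e1 : (Fin.cons (-1) (fun _ => 0) : Fin 2 → ℤ) 1 = 0 := rfl
    simp [hochschildOps, bracket, e1]
  have hff : ∀ k, 2 ≤ k → f k = 0 := fun k hk => by
    obtain ⟨j, rfl⟩ := Nat.exists_eq_add_of_le' hk
    simp [hf, hochschildOps]
  have f00 : N = 0 → f 0 = 0 := by rintro rfl; rw [f0, hα]; simp [-circBilin_apply]
  have f10 : N ≤ 1 → f 1 = 0 := fun h => by
    rw [f1, sum_antidiagonal_eq_zero_of_le_one
      (F := fun a b => circBilin gr 1 (α a) (θ b) - circBilin gr 0 (θ b) (α a))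
      (fun k => by simp [hα, -circBilin_apply]) (fun k => by simp [hθ, -circBilin_apply]) h]
  have hsum : ∑ k ∈ Finset.range N, f k = f 0 + f 1 := by
    rcases N with _ | _ | N
    · rw [f00 rfl, f10 (by omega)]; simp
    · rw [f10 (by omega)]; simp
    · rw [← Finset.sum_pair (by norm_num : (0 : ℕ) ≠ 1)]
      refine (Finset.sum_subset (fun k hk => ?_) fun k hk hk' => hff k ?_).symm
      · simp only [Finset.mem_insert, Finset.mem_singleton] at hk
        rw [Finset.mem_range]; omega
      · simp only [Finset.mem_insert, Finset.mem_singleton] at hk'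
        omega
  rw [hsum, f0, f1]
  simp only [← circBilin_apply, Pi.add_apply, map_add, LinearMap.add_apply, Finset.sum_sub_distrib,
    Finset.sum_add_distrib, sum_antidiagonal_single_right]
  have := sum_antidiagonal_single_right (circBilin gr 0).flip m α N
  simp only [LinearMap.flip_apply] at this
  rw [this]
  abel

end Hochschild

/-! ### Maurer–Cartan elements and gauge equivalence for the Hochschild DGLA -/

section HochschildMC

open PowerSeries

variable {V : Type*} [AddCommGroup V] [Module ℂ V]
variable (gr : ℤ → Submodule ℂ V) [DirectSum.Decomposition gr]

theorem mem_hochschildOps_MC_iff (A : AInftyAlgebra gr) (θ : ℕ → Multi V) :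
    θ ∈ (hochschildOps gr A.m).MC ↔
      IsWeakAInftyDeformation gr A.m (Pi.single 0 A.m + θ) := by
  have hdeg : θ 0 = 0 → ((∀ N, θ N ∈ homDeg gr 1) ↔
      ∀ N, (Pi.single 0 A.m + θ : ℕ → Multi V) N ∈ homDeg gr 1) := fun h0 => by
    refine forall_congr' fun N => ?_
    rcases N with _ | N
    · rw [Pi.add_apply, Pi.single_eq_same, h0, add_zero]
      exact ⟨fun _ => A.m_degree, fun _ => (homDeg gr 1).zero_mem⟩
    · rw [Pi.add_apply, Pi.single_eq_of_ne (Nat.succ_ne_zero N), zero_add]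
  have hzero : (Pi.single 0 A.m + θ : ℕ → Multi V) 0 = A.m ↔ θ 0 = 0 := by
    rw [Pi.add_apply, Pi.single_eq_same, add_eq_left]
  unfold IsWeakAInftyDeformation
  rw [hzero]
  constructor
  · rintro ⟨h0, h1, h2⟩
    refine ⟨h0, (hdeg h0).mp h1, fun N => ?_⟩
    rw [← neg_eq_zero, ← hochschildOps_sum_eq gr A.m A.m_rel h0]
    exact h2 N
  · rintro ⟨h0, h1, h2⟩
    refine ⟨h0, (hdeg h0).mpr h1, fun N => ?_⟩
    rw [hochschildOps_sum_eq gr A.m A.m_rel h0, h2, neg_zero]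

/-- Two series `M`, `M'` of degree one families are intertwined if `g R_{M'} = R_M g` for a
group-like power series `g`. -/
def Intertwined (M M' : ℕ → Multi V) : Prop :=
  ∃ g, IsGroupLike (rightSub gr 0) g ∧ g * rightSeries gr 1 M' = rightSeries gr 1 M * g

theorem Intertwined.refl (M : ℕ → Multi V) : Intertwined gr M M :=
  ⟨1, IsGroupLike.one, by rw [one_mul, mul_one]⟩

theorem Intertwined.symm {M M' : ℕ → Multi V} (h : Intertwined gr M M') : Intertwined gr M' M := by
  obtain ⟨g, hg, e⟩ := h
  refine ⟨seriesInv g, hg.inv (rightSub_commutator_even gr), ?_⟩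
  rw [← mul_one (seriesInv g * _), ← mul_seriesInv hg.constCoeff, mul_assoc, ← mul_assoc _ g, ← e,
    mul_assoc, ← mul_assoc _ g, seriesInv_mul hg.constCoeff, one_mul]

theorem Intertwined.trans {M M' M'' : ℕ → Multi V} (h : Intertwined gr M M')
    (h' : Intertwined gr M' M'') : Intertwined gr M M'' := by
  obtain ⟨g, hg, e⟩ := h
  obtain ⟨g', hg', e'⟩ := h'
  exact ⟨g * g', hg.mul (rightSub_commutator_even gr) hg', by
    rw [mul_assoc, e', ← mul_assoc, e, mul_assoc]⟩

variable {gr}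

/-- Right multiplication turns the gauge equation into `M' = M a - a M`, and the holonomy of `a` at
time one intertwines the endpoints. -/
theorem Intertwined.of_gaugePath {m : Multi V} (hm : m ∈ homDeg gr 1) {θ θ' : ℕ → Multi V}
    (h : (hochschildOps gr m).GaugePath θ θ') :
    Intertwined gr (Pi.single 0 m + θ) (Pi.single 0 m + θ') := by
  obtain ⟨c, α, hc0, hα0, hc, hα, h0, h1, hd⟩ := h
  set M : ℂ → ℕ → Multi V := fun t => Pi.single 0 m + fun N => GradedOps.polyEval t (c N) with hM
  set a : ℂ → ℕ → Multi V := fun t N => GradedOps.polyEval t (α N) with ha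
  have hcd : ∀ t N, GradedOps.polyEval t (c N) ∈ homDeg gr 1 := fun t N => by
    rw [GradedOps.polyEval, Finsupp.sum]
    exact Submodule.sum_mem _ fun j _ => Submodule.smul_mem _ _ (hc N j)
  have had : ∀ t N, a t N ∈ homDeg gr 0 := fun t N => by
    rw [ha]
    simp only [GradedOps.polyEval, Finsupp.sum]
    exact Submodule.sum_mem _ fun j _ => Submodule.smul_mem _ _ (hα N j)
  have hMd : ∀ t N, M t N ∈ homDeg gr 1 := fun t N => by
    refine (homDeg gr 1).add_mem ?_ (hcd t N)
    rcases N with _ | N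
    · rwa [Pi.single_eq_same]
    · rw [Pi.single_eq_of_ne (Nat.succ_ne_zero N)]
      exact Submodule.zero_mem _
  have hda : ∀ t, a t 0 = 0 := fun t => by simp [ha, hα0, GradedOps.polyEval]
  have hD : SeriesDeriv (fun t => rightSeries gr 1 (M t)) fun t =>
      rightSeries gr 1 (M t) * rightSeries gr 0 (a t) -
        rightSeries gr 0 (a t) * rightSeries gr 1 (M t) := fun N => by
    refine (((PolyDeriv.const ((Pi.single 0 m : ℕ → Multi V) N)).add
      (PolyDeriv.polyDeriv_polyEval (c N))).map (rightMul gr 1)).congr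
      (fun t => by rw [coeff_rightSeries]; rfl) fun t => ?_
    rw [coeff_rightSeries_commutator gr (hMd t) (had t), zero_add, hd]
    exact congrArg _ (hochschildOps_gauge_sum_eq gr m (α := a t)
      (θ := fun N => GradedOps.polyEval t (c N)) (hda t)
      (by simp [hc0, GradedOps.polyEval]) N).symm
  have haP : IsPolySeries fun t => rightSeries gr 0 (a t) := fun N => by
    simp only [coeff_rightSeries]
    exact (PolyDeriv.polyDeriv_polyEval (α N)).isPolyFun.map _
  have ha0 : ∀ t, coeff 0 (rightSeries gr 0 (a t)) = 0 := fun t => by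
    rw [coeff_rightSeries, hda, map_zero]
  obtain ⟨φ, hφ, hφ0, hφg⟩ := exists_holonomy (rightSub_commutator_even gr) haP ha0
    fun t => coeffsIn_rightSeries gr (had t)
  have h0' : (fun N => GradedOps.polyEval 0 (c N)) = θ := funext h0
  have h1' : (fun N => GradedOps.polyEval 1 (c N)) = θ' := funext h1
  refine ⟨φ 1, hφg 1, ?_⟩
  have := holonomy_intertwines hD hφ hφ0 ha0 1
  simpa only [hM, h0', h1'] using this

/-- A polynomial function with values in a subspace is represented by a polynomial with coefficients
in this subspace. -/
theorem PolyDeriv.exists_poly {W : Type*} [AddCommGroup W] [Module ℂ W] {S : Submodule ℂ W}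
    {f f' : ℂ → W} (h : PolyDeriv f f') (hS : ∀ t, f t ∈ S) : ∃ p : ℕ →₀ W,
      (∀ t, GradedOps.polyEval t p = f t) ∧ (∀ t, GradedOps.polyDerivEval t p = f' t) ∧
      (∀ j, p j ∈ S) ∧ ((∀ t, f t = 0) → p = 0) := by
  obtain ⟨p, hp, hp'⟩ := h
  refine ⟨p, fun t => (hp t).symm, fun t => (hp' t).symm, coeff_mem_of_polyEval_mem fun t => ?_,
    fun h0 => polyEval_injective fun t _ => by rw [← hp, h0]⟩
  rw [← hp]
  exact hS t

/-- Passes from polynomial functions to coefficient data; membership and vanishing of the values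
carry over to the coefficients because polynomials are determined by their values. -/
theorem GradedOps.gaugePath_of_polyDeriv {W : Type*} [AddCommGroup W] [Module ℂ W]
    {G : GradedOps W} {c a : ℂ → ℕ → W} {c' : ℂ → ℕ → W}
    (hc : ∀ N, PolyDeriv (fun t => c t N) fun t => c' t N) (ha : ∀ N, IsPolyFun fun t => a t N)
    (hc0 : ∀ t, c t 0 = 0) (ha0 : ∀ t, a t 0 = 0) (hcd : ∀ t N, c t N ∈ G.deg 0)
    (had : ∀ t N, a t N ∈ G.deg (-1))
    (h : ∀ t N, c' t N = ∑ k ∈ Finset.range N, ((k.factorial : ℂ)⁻¹) •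
        ∑ i ∈ Finset.Nat.antidiagonalTuple (k + 1) N,
          G.op (k + 1) (Fin.cons (-1) fun _ => 0)
            (Fin.cons (a t (i 0)) fun b => c t (i b.succ))) :
    G.GaugePath (c 0) (c 1) := by
  choose p hp hp' hpS hp0 using fun N => (hc N).exists_poly fun t => hcd t N
  choose a' ha' using fun N => (ha N).exists_polyDeriv
  choose q hq _ hqS hq0 using fun N => (ha' N).exists_poly fun t => had t N
  refine ⟨p, q, hp0 0 hc0, hq0 0 ha0, hpS, hqS, fun N => hp N 0, fun N => hp N 1, fun t N => ?_⟩
  rw [hp', h]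
  simp only [hp, hq]

/-- Conjugate `R_{m+θ}` by `g(tν)`. The conjugates remain right multiplications of degree one, so
evaluation at the identity family reads off a path of families; subtracting `m` gives the path from
`θ` to `θ'`. -/
theorem Intertwined.gaugePath {m : Multi V} (hm : m ∈ homDeg gr 1) {θ θ' : ℕ → Multi V}
    (hθ : ∀ N, θ N ∈ homDeg gr 1) (hθ0 : θ 0 = 0)
    (h : Intertwined gr (Pi.single 0 m + θ) (Pi.single 0 m + θ')) :
    (hochschildOps gr m).GaugePath θ θ' := by
  obtain ⟨g, hg, e⟩ := h
  have hsingle : ∀ N, (Pi.single 0 m : ℕ → Multi V) N ∈ homDeg gr 1 := fun N => by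
    rcases N with _ | N
    · rwa [Pi.single_eq_same]
    · rw [Pi.single_eq_of_ne (Nat.succ_ne_zero N)]
      exact Submodule.zero_mem _
  obtain ⟨P, a, hP0, hP1, ha, ha0, hag, hPS, hPc, hPd⟩ := hg.exists_conj_path
    (rightSub_commutator_odd gr) (coeffsIn_rightSeries gr (M := Pi.single 0 m + θ)
      fun N => (homDeg gr 1).add_mem (hsingle N) (hθ N))
  set Θ : ℂ → ℕ → Multi V := fun t N =>
    evalId V (coeff N (P t)) - (Pi.single 0 m : ℕ → Multi V) N with hΘ
  set α : ℂ → ℕ → Multi V := fun t N => evalId V (coeff N (a t)) with hα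
  have hΘd : ∀ t N, Θ t N ∈ homDeg gr 1 := fun t N =>
    (homDeg gr 1).sub_mem (evalId_mem gr (hPS t N)) (hsingle N)
  have hαd : ∀ t N, α t N ∈ homDeg gr 0 := fun t N => evalId_mem gr (hag t N)
  have hΘ0 : ∀ t, Θ t 0 = 0 := fun t => by
    simp only [hΘ]
    rw [hPc, coeff_rightSeries, evalId_rightMul, Pi.add_apply, hθ0, add_zero, sub_self]
  have hα0 : ∀ t, α t 0 = 0 := fun t => by simp only [hα]; rw [ha0, map_zero]
  have hMΘ : ∀ t, rightSeries gr 1 (Pi.single 0 m + Θ t) = P t := fun t => by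
    ext1 N
    rw [coeff_rightSeries, Pi.add_apply, hΘ]
    simp only
    rw [add_sub_cancel, rightMul_evalId gr (hPS t N)]
  have hαa : ∀ t, rightSeries gr 0 (α t) = a t := fun t => by
    ext1 N
    rw [coeff_rightSeries, hα]
    simp only
    rw [rightMul_evalId gr (hag t N)]
  have hstart : Θ 0 = θ := by
    funext N
    simp only [hΘ]
    rw [hP0, coeff_rightSeries, evalId_rightMul, Pi.add_apply, add_sub_cancel_left]
  have hend : Θ 1 = θ' := by
    have : P 1 = rightSeries gr 1 (Pi.single 0 m + θ') :=
      mul_left_cancel_series hg.constCoeff (hP1.trans e.symm)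
    funext N
    simp only [hΘ]
    rw [this, coeff_rightSeries, evalId_rightMul, Pi.add_apply, add_sub_cancel_left]
  rw [← hstart, ← hend]
  refine GradedOps.gaugePath_of_polyDeriv (c := Θ) (a := α)
    (c' := fun t N => evalId V (coeff N (P t * a t - a t * P t)))
    (fun N => ((((hPd N).map (evalId V)).sub
      (PolyDeriv.const ((Pi.single 0 m : ℕ → Multi V) N)))).congr (fun _ => rfl)
      fun t => (sub_zero _).symm) (fun N => (ha N).map _) hΘ0 hα0 hΘd hαd fun t N => ?_
  have hMd : ∀ N, (Pi.single 0 m + Θ t : ℕ → Multi V) N ∈ homDeg gr 1 :=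
    fun N => (homDeg gr 1).add_mem (hsingle N) (hΘd t N)
  rw [hochschildOps_gauge_sum_eq gr m (hα0 t) (hΘ0 t), ← hMΘ, ← hαa,
    coeff_rightSeries_commutator gr hMd (hαd t), evalId_rightMul]

/-- Gauge equivalence in the Hochschild DGLA is conjugation by a group-like power series. -/
theorem hochschildOps_gaugeSetoid_iff (A : AInftyAlgebra gr)
    (θ θ' : (hochschildOps gr A.m).MC) :
    (hochschildOps gr A.m).gaugeSetoid θ θ' ↔
      Intertwined gr (Pi.single 0 A.m + θ.1) (Pi.single 0 A.m + θ'.1) := by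
  constructor
  · intro h
    change Relation.EqvGen _ _ _ at h
    induction h with
    | rel x y h => exact Intertwined.of_gaugePath A.m_degree h
    | refl x => exact Intertwined.refl gr _
    | symm x y _ ih => exact Intertwined.symm gr ih
    | trans x y z _ _ ih ih' => exact Intertwined.trans gr ih ih'
  · intro h
    -- Since intertwining is already an equivalence relation, a single path replaces a chain.
    exact Relation.EqvGen.rel _ _ (h.gaugePath A.m_degree θ.2.2.1 θ.2.1)

end HochschildMC

/-! ### The relations of an open-closed homotopy algebra, in terms of families -/

section OpenClosedRelations

theorem prod_negOnePow {ι : Type*} (s : Finset ι) (f : ι → ℤ) :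
    ∏ a ∈ s, (f a).negOnePow = (∑ a ∈ s, f a).negOnePow := by
  classical
  induction s using Finset.induction_on with
  | empty => simp
  | insert a s ha ih => rw [Finset.prod_insert ha, Finset.sum_insert ha, Int.negOnePow_add, ih]

theorem negOnePow_smul_eq {W : Type*} [AddCommGroup W] [Module ℂ W] (n : ℤ) (x : W) :
    n.negOnePow • x = ((n.negOnePow : ℤ) : ℂ) • x := by
  rw [Units.smul_def, Int.cast_smul_eq_zsmul]

variable {V : Type*} [AddCommGroup V] [Module ℂ V]
variable (gr : ℤ → Submodule ℂ V) [DirectSum.Decomposition gr]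

/-- Multilinearity extracts one scalar sign from each of the first `i` slots, which recovers the
explicit Koszul sign of the open-closed relations. -/
theorem compAt_signOp_apply {N : ℕ} (i s : ℕ) (h : i + s ≤ N) (r : ℤ)
    (X : MultilinearMap ℂ (fun _ : Fin (i + 1 + (N - i - s)) => V) V)
    (Y : MultilinearMap ℂ (fun _ : Fin s => V) V) (d : Fin N → ℤ) (o : Fin N → V)
    (ho : ∀ b, o b ∈ gr (d b)) : compAt (signOp gr r) i s h X Y o =
      (r * ∑ b : Fin i, d ⟨b.1, by omega⟩).negOnePow •
        X (insertBlock i s h o (Y (block i s h o))) := by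
  have key : ∀ v, insertBlock i s h (fun b => if b.1 < i then signOp gr r (o b) else o b) v =
      fun a => (if h' : a.1 < i then (((r * d ⟨a.1, by omega⟩).negOnePow : ℤ) : ℂ) else 1) •
        insertBlock i s h o v a := by
    intro v
    funext a
    simp only [insertBlock]
    split_ifs with h1 h2 h3
    · rw [signOp_of_mem gr r (ho _), negOnePow_smul_eq]
    · rw [one_smul]
    · omega
    · rw [one_smul]
  change X (insertBlock i s h (fun b => if b.1 < i then signOp gr r (o b) else o b) _) = _
  rw [key, X.map_smul_univ, negOnePow_smul_eq]
  congr 1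
  rw [Fin.prod_univ_add, Fin.prod_univ_add]
  have e1 : ∀ x : Fin (N - i - s), ¬ i + 1 + x.1 < i := fun x => by omega
  have e2 : ∀ x : Fin 1, ¬ i + x.1 < i := fun x => by omega
  simp only [Fin.val_castAdd, Fin.val_natAdd, Fin.is_lt, dif_pos, dif_neg (e1 _), dif_neg (e2 _),
    Finset.prod_const_one, mul_one]
  rw [Finset.mul_sum, ← prod_negOnePow]
  push_cast
  rfl

end OpenClosedRelations

/-! ### L∞ and open-closed relations as instances of one quadratic relation -/

section StructureMaps

variable {Hc : Type*} [AddCommGroup Hc] [Module ℂ Hc] {grc : ℤ → Submodule ℂ Hc}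
  {Ho : Type*} [AddCommGroup Ho] [Module ℂ Ho] {gro : ℤ → Submodule ℂ Ho}

theorem LInftyAlgebra.quadRel (L : LInftyAlgebra grc) : QuadRel grc L.l L.l fun _ => 0 where
  l_zero := L.l_zero
  l_degree := L.l_degree
  l_symm := L.l_symm
  w_symm := L.l_symm
  rel n d c hc := by
    simp only [LinearMap.zero_apply, smul_zero, Finset.sum_const_zero, add_zero]
    exact L.l_rel n d c hc

/-- The closed arguments of an open-closed homotopy algebra parametrize families of multilinear
maps in a multilinear way. -/
def OCHA.family (H : OCHA grc gro) (k : ℕ) : MultilinearMap ℂ (fun _ : Fin k => Hc) (Multi Ho) :=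
  MultilinearMap.pi fun q => H.n k q

theorem OCHA.nStar_mem (H : OCHA grc gro) {k : ℕ} {d : Fin k → ℤ} {c : Fin k → Hc}
    (hc : ∀ i, c i ∈ grc (d i)) : H.nStar k c ∈ homDeg gro (∑ i, d i + 1) := fun q dO o ho => by
  have := H.n_degree k q d c dO o hc ho
  rwa [add_comm (∑ i, d i), add_assoc] at this

/-- Comparison of signs: the terms in the open degrees add up to `(1 + closed degrees of the inner
block) * (degrees of the inputs on the left)`. This is the sign of `circ` for an inner family of
degree one plus its closed degrees. -/
theorem OCHA.quadRel [DirectSum.Decomposition gro] (H : OCHA grc gro) :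
    QuadRel grc H.l H.family (circBilin gro) where
  l_zero := H.l_zero
  l_degree := H.l_degree
  l_symm := H.l_symm
  w_symm k σ d c hc := by
    funext q
    exact H.n_symm k q σ d c hc
  rel n d c hc := by
    funext m
    refine multilinear_ext_homogeneous gro fun dO o ho => ?_
    have h := H.n_rel n m d c dO o hc ho
    simp only [negOnePow_smul_eq] at h ⊢
    rw [Pi.add_apply, _root_.add_apply, Finset.sum_apply, _root_.sum_apply, Finset.sum_apply,
      _root_.sum_apply]
    refine Eq.trans ?_ h
    congr 1
    · refine Finset.sum_congr rfl fun p _ => ?_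
      rw [Finset.sum_apply, _root_.sum_apply]
      exact Finset.sum_congr rfl fun σ _ => rfl
    · refine Finset.sum_congr rfl fun p _ => ?_
      rw [Finset.sum_apply, _root_.sum_apply]
      simp only [Finset.sum_comm (t := (Finset.univ : Finset (Equiv.Perm (Fin n))))]
      refine Finset.sum_congr rfl fun σ _ => ?_
      rw [Pi.smul_apply, Pi.smul_apply, _root_.smul_apply, _root_.smul_apply, circBilin_apply, circ,
        _root_.sum_apply, Finset.smul_sum, Finset.smul_sum]
      refine Finset.sum_congr rfl fun i _ => ?_
      rw [_root_.sum_apply, Finset.smul_sum, Finset.smul_sum]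
      refine Finset.sum_congr rfl fun s _ => ?_
      rw [compAt_signOp_apply gro _ _ _ _ _ _ dO o ho, negOnePow_smul_eq]
      refine congrArg (HSMul.hSMul _) ?_
      rw [smul_smul]
      refine congrArg (fun z : ℂ => z • _) ?_
      rw [← Int.cast_mul, ← Units.val_mul, ← Int.negOnePow_add]
      congr 3
      ring

end StructureMaps

/-! ### Gauge flows in an `L_∞`-algebra -/

section ExpSumDegree

variable {V W : Type*} [AddCommGroup V] [Module ℂ V] [AddCommGroup W] [Module ℂ W]
  {gr : ℤ → Submodule ℂ V} {S : ℤ → Submodule ℂ W}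
  {w : ∀ k : ℕ, MultilinearMap ℂ (fun _ : Fin k => V) W}

theorem expSum₁_eq_sum_cons (x c : ℕ → V) (N : ℕ) : expSum₁ w x c N =
    ∑ k ∈ Finset.range N, ((k.factorial : ℂ)⁻¹) •
      ∑ i ∈ Finset.Nat.antidiagonalTuple (k + 1) N,
        w (k + 1) (Fin.cons (x (i 0)) fun a => c (i a.succ)) := by
  simp only [expSum₁, ser_cons, MultilinearMap.curryLeft_apply]

theorem apply_succ_lt_of_mem_antidiagonalTuple {k N : ℕ} {i : Fin (k + 1) → ℕ}
    (hi : i ∈ Finset.Nat.antidiagonalTuple (k + 1) N) (h : i 0 ≠ 0) (a : Fin k) :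
    i a.succ < N := by
  have h1 := Finset.Nat.mem_antidiagonalTuple.mp hi
  rw [Fin.sum_univ_succ] at h1
  have h2 : i a.succ ≤ ∑ b : Fin k, i b.succ :=
    Finset.single_le_sum (f := fun b : Fin k => i b.succ) (fun _ _ => Nat.zero_le _)
      (Finset.mem_univ a)
  omega

/-- Since `x` begins at order one, every copy of `c` enters below order `N`; this is the
triangularity required by `exists_flow`. -/
theorem expSum₁_congr_right {x c c' : ℕ → V} {N : ℕ} (hx : x 0 = 0) (h : ∀ j < N, c j = c' j) :
    expSum₁ w x c N = expSum₁ w x c' N := by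
  rw [expSum₁_eq_sum_cons, expSum₁_eq_sum_cons]
  refine Finset.sum_congr rfl fun k _ => congrArg _ (Finset.sum_congr rfl fun i hi => ?_)
  by_cases h0 : i 0 = 0
  · rw [(w (k + 1)).map_coord_zero 0 (by simp [h0, hx]),
      (w (k + 1)).map_coord_zero 0 (by simp [h0, hx])]
  · congr 2
    funext a
    exact h _ (apply_succ_lt_of_mem_antidiagonalTuple hi h0 a)

theorem expSum₁_mem (hw : ∀ (k : ℕ) (d : Fin k → ℤ) (c : Fin k → V), (∀ i, c i ∈ gr (d i)) →
    w k c ∈ S (∑ i, d i + 1)) {r : ℤ} {x c : ℕ → V} {N : ℕ} (hx0 : x 0 = 0)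
    (hx : ∀ j, x j ∈ gr r) (hc : ∀ j < N, c j ∈ gr 0) : expSum₁ w x c N ∈ S (r + 1) := by
  rw [expSum₁_eq_sum_cons]
  refine Submodule.sum_mem _ fun k _ => Submodule.smul_mem _ _ (Submodule.sum_mem _ fun i hi => ?_)
  by_cases h0 : i 0 = 0
  · rw [(w (k + 1)).map_coord_zero 0 (by simp [h0, hx0])]
    exact Submodule.zero_mem _
  · have := hw (k + 1) (Fin.cons r fun _ => 0) (Fin.cons (x (i 0)) fun a => c (i a.succ))
      fun a => by
        refine Fin.cases ?_ (fun b => ?_) a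
        · simpa using hx _
        · simpa using hc _ (apply_succ_lt_of_mem_antidiagonalTuple hi h0 b)
    simpa [Fin.sum_univ_succ] using this

theorem expSum_mem (hw : ∀ (k : ℕ) (d : Fin k → ℤ) (c : Fin k → V), (∀ i, c i ∈ gr (d i)) →
    w k c ∈ S (∑ i, d i + 1)) {c : ℕ → V} (hc : ∀ j, c j ∈ gr 0) (N : ℕ) :
    expSum w c N ∈ S 1 := by
  refine Submodule.sum_mem _ fun k _ => Submodule.smul_mem _ _ (Submodule.sum_mem _ fun i _ => ?_)
  have := hw k (fun _ => 0) (fun a => c (i a)) fun a => hc _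
  simpa using this

end ExpSumDegree

/-! ### Polynomial gauge flows of Maurer–Cartan elements -/

section LInftyFlow

variable {V : Type*} [AddCommGroup V] [Module ℂ V] {gr : ℤ → Submodule ℂ V}

theorem LInftyAlgebra.mem_MC_iff (L : LInftyAlgebra gr) {c : ℕ → V} : c ∈ L.toGradedOps.MC ↔
    c 0 = 0 ∧ (∀ N, c N ∈ gr 0) ∧ ∀ N, expSum L.l c N = 0 := by
  have : ∀ N, expSum L.l c N = ∑ k ∈ Finset.Icc 1 N, ((k.factorial : ℂ)⁻¹) •
      ∑ i ∈ Finset.Nat.antidiagonalTuple k N, L.l k fun a => c (i a) := fun N => by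
    rw [expSum_eq_add, L.l_zero, _root_.zero_apply, ite_self, zero_add]
    rfl
  simp only [this]
  rfl

/-- A polynomial solution `c` of the gauge flow equation with parameter `a`. -/
structure LInftyAlgebra.GaugeFlow (L : LInftyAlgebra gr) (c a : ℂ → ℕ → V) : Prop where
  deriv : ∀ N, PolyDeriv (fun t => c t N) fun t => expSum₁ L.l (a t) (c t) N
  isPolyFun : ∀ N, IsPolyFun fun t => a t N
  c_zero : ∀ t, c t 0 = 0
  a_zero : ∀ t, a t 0 = 0
  c_mem : ∀ t N, c t N ∈ gr 0
  a_mem : ∀ t N, a t N ∈ gr (-1)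

variable {L : LInftyAlgebra gr}

theorem LInftyAlgebra.GaugeFlow.gaugePath {c a : ℂ → ℕ → V} (h : L.GaugeFlow c a) :
    L.toGradedOps.GaugePath (c 0) (c 1) :=
  GradedOps.gaugePath_of_polyDeriv h.deriv h.isPolyFun h.c_zero h.a_zero h.c_mem h.a_mem
    fun _ _ => expSum₁_eq_sum_cons _ _ _

theorem LInftyAlgebra.exists_gaugeFlow_of_gaugePath {c₀ c₁ : ℕ → V}
    (h : L.toGradedOps.GaugePath c₀ c₁) : ∃ c a, L.GaugeFlow c a ∧ c 0 = c₀ ∧ c 1 = c₁ := by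
  obtain ⟨c, α, hc0, hα0, hc, hα, h0, h1, hd⟩ := h
  have hmem : ∀ (S : Submodule ℂ V) (p : ℕ →₀ V) (t : ℂ), (∀ j, p j ∈ S) →
      GradedOps.polyEval t p ∈ S := fun S p t hp =>
    Submodule.sum_mem _ fun j _ => Submodule.smul_mem _ _ (hp j)
  refine ⟨fun t N => GradedOps.polyEval t (c N), fun t N => GradedOps.polyEval t (α N), ?_,
    funext h0, funext h1⟩
  exact ⟨fun N => (PolyDeriv.polyDeriv_polyEval (c N)).congr (fun _ => rfl) fun t => by
      rw [hd, expSum₁_eq_sum_cons]; rfl,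
    fun N => (PolyDeriv.polyDeriv_polyEval (α N)).isPolyFun,
    fun t => by simp [hc0, GradedOps.polyEval], fun t => by simp [hα0, GradedOps.polyEval],
    fun t N => hmem _ _ t (hc N), fun t N => hmem _ _ t (hα N)⟩

variable (L) in
/-- The gauge flow of a parameter which does not depend on time. -/
theorem LInftyAlgebra.exists_gaugeFlow {c₀ β : ℕ → V} (hc0 : c₀ 0 = 0) (hβ0 : β 0 = 0)
    (hc : ∀ N, c₀ N ∈ gr 0) (hβ : ∀ N, β N ∈ gr (-1)) :
    ∃ c, L.GaugeFlow c (fun _ => β) ∧ c 0 = c₀ := by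
  obtain ⟨c, hd, hc'⟩ := exists_flow (fun c t N => expSum₁ L.l β (c t) N)
    (fun N c c' h t => expSum₁_congr_right hβ0 (h t))
    (fun c hc N => IsPolyFun.expSum₁ (x := fun _ => β) (fun N => IsPolyFun.const _) hc N) c₀
  refine ⟨c, ⟨hd, fun N => IsPolyFun.const _, fun t => ?_, fun _ => hβ0, fun t N => ?_,
    fun _ => hβ⟩, funext hc'⟩
  · rw [PolyDeriv.eq_of_zero ((hd 0).congr (fun _ => rfl) fun t => expSum₁_zero.symm) t, hc', hc0]
  · induction N using Nat.strong_induction_on generalizing t with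
    | h N ih =>
      refine (hd N).mem (fun t => ?_) (by rw [hc']; exact hc N) t
      exact expSum₁_mem (r := -1) L.l_degree hβ0 hβ fun j hj => ih j hj t

theorem LInftyAlgebra.GaugeFlow.coeff_eq {c c' : ℂ → ℕ → V} {β β' : ℕ → V}
    (h : L.GaugeFlow c fun _ => β) (h' : L.GaugeFlow c' fun _ => β') (h0 : c 0 = c' 0) {N : ℕ}
    (hβ : ∀ k < N, β k = β' k) : ∀ k < N, ∀ t, c t k = c' t k := by
  intro k hk
  induction k using Nat.strong_induction_on with
  | h k ih =>
    refine (h.deriv k).eq_of_eq ((h'.deriv k).congr (fun _ => rfl) fun t => ?_) (by rw [h0])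
    refine sub_eq_zero.mp ?_
    rw [expSum₁_sub (h.a_zero t) (h'.a_zero t) (h.c_zero t) (h'.c_zero t)
      (fun j hj => hβ j (hj.trans hk)) (fun j hj => ih j hj (hj.trans hk) t)]
    simp only [hβ k hk, sub_self]

theorem LInftyAlgebra.GaugeFlow.coeff_sub {c c' : ℂ → ℕ → V} {β β' : ℕ → V}
    (h : L.GaugeFlow c fun _ => β) (h' : L.GaugeFlow c' fun _ => β') (h0 : c 0 = c' 0) {N : ℕ}
    (hβ : ∀ k < N, β k = β' k) (t : ℂ) :
    c t N - c' t N = t • ((L.l 1 fun _ => β N) - L.l 1 fun _ => β' N) := by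
  refine PolyDeriv.eq_of_eq (((h.deriv N).sub (h'.deriv N)).congr (fun _ => rfl) fun t => ?_)
    (PolyDeriv.linear _) (by rw [h0, sub_self, zero_smul]) t
  rw [expSum₁_sub (h.a_zero t) (h'.a_zero t) (h.c_zero t) (h'.c_zero t) hβ
    fun j hj => h.coeff_eq h' h0 hβ j hj t]

theorem GradedSymm.eq_of_degree_zero {W : Type*} [AddCommGroup W] [Module ℂ W]
    {w : ∀ k, MultilinearMap ℂ (fun _ : Fin k => V) W}
    (hw : GradedSymm gr w) (k : ℕ) (σ : Equiv.Perm (Fin k)) (v : Fin k → V)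
    (hv : ∀ a, v a ∈ gr 0) : w k v = w k fun a => v (σ a) :=
  hw.eq_of_mul_eq_zero σ (fun _ => 0) v hv fun _ _ _ => mul_zero _

theorem LInftyAlgebra.GaugeFlow.deriv_mem {c a : ℂ → ℕ → V} (h : L.GaugeFlow c a) (t : ℂ) (N : ℕ) :
    expSum₁ L.l (a t) (c t) N ∈ gr 0 :=
  expSum₁_mem (r := -1) L.l_degree (h.a_zero t) (h.a_mem t) fun j _ => h.c_mem t j

theorem LInftyAlgebra.GaugeFlow.polyDeriv_expSum {W : Type*} [AddCommGroup W] [Module ℂ W]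
    {w : ∀ k, MultilinearMap ℂ (fun _ : Fin k => V) W}
    {c a : ℂ → ℕ → V} (h : L.GaugeFlow c a) (hw : GradedSymm gr w) (N : ℕ) :
    PolyDeriv (fun t => expSum w (c t) N)
      fun t => expSum₁ w (fun n => expSum₁ L.l (a t) (c t) n) (c t) N :=
  PolyDeriv.expSum (c' := fun t n => expSum₁ L.l (a t) (c t) n) hw.eq_of_degree_zero h.c_mem
    h.deriv_mem h.deriv N

/-- The gauge flow preserves Maurer–Cartan elements. -/
theorem LInftyAlgebra.GaugeFlow.mem_MC {c a : ℂ → ℕ → V} (h : L.GaugeFlow c a)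
    (h0 : c 0 ∈ L.toGradedOps.MC) (t : ℂ) : c t ∈ L.toGradedOps.MC := by
  rw [L.mem_MC_iff] at h0 ⊢
  refine ⟨h.c_zero t, h.c_mem t, fun N => ?_⟩
  induction N using Nat.strong_induction_on generalizing t with
  | h N ih =>
    have hd : PolyDeriv (fun t => expSum L.l (c t) N) fun _ => 0 :=
      -- By the linearized relation the derivative of the curvature is linear in the curvature, with
      -- parameter `a` of order at least one; so at order `N` it involves only curvature
      -- coefficients already known to vanish.
      (h.polyDeriv_expSum L.l_symm N).congr (fun _ => rfl) fun t => by
        have := L.quadRel.expSum₁_rel (h.a_mem t) (h.c_mem t) (h.a_zero t) (h.c_zero t) N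
        simp only [LinearMap.zero_apply, Finset.sum_const_zero, sub_zero, add_zero] at this
        rw [expSum₂_eq_zero (fun j hj => ih j hj t) (h.a_zero t) (h.c_zero t), add_zero] at this
        exact this.symm
    rw [hd.eq_of_zero t, h0.2.2]

end LInftyFlow

/-! ### Exponentials and leading coefficients of power series -/

section Exponential

open PowerSeries

variable {A : Type*} [Ring A]

theorem coeff_mul_eq_of_order_right {f U : A⟦X⟧} {N : ℕ} (hU : ∀ k < N, coeff k U = 0) :
    coeff N (f * U) = coeff 0 f * coeff N U := by
  rw [coeff_mul, Finset.sum_eq_single (0, N)]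
  · rintro ⟨i, j⟩ hij hne
    have hij' := Finset.HasAntidiagonal.mem_antidiagonal.mp hij
    simp only at hij' ⊢
    have : i ≠ 0 := by
      rintro rfl
      exact hne (by rw [zero_add] at hij'; rw [hij'])
    rw [hU j (by omega), mul_zero]
  · intro h
    exact absurd (Finset.HasAntidiagonal.mem_antidiagonal.mpr (zero_add N)) h

theorem coeff_mul_eq_of_order_left {f U : A⟦X⟧} {N : ℕ} (hU : ∀ k < N, coeff k U = 0) :
    coeff N (U * f) = coeff N U * coeff 0 f := by
  rw [coeff_mul, Finset.sum_eq_single (N, 0)]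
  · rintro ⟨i, j⟩ hij hne
    have hij' := Finset.HasAntidiagonal.mem_antidiagonal.mp hij
    simp only at hij' ⊢
    have : j ≠ 0 := by
      rintro rfl
      exact hne (by rw [add_zero] at hij'; rw [hij'])
    rw [hU i (by omega), zero_mul]
  · intro h
    exact absurd (Finset.HasAntidiagonal.mem_antidiagonal.mpr (add_zero N)) h

theorem coeff_mul_congr {f f' h h' : A⟦X⟧} {N : ℕ} (hf : ∀ k ≤ N, coeff k f = coeff k f')
    (hh : ∀ k ≤ N, coeff k h = coeff k h') : coeff N (f * h) = coeff N (f' * h') := by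
  rw [coeff_mul, coeff_mul]
  refine Finset.sum_congr rfl fun p hp => ?_
  have := Finset.HasAntidiagonal.mem_antidiagonal.mp hp
  rw [hf _ (by omega), hh _ (by omega)]

theorem coeff_mul_sub_of_order_right {f h h' : A⟦X⟧} {N : ℕ}
    (hh : ∀ k < N, coeff k h = coeff k h') :
    coeff N (f * h) - coeff N (f * h') = coeff 0 f * (coeff N h - coeff N h') := by
  rw [← map_sub, ← mul_sub, coeff_mul_eq_of_order_right, map_sub]
  intro k hk
  rw [map_sub, hh k hk, sub_self]

theorem coeff_mul_sub_of_order_left {f f' h : A⟦X⟧} {N : ℕ}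
    (hf : ∀ k < N, coeff k f = coeff k f') :
    coeff N (f * h) - coeff N (f' * h) = (coeff N f - coeff N f') * coeff 0 h := by
  rw [← map_sub, ← sub_mul, coeff_mul_eq_of_order_left, map_sub]
  intro k hk
  rw [map_sub, hf k hk, sub_self]

variable [Algebra ℂ A] {g : Submodule ℂ A}

theorem exists_exp (hg : ∀ s ∈ g, ∀ a ∈ g, s * a - a * s ∈ g) {a : A⟦X⟧} (ha0 : coeff 0 a = 0)
    (ha : CoeffsIn g a) : ∃ φ : ℂ → A⟦X⟧, SeriesDeriv φ (fun t => φ t * a) ∧ φ 0 = 1 ∧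
      ∀ t, IsGroupLike g (φ t) :=
  exists_holonomy hg (SeriesDeriv.const a).isPolySeries (fun _ => ha0) fun _ => ha

open Classical in
/-- The exponential of a power series without constant coefficient and with coefficients in the Lie
subalgebra `g`, as the holonomy of a constant path. -/
def expSeries (hg : ∀ s ∈ g, ∀ a ∈ g, s * a - a * s ∈ g) (a : A⟦X⟧) : A⟦X⟧ :=
  if h : coeff 0 a = 0 ∧ CoeffsIn g a then (exists_exp hg h.1 h.2).choose 1 else 1

theorem isGroupLike_expSeries (hg : ∀ s ∈ g, ∀ a ∈ g, s * a - a * s ∈ g) (a : A⟦X⟧) :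
    IsGroupLike g (expSeries hg a) := by
  unfold expSeries
  split_ifs with h
  · exact (exists_exp hg h.1 h.2).choose_spec.2.2 1
  · exact IsGroupLike.one

theorem expSeries_coeff_sub (hg : ∀ s ∈ g, ∀ a ∈ g, s * a - a * s ∈ g) {a a' : A⟦X⟧}
    (ha0 : coeff 0 a = 0) (ha : CoeffsIn g a) (ha0' : coeff 0 a' = 0) (ha' : CoeffsIn g a')
    {N : ℕ} (hN : N ≠ 0) (h : ∀ k < N, coeff k a = coeff k a') :
    coeff N (expSeries hg a) - coeff N (expSeries hg a') = coeff N a - coeff N a' := by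
  obtain ⟨h1, h2, -⟩ := (exists_exp hg ha0 ha).choose_spec
  obtain ⟨h1', h2', -⟩ := (exists_exp hg ha0' ha').choose_spec
  have := holonomy_coeff_sub h1 h1' h2 h2' (fun _ => ha0) (fun _ => ha0') hN
    (fun k hk _ => h k hk) (fun _ => rfl) 1
  rw [one_smul] at this
  rw [expSeries, expSeries, dif_pos ⟨ha0, ha⟩, dif_pos ⟨ha0', ha'⟩, this]

theorem expSeries_coeff_congr (hg : ∀ s ∈ g, ∀ a ∈ g, s * a - a * s ∈ g) {a a' : A⟦X⟧}
    (ha0 : coeff 0 a = 0) (ha : CoeffsIn g a) (ha0' : coeff 0 a' = 0) (ha' : CoeffsIn g a')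
    {N : ℕ} (h : ∀ k < N, coeff k a = coeff k a') :
    ∀ k < N, coeff k (expSeries hg a) = coeff k (expSeries hg a') := by
  intro k hk
  rcases Nat.eq_zero_or_pos k with rfl | hk0
  · rw [(isGroupLike_expSeries hg a).constCoeff, (isGroupLike_expSeries hg a').constCoeff]
  · rw [← sub_eq_zero, expSeries_coeff_sub hg ha0 ha ha0' ha' hk0.ne' fun j hj => h j (hj.trans hk),
      h k hk, sub_self]

/-- A constant `M` commuting with `a` solves `M' = M a - a M`, so the holonomy intertwines `M` with
itself. -/
theorem expSeries_commute (hg : ∀ s ∈ g, ∀ a ∈ g, s * a - a * s ∈ g) {a M : A⟦X⟧}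
    (h : M * a = a * M) : M * expSeries hg a = expSeries hg a * M := by
  unfold expSeries
  split_ifs with h'
  · obtain ⟨h1, h2, -⟩ := (exists_exp hg h'.1 h'.2).choose_spec
    set φ := (exists_exp hg h'.1 h'.2).choose
    refine (holonomy_intertwines (M := fun _ => M) (a := fun _ => a) (fun n =>
      (SeriesDeriv.const M n).congr (fun _ => rfl) fun t => ?_) h1 h2 (fun _ => h'.1) 1).symm
    rw [h, sub_self]
  · rw [mul_one, one_mul]

end Exponential

/-! ### The map of Maurer–Cartan elements defined by an open-closed homotopy algebra -/

section OpenClosedMap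

open PowerSeries

variable {Hc : Type*} [AddCommGroup Hc] [Module ℂ Hc] {grc : ℤ → Submodule ℂ Hc}
  {Ho : Type*} [AddCommGroup Ho] [Module ℂ Ho] {gro : ℤ → Submodule ℂ Ho}

theorem OCHA.single_add_perturbation (H : OCHA grc gro) {m : Multi Ho}
    (hm : ∀ q, H.n 0 q Fin.elim0 = m q) (c : ℕ → Hc) :
    Pi.single 0 m + H.perturbation c = expSum H.family c := by
  funext N
  rw [expSum_eq_add, Pi.add_apply]
  congr 1
  rcases N with _ | N
  · rw [Pi.single_eq_same, if_pos rfl]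
    exact (funext hm).symm
  · rw [Pi.single_eq_of_ne (Nat.succ_ne_zero N), if_neg (Nat.succ_ne_zero N)]

theorem OCHA.family_degree (H : OCHA grc gro) (k : ℕ) (d : Fin k → ℤ) (c : Fin k → Hc)
    (hc : ∀ i, c i ∈ grc (d i)) : H.family k c ∈ homDeg gro (∑ i, d i + 1) := H.nStar_mem hc

variable [DirectSum.Decomposition gro] (H : OCHA grc gro)

theorem OCHA.expSum_family_rel {c : ℕ → Hc} (hc : c ∈ H.toLInftyAlgebra.toGradedOps.MC) (N : ℕ) :
    ∑ p ∈ Finset.HasAntidiagonal.antidiagonal N,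
      circ gro 1 (expSum H.family c p.1) (expSum H.family c p.2) = 0 := by
  rw [LInftyAlgebra.mem_MC_iff] at hc
  have := H.quadRel.expSum_rel hc.2.1 hc.1 N
  rwa [show expSum H.l c = fun _ => 0 from funext hc.2.2, expSum₁_zero_left, zero_add] at this

theorem OCHA.isWeakAInftyDeformation {m : Multi Ho} (hm : ∀ q, H.n 0 q Fin.elim0 = m q)
    {c : ℕ → Hc} (hc : c ∈ H.toLInftyAlgebra.toGradedOps.MC) :
    IsWeakAInftyDeformation gro m (Pi.single 0 m + H.perturbation c) := by
  rw [H.single_add_perturbation hm]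
  have hc' := (LInftyAlgebra.mem_MC_iff _).mp hc
  refine ⟨?_, expSum_mem H.family_degree hc'.2.1, H.expSum_family_rel hc⟩
  rw [expSum_zero]
  exact funext hm

/-- The open-closed map turns gauge flows into conjugations by group-like power series. -/
theorem OCHA.exists_holonomy_of_gaugeFlow {c a : ℂ → ℕ → Hc}
    (h : H.toLInftyAlgebra.GaugeFlow c a) (h0 : c 0 ∈ H.toLInftyAlgebra.toGradedOps.MC) :
    ∃ φ : ℂ → (EndMulti Ho)⟦X⟧,
      SeriesDeriv φ (fun t => φ t * rightSeries gro 0 (expSum₁ H.family (a t) (c t))) ∧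
      φ 0 = 1 ∧ (∀ t, IsGroupLike (rightSub gro 0) (φ t)) ∧
      ∀ t, φ t * rightSeries gro 1 (expSum H.family (c t)) =
        rightSeries gro 1 (expSum H.family (c 0)) * φ t := by
  have hXd : ∀ t N, expSum₁ H.family (a t) (c t) N ∈ homDeg gro 0 := fun t N =>
    expSum₁_mem (r := -1) H.family_degree (h.a_zero t) (h.a_mem t) fun j _ => h.c_mem t j
  have hMd : ∀ t N, expSum H.family (c t) N ∈ homDeg gro 1 := fun t =>
    expSum_mem H.family_degree (h.c_mem t)
  have hD : SeriesDeriv (fun t => rightSeries gro 1 (expSum H.family (c t))) fun t =>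
      rightSeries gro 1 (expSum H.family (c t)) *
        rightSeries gro 0 (expSum₁ H.family (a t) (c t)) -
      rightSeries gro 0 (expSum₁ H.family (a t) (c t)) *
        rightSeries gro 1 (expSum H.family (c t)) := fun N => by
    refine ((h.polyDeriv_expSum H.quadRel.w_symm N).map (rightMul gro 1)).congr
      (fun t => coeff_rightSeries _ _ _ _) fun t => ?_
    rw [coeff_rightSeries_commutator gro (hMd t) (hXd t)]
    congr 1
    have hrel := H.quadRel.expSum₁_rel (h.a_mem t) (h.c_mem t) (h.a_zero t) (h.c_zero t) N
    have hMC := (LInftyAlgebra.mem_MC_iff _).mp (h.mem_MC h0 t)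
    -- The curvature of `c t` vanishes along the flow, which removes the only term of the linearized
    -- relation that is not part of the commutator.
    rw [expSum₂_eq_zero (fun j _ => hMC.2.2 j) (h.a_zero t) (h.c_zero t), add_zero] at hrel
    rw [eq_neg_of_add_eq_zero_left hrel, neg_sub, Finset.sum_sub_distrib]
    congr 1
    exact Finset.Nat.sum_antidiagonal_swap (f := fun p =>
      circ gro 0 (expSum H.family (c t) p.1) (expSum₁ H.family (a t) (c t) p.2))
  have hX0 : ∀ t, coeff 0 (rightSeries gro 0 (expSum₁ H.family (a t) (c t))) = 0 := fun t => by
    rw [coeff_rightSeries, expSum₁_zero, map_zero]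
  obtain ⟨φ, hφ, hφ0, hφg⟩ := exists_holonomy (rightSub_commutator_even gro)
    (α := fun t => rightSeries gro 0 (expSum₁ H.family (a t) (c t)))
    (fun N => by
      simp only [coeff_rightSeries]
      exact (IsPolyFun.expSum₁ h.isPolyFun (fun N => (h.deriv N).isPolyFun) N).map _)
    hX0 fun t => coeffsIn_rightSeries gro (hXd t)
  exact ⟨φ, hφ, hφ0, hφg, holonomy_intertwines hD hφ hφ0 hX0⟩

theorem OCHA.intertwined_of_gaugePath {c₀ c₁ : ℕ → Hc}
    (h0 : c₀ ∈ H.toLInftyAlgebra.toGradedOps.MC)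
    (h : H.toLInftyAlgebra.toGradedOps.GaugePath c₀ c₁) :
    Intertwined gro (expSum H.family c₀) (expSum H.family c₁) := by
  obtain ⟨c, a, hca, rfl, rfl⟩ := LInftyAlgebra.exists_gaugeFlow_of_gaugePath h
  obtain ⟨φ, -, -, hφ, e⟩ := H.exists_holonomy_of_gaugeFlow hca h0
  exact ⟨φ 1, hφ 1, e 1⟩

theorem OCHA.intertwined_of_gaugeSetoid {c₀ c₁ : H.toLInftyAlgebra.toGradedOps.MC}
    (h : H.toLInftyAlgebra.toGradedOps.gaugeSetoid c₀ c₁) :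
    Intertwined gro (expSum H.family c₀.1) (expSum H.family c₁.1) := by
  change Relation.EqvGen _ _ _ at h
  induction h with
  | rel x y h => exact H.intertwined_of_gaugePath x.2 h
  | refl x => exact Intertwined.refl gro _
  | symm x y _ ih => exact Intertwined.symm gro ih
  | trans x y z _ _ ih ih' => exact Intertwined.trans gro ih ih'

end OpenClosedMap

/-! ### The complexes of unary operations -/

section Unary

variable {V W : Type*} [AddCommGroup V] [Module ℂ V] [AddCommGroup W] [Module ℂ W]

/-- The linear map of a multilinear map in one variable. -/
def unary (f : MultilinearMap ℂ (fun _ : Fin 1 => V) W) : V →ₗ[ℂ] W :=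
  (MultilinearMap.ofSubsingleton ℂ V W (0 : Fin 1)).symm f

theorem unary_apply (f : MultilinearMap ℂ (fun _ : Fin 1 => V) W) (x : V) :
    unary f x = f fun _ => x := rfl

end Unary

/-! ### The Hochschild differential as a commutator, and the obstruction step -/

section Complexes

variable {Hc : Type*} [AddCommGroup Hc] [Module ℂ Hc] {grc : ℤ → Submodule ℂ Hc}
  {Ho : Type*} [AddCommGroup Ho] [Module ℂ Ho] {gro : ℤ → Submodule ℂ Ho}
  [DirectSum.Decomposition gro]

variable (gro) in
theorem hochschildOps_diff (m : Multi Ho) (r : ℤ) (y : Multi Ho) :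
    (hochschildOps gro m).diff r y = -bracket gro 1 (r + 1) m y := rfl

variable (gro) in
theorem hochschildOps_diff_zero (m y : Multi Ho) :
    (hochschildOps gro m).diff 0 y = -(circ gro 1 m y + circ gro 1 y m) := by
  rw [hochschildOps_diff, bracket]
  norm_num

variable (gro) in
theorem hochschildOps_diff_neg_one (m y : Multi Ho) :
    (hochschildOps gro m).diff (-1) y = circ gro 1 y m - circ gro 0 m y := by
  rw [hochschildOps_diff, bracket]
  norm_num

variable (gro) in
theorem hochschildOps_diff_neg_two (m y : Multi Ho) :
    (hochschildOps gro m).diff (-2) y = -(circ gro 1 m y + circ gro 1 y m) := by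
  rw [hochschildOps_diff, bracket, circ_congr_of_even gro (r := -2 + 1) (r' := 1) (by decide)]
  norm_num

variable (gro) in
theorem rightMul_diff_neg_one {m y : Multi Ho} (hm : m ∈ homDeg gro 1) (hy : y ∈ homDeg gro 0) :
    rightMul gro 1 ((hochschildOps gro m).diff (-1) y) =
      rightMul gro 1 m * rightMul gro 0 y - rightMul gro 0 y * rightMul gro 1 m := by
  rw [hochschildOps_diff_neg_one, rightMul_odd gro hm hy]

variable (gro) in
theorem rightMul_diff_neg_two {m y : Multi Ho} (hm : m ∈ homDeg gro 1) (hy : y ∈ homDeg gro (-1)) :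
    rightMul gro 0 ((hochschildOps gro m).diff (-2) y) =
      -(rightMul gro 1 m * rightMul gro 1 y + rightMul gro 1 y * rightMul gro 1 m) := by
  rw [hochschildOps_diff_neg_two, map_neg, rightMul_add gro hy hm (by decide) odd_one,
    add_comm (circ gro 1 m y)]

variable (gro) in
theorem rightMul_diff_zero {m y : Multi Ho} (hm : m ∈ homDeg gro 1) (hy : y ∈ homDeg gro 1) :
    rightMul gro 0 ((hochschildOps gro m).diff 0 y) =
      -(rightMul gro 1 m * rightMul gro 1 y + rightMul gro 1 y * rightMul gro 1 m) := by
  rw [hochschildOps_diff_zero, map_neg, rightMul_add gro hy hm odd_one odd_one,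
    add_comm (circ gro 1 m y)]

variable (gro) in
theorem hochschildOps_diff_add (m : Multi Ho) (r : ℤ) (y y' : Multi Ho) :
    (hochschildOps gro m).diff r (y + y') =
      (hochschildOps gro m).diff r y + (hochschildOps gro m).diff r y' := by
  simp only [hochschildOps_diff, bracket, ← circBilin_apply, map_add, LinearMap.add_apply, smul_add]
  abel

variable (gro) in
theorem hochschildOps_diff_neg (m : Multi Ho) (r : ℤ) (y : Multi Ho) :
    (hochschildOps gro m).diff r (-y) = -(hochschildOps gro m).diff r y := by
  simp only [hochschildOps_diff, bracket, ← circBilin_apply, map_neg, LinearMap.neg_apply, smul_neg]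
  abel

variable (gro) in
theorem hochschildOps_diff_sub (m : Multi Ho) (r : ℤ) (y y' : Multi Ho) :
    (hochschildOps gro m).diff r (y - y') =
      (hochschildOps gro m).diff r y - (hochschildOps gro m).diff r y' := by
  rw [sub_eq_add_neg, hochschildOps_diff_add, hochschildOps_diff_neg, sub_eq_add_neg]

/-- A closed element whose image is exact up to a given cochain: the obstruction step shared by the
surjectivity and the injectivity on moduli spaces. -/
theorem exists_of_isQuasiIso {L : LInftyAlgebra grc} {m : Multi Ho} {f : Hc →ₗ[ℂ] Multi Ho}
    (hf : L.toGradedOps.IsQuasiIso (hochschildOps gro m) f) {r : ℤ} {z : Hc} (hz : z ∈ grc (r + 1))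
    (hlz : unary (L.l 1) z = 0) {y : Multi Ho} (hy : y ∈ homDeg gro (r + 1))
    (h : f z = (hochschildOps gro m).diff r y) :
    ∃ w ∈ grc r, z = unary (L.l 1) w ∧ ∃ v ∈ grc r, unary (L.l 1) v = 0 ∧
      ∃ q ∈ homDeg gro r, y - f w - f v = (hochschildOps gro m).diff (r - 1) q := by
  obtain ⟨hdeg, hchain, hinj, hsurj⟩ := hf
  obtain ⟨w, hw, hzw⟩ := hinj (r + 1) z hz hlz ⟨y, by rw [add_sub_cancel_right]; exact hy,
    by rw [add_sub_cancel_right]; exact h⟩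
  rw [add_sub_cancel_right] at hw
  have hzw' : z = unary (L.l 1) w := hzw
  have hclosed : (hochschildOps gro m).diff r (y - f w) = 0 := by
    rw [hochschildOps_diff_sub, ← h, ← hchain r w hw, sub_eq_zero, hzw]
    rfl
  obtain ⟨v, hv, hlv, q, hq, e⟩ := hsurj r (y - f w) ((homDeg gro (r + 1)).sub_mem hy (hdeg r w hw))
    hclosed
  refine ⟨w, hw, hzw', v, hv, hlv, q, ?_, e⟩
  have : q ∈ homDeg gro (r - 1 + 1) := hq
  rwa [sub_add_cancel] at this

end Complexes

/-! ### Surjectivity on moduli spaces -/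

section Surjectivity

open PowerSeries

variable {Hc : Type*} [AddCommGroup Hc] [Module ℂ Hc] {grc : ℤ → Submodule ℂ Hc}
  {Ho : Type*} [AddCommGroup Ho] [Module ℂ Ho] {gro : ℤ → Submodule ℂ Ho}
  [DirectSum.Decomposition gro]

theorem expSum_congr {V W : Type*} [AddCommGroup V] [Module ℂ V] [AddCommGroup W] [Module ℂ W]
    {w : ∀ k : ℕ, MultilinearMap ℂ (fun _ : Fin k => V) W} {c c' : ℕ → V} {N : ℕ}
    (h : ∀ j ≤ N, c j = c' j) : expSum w c N = expSum w c' N :=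
  Finset.sum_congr rfl fun k _ => by rw [ser_congr (w k) fun _ => h]

/-- The sequence with the given terms in positive degrees, starting with zero. -/
def tailSeq {V : Type*} [AddCommGroup V] [Module ℂ V] {S : Submodule ℂ V} (s : ℕ → S) (N : ℕ) : V :=
  if N = 0 then 0 else s N

section TailSeq

variable {V : Type*} [AddCommGroup V] [Module ℂ V] {S : Submodule ℂ V} (s : ℕ → S)

theorem tailSeq_zero : tailSeq s 0 = 0 := if_pos rfl

theorem tailSeq_of_ne {N : ℕ} (hN : N ≠ 0) : tailSeq s N = s N := if_neg hN

theorem tailSeq_mem (N : ℕ) : tailSeq s N ∈ S := by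
  unfold tailSeq
  split_ifs
  · exact S.zero_mem
  · exact (s N).2

theorem tailSeq_congr {s s' : ℕ → S} {N : ℕ} (h : s N = s' N) : tailSeq s N = tailSeq s' N := by
  unfold tailSeq
  rw [h]

end TailSeq

/-- If the Maurer–Cartan equation for `c` and the intertwining relation with `P` hold to order `N`,
then the defects in order `N` are related by the differential. -/
theorem OCHA.family_curvature_eq (H : OCHA grc gro) {m : Multi Ho}
    (hm : m ∈ homDeg gro 1) (hmA : H.family 0 Fin.elim0 = m) {c : ℕ → Hc} (hc : ∀ N, c N ∈ grc 0)
    (hc0 : c 0 = 0) {g P : (EndMulti Ho)⟦X⟧} (hg : IsGroupLike (rightSub gro 0) g)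
    (hP : CoeffsIn (rightSub gro 1) P) (hPP : P * P = 0) (hP0 : coeff 0 P = rightMul gro 1 m)
    {N : ℕ} (hE : ∀ k < N, expSum H.l c k = 0)
    (hD : ∀ k < N, coeff k (g * rightSeries gro 1 (expSum H.family c)) = coeff k (P * g)) :
    ∃ δ ∈ homDeg gro 1, coeff N (P * g) - coeff N (g * rightSeries gro 1 (expSum H.family c)) =
        rightMul gro 1 δ ∧
      unary (H.family 1) (expSum H.l c N) = (hochschildOps gro m).diff 0 (-δ) := by
  set M := rightSeries gro 1 (expSum H.family c) with hM
  have hMd : ∀ N, expSum H.family c N ∈ homDeg gro 1 := expSum_mem H.family_degree hc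
  set D := coeff N (P * g) - coeff N (g * M) with hDdef
  -- `U` has the same leading coefficient at order `N` as `P g - g M`, but is a difference of two
  -- series of degree-one right multiplications. Hence the defect is `R_δ` for a family `δ`.
  set U := seriesInv g * P * g - M with hU
  have hU' : U = seriesInv g * (P * g - g * M) := by
    rw [hU, mul_sub, ← mul_assoc, ← mul_assoc, seriesInv_mul hg.constCoeff, one_mul]
  have hlow : ∀ k < N, coeff k (P * g - g * M) = 0 := fun k hk => by
    rw [map_sub, hD k hk, sub_self]
  have hUlow : ∀ k < N, coeff k U = 0 := fun k hk => by
    rw [hU', coeff_mul_eq_of_order_right fun j hj => hlow j (hj.trans hk), hlow k hk, mul_zero]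
  have hUN : coeff N U = D := by
    rw [hU', coeff_mul_eq_of_order_right hlow, coeff_zero_seriesInv, one_mul, map_sub]
  have hDmem : D ∈ rightSub gro 1 := by
    rw [← hUN, hU, map_sub]
    exact Submodule.sub_mem _ (hg.inv_mul_mul_mem (rightSub_commutator_odd gro) hP N)
      (coeffsIn_rightSeries gro hMd N)
  obtain ⟨δ, hδ, hδD⟩ := hDmem
  refine ⟨δ, hδ, hδD.symm, rightMul_injective gro 0 ?_⟩
  have hM0 : coeff 0 M = rightMul gro 1 m := by
    rw [hM, coeff_rightSeries, expSum_zero, hmA]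
  have hQ0 : coeff 0 (seriesInv g * P * g) = rightMul gro 1 m := by
    rw [coeff_zero_mul', coeff_zero_mul', coeff_zero_seriesInv, hg.constCoeff, one_mul, mul_one, hP0]
  have hQQ : (seriesInv g * P * g) * (seriesInv g * P * g) = 0 := by
    rw [mul_assoc _ g, ← mul_assoc g, ← mul_assoc g, mul_seriesInv hg.constCoeff, one_mul,
      ← mul_assoc, mul_assoc _ P P, hPP, mul_zero, zero_mul]
  -- With `Q = g⁻¹ P g`, the equation `Q * Q = 0` expresses the square of `M` linearly in `U`. At
  -- order `N` this is `-(R_m R_δ + R_δ R_m)`, which is the differential of `δ`; the curvature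
  -- identity equates the image of the Maurer–Cartan defect with its negative.
  have hMM : M * M = -((seriesInv g * P * g) * U) - U * M := by
    have : M = seriesInv g * P * g - U := by rw [hU]; abel
    rw [show M * M = (seriesInv g * P * g) * (seriesInv g * P * g) - (seriesInv g * P * g) * U -
      U * M by nth_rewrite 1 [this]; rw [sub_mul, ← mul_sub, ← this], hQQ, zero_sub]
  have hMMN : coeff N (M * M) =
      -(rightMul gro 1 m * rightMul gro 1 δ + rightMul gro 1 δ * rightMul gro 1 m) := by
    rw [hMM, map_sub, map_neg, coeff_mul_eq_of_order_right hUlow, coeff_mul_eq_of_order_left hUlow,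
      hUN, hQ0, hM0, hδD, neg_add, sub_eq_add_neg]
  have hrel := H.quadRel.expSum_rel hc hc0 N
  rw [expSum₁_eq_of_order hE (H.quadRel.expSum_l_zero c) hc0] at hrel
  rw [unary_apply, eq_neg_of_add_eq_zero_left hrel, map_neg, hochschildOps_diff_neg, map_neg,
    rightMul_diff_zero gro hm hδ, neg_neg]
  simp only [circBilin_apply]
  rw [← coeff_rightSeries_mul_self gro hMd, hMMN, neg_neg]

/-- The unknowns at order `N` are `c_N` and `w_N`, with `g = exp(R_w)`. The Maurer–Cartan defect is
`l_1`-closed and its image is exact through the intertwining defect, so injectivity on cohomology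
makes it exact and surjectivity corrects the remaining cocycle. -/
theorem OCHA.exists_MC_intertwined (H : OCHA grc gro) (A : AInftyAlgebra gro)
    (hA : ∀ q, H.n 0 q Fin.elim0 = A.m q)
    (hf : GradedOps.IsQuasiIso H.toLInftyAlgebra.toGradedOps (hochschildOps gro A.m)
      (unary (H.family 1)))
    {θ : ℕ → Multi Ho} (hθ : θ ∈ (hochschildOps gro A.m).MC) :
    ∃ c ∈ H.toLInftyAlgebra.toGradedOps.MC,
      Intertwined gro (Pi.single 0 A.m + θ) (expSum H.family c) := by
  have hmA : H.family 0 Fin.elim0 = A.m := funext hA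
  obtain ⟨hθ0, hθd, hθr⟩ := (mem_hochschildOps_MC_iff gro A θ).mp hθ
  set P := rightSeries gro 1 (Pi.single 0 A.m + θ) with hP
  have hPP : P * P = 0 := rightSeries_mul_self gro hθd hθr
  have hP0 : coeff 0 P = rightMul gro 1 A.m := by rw [hP, coeff_rightSeries, hθ0]
  let cs : (ℕ → grc 0 × homDeg gro 0) → ℕ → Hc := fun s => tailSeq fun N => (s N).1
  let ws : (ℕ → grc 0 × homDeg gro 0) → ℕ → Multi Ho := fun s => tailSeq fun N => (s N).2
  let gs : (ℕ → grc 0 × homDeg gro 0) → (EndMulti Ho)⟦X⟧ := fun s =>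
    expSeries (rightSub_commutator_even gro) (rightSeries gro 0 (ws s))
  have hcs : ∀ s N, cs s N ∈ grc 0 := fun s => tailSeq_mem _
  have hcs0 : ∀ s, cs s 0 = 0 := fun s => tailSeq_zero _
  have hw0 : ∀ s, coeff 0 (rightSeries gro 0 (ws s)) = 0 := fun s => by
    rw [coeff_rightSeries]
    simp only [ws]
    rw [tailSeq_zero, map_zero]
  have hwg : ∀ s, CoeffsIn (rightSub gro 0) (rightSeries gro 0 (ws s)) := fun s =>
    coeffsIn_rightSeries gro (tailSeq_mem _)
  have hgs : ∀ s, IsGroupLike (rightSub gro 0) (gs s) := fun s => isGroupLike_expSeries _ _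
  have hcs_congr : ∀ {s s' : ℕ → grc 0 × homDeg gro 0} {k : ℕ}, s k = s' k → cs s k = cs s' k :=
    fun h => tailSeq_congr (congrArg Prod.fst h)
  have hws_congr : ∀ {s s' : ℕ → grc 0 × homDeg gro 0} {k : ℕ}, s k = s' k → ws s k = ws s' k :=
    fun h => tailSeq_congr (congrArg Prod.snd h)
  have hgs_congr : ∀ {s s' : ℕ → grc 0 × homDeg gro 0} {N : ℕ}, (∀ k < N, s k = s' k) →
      ∀ k < N, coeff k (gs s) = coeff k (gs s') := fun {s s' N} h =>
    expSeries_coeff_congr _ (hw0 s) (hwg s) (hw0 s') (hwg s') fun k hk => by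
      rw [coeff_rightSeries, coeff_rightSeries, hws_congr (h k hk)]
  obtain ⟨s, hs⟩ := exists_seq
    (fun N s => expSum H.l (cs s) N = 0 ∧
      coeff N (gs s * rightSeries gro 1 (expSum H.family (cs s))) = coeff N (P * gs s))
    (fun N s s' h h' => by
      -- The conditions at order `N` involve only terms up to `N`, since coefficients of `exp`
      -- depend only on coefficients of no higher order.
      have hg' : ∀ k ≤ N, coeff k (gs s) = coeff k (gs s') := fun k hk =>
        hgs_congr (N := N + 1) (fun j hj => h j (by omega)) k (by omega)
      have hc' : ∀ k ≤ N, cs s k = cs s' k := fun k hk => hcs_congr (h k hk)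
      refine ⟨by rw [← expSum_congr hc']; exact h'.1, ?_⟩
      rw [← coeff_mul_congr hg' (fun k hk => ?_), h'.2, coeff_mul_congr (fun k _ => rfl) hg']
      rw [coeff_rightSeries, coeff_rightSeries, expSum_congr fun j hj => hc' j (hj.trans hk)])
    (fun N s hgood => by
      rcases Nat.eq_zero_or_pos N with rfl | hN
      -- Order zero is automatic: `tailSeq` discards this term, `g` starts with 1, and both series
      -- start with `R_m`.
      · refine ⟨s 0, H.quadRel.expSum_l_zero _, ?_⟩
        rw [coeff_zero_mul', coeff_zero_mul', (hgs _).constCoeff, one_mul, mul_one, hP0,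
          coeff_rightSeries, expSum_zero, hmA]
      · obtain ⟨δ, hδ, hδD, hfE⟩ := H.family_curvature_eq A.m_degree hmA (hcs s) (hcs0 s) (hgs s)
          (coeffsIn_rightSeries gro hθd) hPP hP0 (fun k hk => (hgood k hk).1)
          fun k hk => (hgood k hk).2
        have hE : expSum H.l (cs s) N ∈ grc 1 := expSum_mem H.l_degree (hcs s) N
        have hlE : unary (H.l 1) (expSum H.l (cs s) N) = 0 := by
          have := H.toLInftyAlgebra.quadRel.expSum_rel (hcs s) (hcs0 s) N
          simp only [LinearMap.zero_apply, Finset.sum_const_zero, add_zero] at this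
          rwa [expSum₁_eq_of_order (fun k hk => (hgood k hk).1) (H.quadRel.expSum_l_zero _)
            (hcs0 s)] at this
        obtain ⟨w, hw, hEw, v, hv, hlv, q, hq, hdq⟩ := exists_of_isQuasiIso hf (r := 0)
          hE hlE ((homDeg gro 1).neg_mem hδ) hfE
        -- Subtracting `w` from `c_N` removes the curvature `l_1 w`. The closed `v` leaves it
        -- unchanged and, together with adding `q` to `w_N`, cancels the remaining intertwining
        -- defect.
        refine ⟨(⟨(s N).1 - w - v, Submodule.sub_mem _ (Submodule.sub_mem _ (s N).1.2 hw) hv⟩,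
          ⟨(s N).2 + q, Submodule.add_mem _ (s N).2.2 hq⟩), ?_⟩
        set s' := Function.update s N _ with hs'
        have hlt : ∀ k < N, s k = s' k := fun k hk => by
          rw [hs', Function.update_of_ne hk.ne]
        have hcN : cs s' N = cs s N - w - v := by
          simp only [cs, tailSeq_of_ne _ hN.ne', hs', Function.update_self]
        have hwN : ws s' N = ws s N + q := by
          simp only [ws, tailSeq_of_ne _ hN.ne', hs', Function.update_self]
        have hclt : ∀ k < N, cs s' k = cs s k := fun k hk => (hcs_congr (hlt k hk)).symm
        have hE' : expSum H.l (cs s') N = 0 := by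
          have := expSum_sub (w := H.l) (hcs0 s') (hcs0 s) hclt
          rw [← unary_apply, ← unary_apply, ← map_sub, hcN, hEw, map_sub, map_sub, map_sub, hlv,
            sub_zero, sub_sub_cancel_left] at this
          rwa [sub_eq_neg_self] at this
        refine ⟨hE', ?_⟩
        have hgN : coeff N (gs s') - coeff N (gs s) = rightMul gro 0 q := by
          rw [expSeries_coeff_sub _ (hw0 s') (hwg s') (hw0 s) (hwg s) hN.ne' (fun k hk => by
            rw [coeff_rightSeries, coeff_rightSeries, hws_congr (hlt k hk)]), coeff_rightSeries,
            coeff_rightSeries, ← map_sub, hwN, add_sub_cancel_left]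
        have hglt : ∀ k < N, coeff k (gs s') = coeff k (gs s) := fun k hk =>
          (hgs_congr hlt k hk).symm
        have hMlt : ∀ k < N, coeff k (rightSeries gro 1 (expSum H.family (cs s'))) =
            coeff k (rightSeries gro 1 (expSum H.family (cs s))) := fun k hk => by
          rw [coeff_rightSeries, coeff_rightSeries,
            expSum_congr fun j hj => hclt j (lt_of_le_of_lt hj hk)]
        have hMN : coeff N (rightSeries gro 1 (expSum H.family (cs s'))) -
            coeff N (rightSeries gro 1 (expSum H.family (cs s))) =
            -rightMul gro 1 (unary (H.family 1) w + unary (H.family 1) v) := by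
          rw [coeff_rightSeries, coeff_rightSeries, ← map_sub,
            expSum_sub (hcs0 s') (hcs0 s) hclt, ← unary_apply, ← unary_apply, ← map_sub, hcN,
            ← map_neg, ← map_add, ← map_neg]
          congr 2
          abel
        have e1 := coeff_mul_sub_of_order_right (f := P) hglt
        have e2 := coeff_mul_sub_of_order_left
          (h := rightSeries gro 1 (expSum H.family (cs s'))) hglt
        have e3 := coeff_mul_sub_of_order_right (f := gs s) hMlt
        rw [hgN, hP0] at e1
        rw [hgN, coeff_rightSeries, expSum_zero, hmA] at e2
        rw [hMN, (hgs s).constCoeff, one_mul] at e3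
        have e4 : rightMul gro 1 A.m * rightMul gro 0 q - rightMul gro 0 q * rightMul gro 1 A.m =
            -rightMul gro 1 δ - rightMul gro 1 (unary (H.family 1) w + unary (H.family 1) v) := by
          rw [← rightMul_diff_neg_one gro A.m_degree hq, ← map_neg, ← map_sub]
          congr 1
          rw [← sub_sub]
          exact hdq.symm
        rw [← sub_eq_zero]
        linear_combination (norm := abel) e2 + e3 - e1 - hδD - e4)
  have hMC : cs s ∈ H.toLInftyAlgebra.toGradedOps.MC :=
    (LInftyAlgebra.mem_MC_iff _).mpr ⟨hcs0 s, hcs s, fun N => (hs N).1⟩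
  exact ⟨cs s, hMC, gs s, hgs s, by ext N; exact (hs N).2⟩

end Surjectivity

/-! ### Injectivity on moduli spaces -/

section Injectivity

open PowerSeries

variable {Hc : Type*} [AddCommGroup Hc] [Module ℂ Hc] {grc : ℤ → Submodule ℂ Hc}
  {Ho : Type*} [AddCommGroup Ho] [Module ℂ Ho] {gro : ℤ → Submodule ℂ Ho}
  [DirectSum.Decomposition gro]

/-- Matching endpoints alone would leave the next obstruction uncontrolled, so the holonomy of the
flow is prescribed too, as `g` times `exp(R_{M'} R_u + R_u R_{M'})` with `u` of family degree -1.
This factor commutes with `R_{M'}` because `R_{M'}` squares to zero, so the product still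
intertwines `M(c)` and `M(c')`. -/
theorem OCHA.gaugePath_of_intertwined (H : OCHA grc gro) (A : AInftyAlgebra gro)
    (hA : ∀ q, H.n 0 q Fin.elim0 = A.m q)
    (hf : GradedOps.IsQuasiIso H.toLInftyAlgebra.toGradedOps (hochschildOps gro A.m)
      (unary (H.family 1)))
    {c c' : ℕ → Hc} (hc : c ∈ H.toLInftyAlgebra.toGradedOps.MC)
    (hc' : c' ∈ H.toLInftyAlgebra.toGradedOps.MC)
    (h : Intertwined gro (expSum H.family c) (expSum H.family c')) :
    H.toLInftyAlgebra.toGradedOps.GaugePath c c' := by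
  have hmA : H.family 0 Fin.elim0 = A.m := funext hA
  obtain ⟨g, hg, e⟩ := h
  have hcM := (LInftyAlgebra.mem_MC_iff _).mp hc
  have hcM' := (LInftyAlgebra.mem_MC_iff _).mp hc'
  have hMd' : ∀ N, expSum H.family c' N ∈ homDeg gro 1 := expSum_mem H.family_degree hcM'.2.1
  set M' := rightSeries gro 1 (expSum H.family c') with hM'
  have hMM' : M' * M' = 0 := rightSeries_mul_self gro hMd' (H.expSum_family_rel hc')
  have hcoeff0 : ∀ c, coeff 0 (rightSeries gro 1 (expSum H.family c)) = rightMul gro 1 A.m :=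
    fun c => by rw [coeff_rightSeries, expSum_zero, hmA]
  let βs : (ℕ → grc (-1) × homDeg gro (-1)) → ℕ → Hc := fun s => tailSeq fun N => (s N).1
  let us : (ℕ → grc (-1) × homDeg gro (-1)) → ℕ → Multi Ho := fun s => tailSeq fun N => (s N).2
  have hβ0 : ∀ s, βs s 0 = 0 := fun s => tailSeq_zero _
  have hflow : ∀ s, ∃ (C : ℂ → ℕ → Hc) (φ : ℂ → (EndMulti Ho)⟦X⟧),
      H.toLInftyAlgebra.GaugeFlow C (fun _ => βs s) ∧ C 0 = c ∧
      SeriesDeriv φ (fun t => φ t * rightSeries gro 0 (expSum₁ H.family (βs s) (C t))) ∧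
      φ 0 = 1 ∧ (∀ t, IsGroupLike (rightSub gro 0) (φ t)) ∧
      ∀ t, φ t * rightSeries gro 1 (expSum H.family (C t)) =
        rightSeries gro 1 (expSum H.family (C 0)) * φ t := fun s => by
    obtain ⟨C, hC, hC0⟩ := H.toLInftyAlgebra.exists_gaugeFlow hcM.1 (hβ0 s) hcM.2.1
      (tailSeq_mem fun N => (s N).1)
    obtain ⟨φ, hφ⟩ := H.exists_holonomy_of_gaugeFlow hC (by rwa [hC0])
    exact ⟨C, φ, hC, hC0, hφ⟩
  choose C φ hC hC0 hφ hφ0 hφg hφM using hflow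
  let as : (ℕ → grc (-1) × homDeg gro (-1)) → (EndMulti Ho)⟦X⟧ := fun s =>
    M' * rightSeries gro 1 (us s) + rightSeries gro 1 (us s) * M'
  let Es : (ℕ → grc (-1) × homDeg gro (-1)) → (EndMulti Ho)⟦X⟧ := fun s =>
    expSeries (rightSub_commutator_even gro) (as s)
  have hus : ∀ s N, us s N ∈ homDeg gro (-1) := fun s => tailSeq_mem _
  have has0 : ∀ s, coeff 0 (as s) = 0 := fun s => by
    have hu0 : coeff 0 (rightSeries gro 1 (us s)) = 0 := by
      rw [coeff_rightSeries]
      simp only [us]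
      rw [tailSeq_zero, map_zero]
    simp only [as]
    rw [map_add, coeff_zero_mul', coeff_zero_mul', hu0, mul_zero, zero_mul, add_zero]
  have hasg : ∀ s, CoeffsIn (rightSub gro 0) (as s) := fun s N => by
    simp only [as]
    rw [coeff_rightSeries_anticommutator gro odd_one (by decide) hMd' (hus s)]
    refine rightMul_mem gro (Submodule.sum_mem _ fun p _ => Submodule.add_mem _ ?_ ?_)
    · exact circ_mem_homDeg gro (hus s _) (hMd' _) 1
    · exact circ_mem_homDeg gro (hMd' _) (hus s _) 1
  have hEM : ∀ s, M' * Es s = Es s * M' := fun s => expSeries_commute _ (by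
    simp only [as]
    rw [mul_add, add_mul, ← mul_assoc, hMM', zero_mul, mul_assoc _ M' M', hMM', mul_zero, zero_add,
      add_zero, mul_assoc])
  have hEg : ∀ s, IsGroupLike (rightSub gro 0) (Es s) := fun s => isGroupLike_expSeries _ _
  have hβ_congr : ∀ {s s' : ℕ → grc (-1) × homDeg gro (-1)} {k : ℕ}, s k = s' k →
      βs s k = βs s' k := fun h => tailSeq_congr (congrArg Prod.fst h)
  have hu_congr : ∀ {s s' : ℕ → grc (-1) × homDeg gro (-1)} {k : ℕ}, s k = s' k →
      us s k = us s' k := fun h => tailSeq_congr (congrArg Prod.snd h)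
  -- Flows and holonomies were chosen separately for each `s`. Uniqueness of solutions, order by
  -- order, makes their low coefficients depend only on the low terms of `s`.
  have hC_congr : ∀ {s s' : ℕ → grc (-1) × homDeg gro (-1)} {N : ℕ}, (∀ k < N, s k = s' k) →
      ∀ k < N, ∀ t, C s t k = C s' t k := fun {s s' N} h =>
    (hC s).coeff_eq (hC s') (by rw [hC0, hC0]) fun k hk => hβ_congr (h k hk)
  have hX0 : ∀ s t, coeff 0 (rightSeries gro 0 (expSum₁ H.family (βs s) (C s t))) = 0 :=
    fun s t => by rw [coeff_rightSeries, expSum₁_zero, map_zero]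
  have hX_sub : ∀ {s s' : ℕ → grc (-1) × homDeg gro (-1)} {N : ℕ}, (∀ k < N, s k = s' k) →
      ∀ t, coeff N (rightSeries gro 0 (expSum₁ H.family (βs s) (C s t))) -
        coeff N (rightSeries gro 0 (expSum₁ H.family (βs s') (C s' t))) =
        rightMul gro 0 (unary (H.family 1) (βs s N - βs s' N)) := fun {s s' N} h t => by
    rw [coeff_rightSeries, coeff_rightSeries, ← map_sub, expSum₁_sub (hβ0 s) (hβ0 s')
      ((hC s).c_zero t) ((hC s').c_zero t) (fun k hk => hβ_congr (h k hk))
      fun k hk => hC_congr h k hk t, map_sub (unary _)]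
    rfl
  have hX_congr : ∀ {s s' : ℕ → grc (-1) × homDeg gro (-1)} {N : ℕ}, (∀ k < N, s k = s' k) →
      ∀ k < N, ∀ t, coeff k (rightSeries gro 0 (expSum₁ H.family (βs s) (C s t))) =
        coeff k (rightSeries gro 0 (expSum₁ H.family (βs s') (C s' t))) :=
    fun {s s' N} h k hk t => by
      rw [← sub_eq_zero, hX_sub (fun j hj => h j (hj.trans hk)), hβ_congr (h k hk), sub_self,
        map_zero, map_zero]
  have hφ_congr : ∀ {s s' : ℕ → grc (-1) × homDeg gro (-1)} {N : ℕ}, (∀ k < N, s k = s' k) →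
      ∀ k < N, ∀ t, coeff k (φ s t) = coeff k (φ s' t) := fun {s s' N} h =>
    holonomy_coeff_eq (hφ s) (hφ s') (hφ0 s) (hφ0 s') (hX0 s') (hX_congr h)
  have has_congr : ∀ {s s' : ℕ → grc (-1) × homDeg gro (-1)} {N : ℕ}, (∀ k < N, s k = s' k) →
      ∀ k < N, coeff k (as s) = coeff k (as s') := fun {s s' N} h k hk => by
    have h' : ∀ j ≤ k, coeff j (rightSeries gro 1 (us s)) = coeff j (rightSeries gro 1 (us s')) :=
      fun j hj => by
        rw [coeff_rightSeries, coeff_rightSeries, hu_congr (h j (lt_of_le_of_lt hj hk))]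
    simp only [as]
    rw [map_add, map_add, coeff_mul_congr (fun _ _ => rfl) h', coeff_mul_congr h' fun _ _ => rfl]
  have hE_congr : ∀ {s s' : ℕ → grc (-1) × homDeg gro (-1)} {N : ℕ}, (∀ k < N, s k = s' k) →
      ∀ k < N, coeff k (Es s) = coeff k (Es s') := fun {s s' N} h =>
    expSeries_coeff_congr _ (has0 s) (hasg s) (has0 s') (hasg s') (has_congr h)
  obtain ⟨s, hs⟩ := exists_seq
    (fun N s => C s 1 N = c' N ∧ coeff N (φ s 1) = coeff N (g * Es s))
    (fun N s s' h h' => by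
      have h1 : ∀ k < N + 1, s k = s' k := fun k hk => h k (by omega)
      refine ⟨by rw [← hC_congr h1 N N.lt_succ_self]; exact h'.1, ?_⟩
      rw [← hφ_congr h1 N N.lt_succ_self, h'.2]
      exact coeff_mul_congr (fun _ _ => rfl) fun k hk => hE_congr h1 k (by omega))
    (fun N s hgood => by
      rcases Nat.eq_zero_or_pos N with rfl | hN
      · refine ⟨s 0, ?_, ?_⟩
        · rw [(hC _).c_zero, hcM'.1]
        · rw [coeff_zero_mul', (hφg _ _).constCoeff, hg.constCoeff, (hEg _).constCoeff, one_mul]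
      · have hc₁ : C s 1 ∈ H.toLInftyAlgebra.toGradedOps.MC := (hC s).mem_MC (by rwa [hC0]) 1
        have hcM₁ := (LInftyAlgebra.mem_MC_iff _).mp hc₁
        have hClt : ∀ k < N, C s 1 k = c' k := fun k hk => (hgood k hk).1
        set z := C s 1 N - c' N with hz
        have hzmem : z ∈ grc 0 := Submodule.sub_mem _ (hcM₁.2.1 N) (hcM'.2.1 N)
        have hlz : unary (H.l 1) z = 0 := by
          have := expSum_sub (w := H.l) hcM₁.1 hcM'.1 hClt
          rw [hcM₁.2.2, hcM'.2.2, sub_self] at this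
          rw [hz, map_sub]
          exact this.symm
        set G := g * Es s with hG
        have hGg : IsGroupLike (rightSub gro 0) G := hg.mul (rightSub_commutator_even gro) (hEg s)
        set U := φ s 1 - G with hU
        have hUlow : ∀ k < N, coeff k U = 0 := fun k hk => by
          rw [hU, map_sub, (hgood k hk).2, sub_self]
        -- `G⁻¹ φ` is group-like and agrees with 1 below order `N`, so its leading coefficient,
        -- which is that of `U`, lies in the Lie algebra.
        have hUmem : coeff N U ∈ rightSub gro 0 := by
          have hk := (hGg.inv (rightSub_commutator_even gro)).mul (rightSub_commutator_even gro)
            (hφg s 1)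
          have e1 : seriesInv G * φ s 1 = 1 + seriesInv G * U := by
            rw [hU, mul_sub, seriesInv_mul hGg.constCoeff, add_sub_cancel]
          have e2 : ∀ k, k ≠ 0 → coeff k (seriesInv G * φ s 1) = coeff k (seriesInv G * U) :=
            fun k hk => by rw [e1, map_add, coeff_one, if_neg hk, zero_add]
          have := hk.coeff_mem hN.ne' fun k hk hk0 => by
            rw [e2 k hk0, coeff_mul_eq_of_order_right fun j hj => hUlow j (hj.trans hk),
              hUlow k hk, mul_zero]
          rwa [e2 N hN.ne', coeff_mul_eq_of_order_right hUlow, coeff_zero_seriesInv,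
            one_mul] at this
        obtain ⟨y, hy, hyU⟩ := hUmem
        have hfz : unary (H.family 1) z = (hochschildOps gro A.m).diff (-1) y := by
          refine rightMul_injective gro 1 ?_
          rw [rightMul_diff_neg_one gro A.m_degree hy, hyU]
          -- Both `φ` and `G` intertwine with `M(c)` on the left, but with `M(C(1))` and `M(c')` on
          -- the right. The order-`N` part of the difference says that the image of `z` is the
          -- differential of `y`.
          have hUM : U * rightSeries gro 1 (expSum H.family (C s 1)) -
              rightSeries gro 1 (expSum H.family c) * U =
              G * (M' - rightSeries gro 1 (expSum H.family (C s 1))) := by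
            have e1 := hφM s 1
            rw [hC0] at e1
            have e2 : G * M' = rightSeries gro 1 (expSum H.family c) * G := by
              rw [hG, mul_assoc, ← hEM, ← mul_assoc, e, mul_assoc]
            rw [hU, sub_mul, mul_sub, mul_sub, e1, e2]
            abel
          have hlow : ∀ k < N, coeff k (M' - rightSeries gro 1 (expSum H.family (C s 1))) = 0 :=
            fun k hk => by
              rw [map_sub, hM', coeff_rightSeries, coeff_rightSeries,
                expSum_congr fun j hj => hClt j (lt_of_le_of_lt hj hk), sub_self]
          have hdiff : coeff N (M' - rightSeries gro 1 (expSum H.family (C s 1))) =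
              -rightMul gro 1 (unary (H.family 1) z) := by
            rw [map_sub, hM', coeff_rightSeries, coeff_rightSeries, ← map_sub,
              ← neg_sub (expSum H.family (C s 1) N), expSum_sub hcM₁.1 hcM'.1 hClt, ← unary_apply,
              ← unary_apply, ← map_sub, ← hz, map_neg]
          have := congrArg (coeff N) hUM
          rw [map_sub, coeff_mul_eq_of_order_left hUlow, coeff_mul_eq_of_order_right hUlow,
            coeff_mul_eq_of_order_right hlow, hcoeff0, hcoeff0, hGg.constCoeff, one_mul,
            hdiff] at this
          rw [← neg_sub, this, neg_neg]
        obtain ⟨w, hw, hzw, v, hv, hlv, q, hq, hdq⟩ := exists_of_isQuasiIso hf (r := -1)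
          hzmem hlz hy hfz
        -- Lowering `β_N` by `w` moves the endpoint by `-l_1 w = -z`, while the closed `v` does not
        -- move it. The holonomy changes by the image of `-(w + v)` and the stabilizer factor by the
        -- differential of `q`, which together cancel `y`.
        refine ⟨(⟨(s N).1 - (w + v), Submodule.sub_mem _ (s N).1.2 (Submodule.add_mem _ hw hv)⟩,
          ⟨(s N).2 - q, Submodule.sub_mem _ (s N).2.2 hq⟩), ?_⟩
        set s' := Function.update s N _ with hs'
        have hlt : ∀ k < N, s' k = s k := fun k hk => by
          rw [hs', Function.update_of_ne hk.ne]
        have hβN : βs s' N - βs s N = -(w + v) := by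
          simp only [βs, tailSeq_of_ne _ hN.ne', hs', Function.update_self]
          abel
        have huN : us s' N - us s N = -q := by
          simp only [us, tailSeq_of_ne _ hN.ne', hs', Function.update_self]
          exact sub_sub_cancel_left _ _
        constructor
        · have := (hC s').coeff_sub (hC s) (by rw [hC0, hC0]) (fun k hk => hβ_congr (hlt k hk)) 1
          rw [one_smul, ← unary_apply, ← unary_apply, ← map_sub, hβN, map_neg, map_add, hlv,
            add_zero, ← hzw, hz] at this
          linear_combination (norm := abel) this
        · have e1 := holonomy_coeff_sub (hφ s') (hφ s) (hφ0 s') (hφ0 s) (hX0 s') (hX0 s) hN.ne'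
            (hX_congr hlt) (hX_sub hlt) 1
          have e2 := expSeries_coeff_sub (rightSub_commutator_even gro) (has0 s') (hasg s') (has0 s)
            (hasg s) hN.ne' (has_congr hlt)
          have hulow : ∀ k < N, coeff k (rightSeries gro 1 (us s')) =
              coeff k (rightSeries gro 1 (us s)) := fun k hk => by
            rw [coeff_rightSeries, coeff_rightSeries, hu_congr (hlt k hk)]
          have e3 := coeff_mul_sub_of_order_right (f := M') hulow
          have e4 := coeff_mul_sub_of_order_left (h := M') hulow
          have e5 := coeff_mul_sub_of_order_right (f := g) (hE_congr hlt)
          have huN' : coeff N (rightSeries gro 1 (us s')) - coeff N (rightSeries gro 1 (us s)) =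
              -rightMul gro 1 q := by
            rw [coeff_rightSeries, coeff_rightSeries, ← map_sub, huN, map_neg]
          rw [huN', hcoeff0] at e3 e4
          rw [hg.constCoeff, one_mul] at e5
          rw [one_smul, hβN] at e1
          have e6 : coeff N (as s') - coeff N (as s) =
              rightMul gro 0 ((hochschildOps gro A.m).diff (-2) q) := by
            rw [rightMul_diff_neg_two gro A.m_degree hq]
            simp only [as, map_add]
            rw [mul_neg] at e3
            rw [neg_mul] at e4
            linear_combination (norm := abel) e3 + e4
          have e7 : rightMul gro 0 ((hochschildOps gro A.m).diff (-2) q) =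
              coeff N U - rightMul gro 0 (unary (H.family 1) (w + v)) := by
            rw [← hyU, ← map_sub, map_add, ← sub_sub]
            exact congrArg _ hdq.symm
          rw [hU, map_sub] at e7
          rw [map_neg, map_neg] at e1
          have e8 : coeff N (Es s') - coeff N (Es s) = coeff N (as s') - coeff N (as s) := e2
          rw [← sub_eq_zero]
          linear_combination (norm := abel) e1 - e5 - e8 - e6 - e7)
  have hend : C s 1 = c' := funext fun N => (hs N).1
  have := (hC s).gaugePath
  rwa [hC0, hend] at this

end Injectivity

end OpenClosed

end

/-! ### Assembly of the three statements -/

theorem mainTheorem6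
    {Hc : Type*} [AddCommGroup Hc] [Module ℂ Hc]
    (grc : ℤ → Submodule ℂ Hc) [DirectSum.Decomposition grc]
    {Ho : Type*} [AddCommGroup Ho] [Module ℂ Ho]
    (gro : ℤ → Submodule ℂ Ho) [DirectSum.Decomposition gro]
    (A : OpenClosed.AInftyAlgebra gro) (L : OpenClosed.LInftyAlgebra grc)
    (H : OpenClosed.OCHA grc gro)
    (hL : H.toLInftyAlgebra = L) (hA : ∀ q, H.n 0 q Fin.elim0 = A.m q) :
    (∀ c ∈ L.toGradedOps.MC,
      OpenClosed.IsWeakAInftyDeformation gro A.m (Pi.single 0 A.m + H.perturbation c)) ∧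
    (∀ θ : ℕ → OpenClosed.Multi Ho, θ ∈ (OpenClosed.hochschildOps gro A.m).MC ↔
      OpenClosed.IsWeakAInftyDeformation gro A.m (Pi.single 0 A.m + θ)) ∧
    ∃ F : L.toGradedOps.Moduli → (OpenClosed.hochschildOps gro A.m).Moduli,
      (∀ (c : ℕ → Hc) (hc : c ∈ L.toGradedOps.MC),
        ∃ hc' : H.perturbation c ∈ (OpenClosed.hochschildOps gro A.m).MC,
          F (L.toGradedOps.toModuli c hc) =
            (OpenClosed.hochschildOps gro A.m).toModuli (H.perturbation c) hc') ∧
      (OpenClosed.GradedOps.IsQuasiIso L.toGradedOps (OpenClosed.hochschildOps gro A.m)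
          (fun c => H.nStar 1 (fun _ => c)) →
        Function.Bijective F) := by
  subst hL
  have hmod : ∀ c ∈ H.toLInftyAlgebra.toGradedOps.MC,
      H.perturbation c ∈ (OpenClosed.hochschildOps gro A.m).MC := fun c hc =>
    (OpenClosed.mem_hochschildOps_MC_iff gro A _).mpr (H.isWeakAInftyDeformation hA hc)
  refine ⟨fun c hc => H.isWeakAInftyDeformation hA hc,
    OpenClosed.mem_hochschildOps_MC_iff gro A, ?_⟩
  refine ⟨Quotient.lift (fun c => OpenClosed.GradedOps.toModuli _ (H.perturbation c.1)
    (hmod c.1 c.2)) fun c c' h => Quotient.sound ?_, fun c hc => ⟨hmod c hc, rfl⟩, fun hf => ?_⟩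
  -- On both sides gauge equivalence is translated into intertwining, the only form in which the two
  -- structures are compared.
  · refine (OpenClosed.hochschildOps_gaugeSetoid_iff A _ _).mpr ?_
    rw [H.single_add_perturbation hA, H.single_add_perturbation hA]
    exact H.intertwined_of_gaugeSetoid h
  · constructor
    · intro x y
      refine Quotient.inductionOn₂ x y fun c c' h => Quotient.sound ?_
      have h' := (OpenClosed.hochschildOps_gaugeSetoid_iff A _ _).mp (Quotient.exact h)
      rw [H.single_add_perturbation hA, H.single_add_perturbation hA] at h'
      exact Relation.EqvGen.rel _ _ (H.gaugePath_of_intertwined A hA hf c.2 c'.2 h')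
    · intro x
      refine Quotient.inductionOn x fun θ => ?_
      obtain ⟨c, hc, h⟩ := H.exists_MC_intertwined A hA hf θ.2
      refine ⟨Quotient.mk _ ⟨c, hc⟩, Quotient.sound ?_⟩
      refine (OpenClosed.hochschildOps_gaugeSetoid_iff A _ _).mpr ?_
      rw [H.single_add_perturbation hA]
      exact h.symm
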